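/- Let $M$ be a smooth 3-manifold with a volume form $\Omega$, and let $B$ be a smooth vector field on $M$ whose flux 2-form is exact: $\beta=i_B\Omega=d\alpha$ for a smooth 1-form $\alpha$ (that is, $\alpha=A^\flat$ for a vector potential $A$ of $B$; in particular $B$ preserves $\Omega$). Suppose a region of $M$ is smoothly foliated by tori: it is diffeomorphic to $J\times(\mathbb R/\mathbb Z)^2$ for an open interval $J$, and the tori $S_s$ $(s\in J)$, corresponding to $\{s\}\times(\mathbb R/\mathbb Z)^2$, are the level sets $\{\psi=s\}$ in the region of the label $\psi$. Suppose that $B$ is tangent to every $S_s$ (the tori are invariant under $B$) and nowhere zero on the region. Let $n$ be a vector field with $i_n d\psi=1$ there, and let $\mathcal A=i_n\Omega$, which restricts to a $B$-invariant area form on each $S_s$. For each $s\in J$ let $\gamma_s$ be a simple closed $C^1$ curve on $S_s$, transverse to $B$, depending continuously on $s$, and oriented so that $(n,\dot\gamma_s,B)$ is positively oriented with respect to $\Omega$. Put $$\Phi(s)=\int_{\gamma_s}\alpha ,$$ and let $V(s)$ be the volume enclosed by $S_s$, that is, $V(t)-V(s)$ is the volume with respect to $\Omega$ of the region between $S_s$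 and $S_t$ for $s<t$. Every $B$-line that starts on $\gamma_s$ returns to $\gamma_s$, and its mean return time $\bar T(s)$ is well defined as follows. If $B$ winds irrationally on $S_s$, then for every $B$-line starting on $\gamma_s$, with successive returns to $\gamma_s$ at the times $t_1<t_2<\cdots$, the limit $\bar T(s)=\lim_{k\to\infty}t_k/k$ exists, and it does not depend on the starting point. If $S_s$ is rational (that is, otherwise), $\bar T(s)$ is the average of the first return time $T:\gamma_s\to(0,\infty)$ with respect to the invariant area form, i.e. with respect to the density $|i_B\mathcal A|$ that $\mathcal A$ induces on $\gamma_s$: $$\bar T(s)=\int_{\gamma_s}T\,|i_B\mathcal A|\Big/\int_{\gamma_s}|i_B\mathcal A| .$$ Then $V$ and $\Phi$ are differentiable on $J$ and $$dV=\bar T\,d\Phi ,\qquad\text{i.e.}\qquad V'(s)=\bar T(s)\,\Phi'(s)\quad\text{for all } s\in J .$$ -/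

import Mathlib

open Set Filter Topology MeasureTheory
open scoped Manifold ContDiff

/-- The model space of 3-manifolds. -/
abbrev R3 : Type := EuclideanSpace ℝ (Fin 3)

noncomputable section

section Forms

variable {M : Type*} [TopologicalSpace M] [ChartedSpace R3 M]

/-- The coordinate expression at `y` of a `k`-form `η` in the chart around `c`, i.e. the pullback
of `η` by the inverse of that chart. -/
def formInChart {k : ℕ} (η : ∀ x : M, (TangentSpace (𝓡 3) x) [⋀^Fin k]→L[ℝ] ℝ) (c : M) (y : R3) :
    R3 [⋀^Fin k]→L[ℝ] ℝ :=
  ContinuousAlternatingMap.compContinuousLinearMap (η ((extChartAt (𝓡 3) c).symm y))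
    (mfderiv 𝓘(ℝ, R3) (𝓡 3) (extChartAt (𝓡 3) c).symm y)

/-- A differential `k`-form is smooth if its coordinate expressions are. -/
def IsSmoothForm {k : ℕ} (η : ∀ x : M, (TangentSpace (𝓡 3) x) [⋀^Fin k]→L[ℝ] ℝ) : Prop :=
  ∀ c : M, ContDiffOn ℝ ∞ (formInChart η c) (extChartAt (𝓡 3) c).target

/-- `β = dα`, read in charts. -/
def IsExteriorDerivative {k : ℕ} (α : ∀ x : M, (TangentSpace (𝓡 3) x) [⋀^Fin k]→L[ℝ] ℝ)
    (β : ∀ x : M, (TangentSpace (𝓡 3) x) [⋀^Fin (k + 1)]→L[ℝ] ℝ) : Prop :=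
  ∀ c : M, ∀ y ∈ (extChartAt (𝓡 3) c).target,
    formInChart β c y = extDeriv (formInChart α c) y

/-- The interior product `i_X η`. -/
def interiorProduct {k : ℕ} (X : ∀ x : M, TangentSpace (𝓡 3) x)
    (η : ∀ x : M, (TangentSpace (𝓡 3) x) [⋀^Fin (k + 1)]→L[ℝ] ℝ) (x : M) :
    (TangentSpace (𝓡 3) x) [⋀^Fin k]→L[ℝ] ℝ :=
  ContinuousAlternatingMap.curryLeft (E := R3) (η x) (X x)

/-- A volume form: a smooth nowhere vanishing 3-form. -/
structure IsVolumeForm (Ω : ∀ x : M, (TangentSpace (𝓡 3) x) [⋀^Fin 3]→L[ℝ] ℝ) : Prop where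
  smooth : IsSmoothForm Ω
  ne_zero : ∀ x, Ω x ≠ 0

/-- The measure `|Ω|` on `M`. In a chart it has the density `|Ω(∂₁, ∂₂, ∂₃)|` with respect to
Lebesgue measure; the measures obtained so on the chart domains agree on overlaps, and `|Ω|` is
their supremum. -/
def volumeMeasure [MeasurableSpace M] (Ω : ∀ x : M, (TangentSpace (𝓡 3) x) [⋀^Fin 3]→L[ℝ] ℝ) :
    Measure M :=
  ⨆ c : M, Measure.map (extChartAt (𝓡 3) c).symm
    ((volume.restrict (extChartAt (𝓡 3) c).target).withDensity fun y =>
      ENNReal.ofReal |formInChart Ω c y fun i => EuclideanSpace.single i (1 : ℝ)|)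

/-- Smoothness of a vector field on `M`. -/
def IsSmoothVectorField [IsManifold (𝓡 3) ∞ M] (X : ∀ x : M, TangentSpace (𝓡 3) x) : Prop :=
  ContMDiff (𝓡 3) (𝓡 3).tangent ∞ fun x => (⟨x, X x⟩ : TangentBundle (𝓡 3) M)

/-- `α` is a vector potential (a smooth 1-form `A^♭`) of the smooth vector field `B`: the flux
2-form satisfies `i_B Ω = dα`. In particular `B` preserves `Ω`. -/
structure IsMagneticField [IsManifold (𝓡 3) ∞ M]
    (Ω : ∀ x : M, (TangentSpace (𝓡 3) x) [⋀^Fin 3]→L[ℝ] ℝ)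
    (B : ∀ x : M, TangentSpace (𝓡 3) x)
    (α : ∀ x : M, (TangentSpace (𝓡 3) x) [⋀^Fin 1]→L[ℝ] ℝ) : Prop where
  smooth_field : IsSmoothVectorField B
  smooth_potential : IsSmoothForm α
  exact : IsExteriorDerivative α (interiorProduct B Ω)

end Forms

section Foliation

variable {M : Type*} [TopologicalSpace M] [ChartedSpace R3 M]

/-- The torus with label `s`, where `F (s, θ)`, with `θ ∈ ℝ²` taken modulo `ℤ²`, parametrizes a
family of tori. -/
def torus (F : ℝ × (ℝ × ℝ) → M) (s : ℝ) : Set M := range fun θ : ℝ × ℝ => F (s, θ)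

/-- `F` identifies `J × (ℝ²/ℤ²)` diffeomorphically with a region of `M`, which is thereby foliated
by the tori `torus F s`, `s ∈ J`; they are the level sets in the region of the label `ψ`. -/
structure IsTorusFoliation (J : Set ℝ) (F : ℝ × (ℝ × ℝ) → M) (ψ : M → ℝ) : Prop where
  smooth : ContMDiffOn 𝓘(ℝ, ℝ × (ℝ × ℝ)) (𝓡 3) ∞ F (J ×ˢ univ)
  immersion : ∀ s ∈ J, ∀ θ : ℝ × ℝ,
    Function.Injective (mfderiv 𝓘(ℝ, ℝ × (ℝ × ℝ)) (𝓡 3) F (s, θ))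
  eq_iff : ∀ s ∈ J, ∀ s' ∈ J, ∀ θ θ' : ℝ × ℝ,
    F (s, θ) = F (s', θ') ↔ s = s' ∧ ∃ m n : ℤ, θ' = θ + ((m : ℝ), (n : ℝ))
  label : ∀ s ∈ J, ∀ θ : ℝ × ℝ, ψ (F (s, θ)) = s

/-- The tori are invariant under `B` (flux surfaces): `B` is tangent to each of them. -/
def IsTangentToTori (J : Set ℝ) (F : ℝ × (ℝ × ℝ) → M) (B : ∀ x : M, TangentSpace (𝓡 3) x) : Prop :=
  ∀ s ∈ J, ∀ θ : ℝ × ℝ, ∃ v : ℝ × ℝ,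
    B (F (s, θ)) = mfderiv 𝓘(ℝ, ℝ × (ℝ × ℝ)) (𝓡 3) F (s, θ) ((0 : ℝ), v)

/-- `i_n dψ = 1` on the tori. -/
def IsTransverseField (J : Set ℝ) (F : ℝ × (ℝ × ℝ) → M) (ψ : M → ℝ)
    (n : ∀ x : M, TangentSpace (𝓡 3) x) : Prop :=
  ∀ s ∈ J, ∀ x ∈ torus F s, (mfderiv (𝓡 3) 𝓘(ℝ, ℝ) ψ x (n x) : ℝ) = 1

/-- `V` is the volume enclosed by the tori, as a function of the label: it increases from `s` to
`t` by the volume of the region between the tori `s` and `t`. -/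
def IsEnclosedVolume [MeasurableSpace M]
    (Ω : ∀ x : M, (TangentSpace (𝓡 3) x) [⋀^Fin 3]→L[ℝ] ℝ)
    (J : Set ℝ) (F : ℝ × (ℝ × ℝ) → M) (V : ℝ → ℝ) : Prop :=
  ∀ s ∈ J, ∀ t ∈ J, s ≤ t →
    V t - V s = (volumeMeasure Ω (⋃ r ∈ Ioc s t, torus F r)).toReal

/-- `B` winds irrationally on the torus `s`: along all `B`-lines on it, lifted to `ℝ²`, the ratio of
the two angles tends to one and the same irrational number. -/
def WindsIrrationally (B : ∀ x : M, TangentSpace (𝓡 3) x) (F : ℝ × (ℝ × ℝ) → M) (s : ℝ) : Prop :=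
  ∃ ι : ℝ, Irrational ι ∧ ∀ θ : ℝ → ℝ × ℝ, Continuous θ →
    IsMIntegralCurve (I := 𝓡 3) (fun t => F (s, θ t)) B →
    Tendsto (fun t => (θ t).2 / (θ t).1) atTop (𝓝 ι)

end Foliation

section Curves

variable {M : Type*} [TopologicalSpace M] [ChartedSpace R3 M]

/-- The velocity of the curve `g` at the parameter `u`. -/
def velocity (g : ℝ → M) (u : ℝ) : TangentSpace (𝓡 3) (g u) :=
  mfderiv 𝓘(ℝ, ℝ) (𝓡 3) g u (1 : ℝ)

/-- `g`, of period 1, is a simple closed `C¹` curve on `S`, transverse to `B` there. -/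
structure IsTransverseClosedCurve (B : ∀ x : M, TangentSpace (𝓡 3) x) (S : Set M) (g : ℝ → M) :
    Prop where
  contMDiff : ContMDiff 𝓘(ℝ, ℝ) (𝓡 3) 1 g
  periodic : Function.Periodic g 1
  simple : InjOn g (Ico 0 1)
  mem : ∀ u, g u ∈ S
  transverse : ∀ u, LinearIndependent ℝ ![velocity g u, B (g u)]

/-- The line integral `∫_g α` over the closed curve `g` of period 1. -/
def lineIntegral (α : ∀ x : M, (TangentSpace (𝓡 3) x) [⋀^Fin 1]→L[ℝ] ℝ) (g : ℝ → M) : ℝ :=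
  ∫ u in (0 : ℝ)..1, α (g u) ![velocity g u]

/-- `T u` is the first return time to the curve `g` of the `B`-line starting at `g u`. -/
def IsFirstReturnTime (B : ∀ x : M, TangentSpace (𝓡 3) x) (g : ℝ → M) (T : ℝ → ℝ) : Prop :=
  ∀ u, ∃ c : ℝ → M, IsMIntegralCurve (I := 𝓡 3) c B ∧ c 0 = g u ∧
    0 < T u ∧ c (T u) ∈ range g ∧ ∀ t ∈ Ioo 0 (T u), c t ∉ range g

/-- The limiting average return time to `K` of the line `c` is `τ`: the times `t ≥ 0` with
`c t ∈ K` form a sequence `0 = t₀ < t₁ < …`, and `tₙ / n → τ`. -/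
def HasLimitingReturnTime (c : ℝ → M) (K : Set M) (τ : ℝ) : Prop :=
  ∃ t : ℕ → ℝ, t 0 = 0 ∧ StrictMono t ∧ range t = {r | 0 ≤ r ∧ c r ∈ K} ∧
    Tendsto (fun n : ℕ => t n / n) atTop (𝓝 τ)

/-- `τ` is the average of the first return time to the curve `g` with respect to the invariant
area form `𝒜 = i_n Ω`, i.e. with respect to the density `|i_B 𝒜|` that it induces on `g`. -/
def IsAreaMeanReturnTime (Ω : ∀ x : M, (TangentSpace (𝓡 3) x) [⋀^Fin 3]→L[ℝ] ℝ)
    (B n : ∀ x : M, TangentSpace (𝓡 3) x) (g : ℝ → M) (τ : ℝ) : Prop :=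
  let w : ℝ → ℝ := fun u => |interiorProduct B (interiorProduct n Ω) (g u) ![velocity g u]|
  ∃ T : ℝ → ℝ, IsFirstReturnTime B g T ∧
    IntervalIntegrable w volume 0 1 ∧ IntervalIntegrable (fun u => T u * w u) volume 0 1 ∧
    0 < ∫ u in (0 : ℝ)..1, w u ∧
    τ = (∫ u in (0 : ℝ)..1, T u * w u) / ∫ u in (0 : ℝ)..1, w u

/-- `τ` is the mean return time of `B`-lines to the curve `g` on the torus `s`: on an irrational
torus, the limiting average return time of every `B`-line starting on `g`; on a rational one, the
average of the return time with respect to the invariant area. -/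
def IsMeanReturnTime (Ω : ∀ x : M, (TangentSpace (𝓡 3) x) [⋀^Fin 3]→L[ℝ] ℝ)
    (B n : ∀ x : M, TangentSpace (𝓡 3) x) (F : ℝ × (ℝ × ℝ) → M) (s : ℝ) (g : ℝ → M)
    (τ : ℝ) : Prop :=
  (WindsIrrationally B F s → ∀ u, ∃ c : ℝ → M, IsMIntegralCurve (I := 𝓡 3) c B ∧ c 0 = g u ∧
    HasLimitingReturnTime c (range g) τ) ∧
  (¬ WindsIrrationally B F s → IsAreaMeanReturnTime Ω B n g τ)

end Curves

end

/-! Both derivatives are quantities on a single torus: `V'` is its area and `Φ'` is the flux of `B`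
across the curve. Slicing the torus into orbit segments between consecutive crossings writes the
area as the integral of the return time against the flux density, so `V' / Φ'` is the mean return
time.

In the coordinates `(s, θ)` write `F^* Ω = f ds ∧ dθ₁ ∧ dθ₂`, let `v` be the angular part of `B`,
and let `a₀, a₁, a₂` be the coefficients of `F^* α`. Then `d(F^* α) = F^*(i_B Ω)` says two things
(`isTorusField`). On a torus the potential is closed, so its integral over a loop depends only on
the homology class; and the flux form `f (v₂ dθ₁ - v₁ dθ₂)` is the `s`-derivative of `a₁ dθ₁ + a₂
dθ₂` minus the differential of the periodic function `a₀`. Hence the flux form is closed, with a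
stream function `H` on the universal cover, and the increment `holonomy H m₀` is the `s`-derivative
of the integral of `α` over the class `m₀` (`hasDerivAt_period`). The curves lift to the plane
continuously in `s`, so their class is constant and this increment is `Φ'`. On the other side,
Fubini gives `V' = ∫ |f|` (`hasDerivAt_enclosedVolume`).

In the plane each level of `H` is exactly one orbit (`exists_flow_eq`), no orbit closes
(`flow_injective`), and the lifted curve crosses every level once. So (level, time since the curve)
are global coordinates, in which the area `|f| dx dy` is Lebesgue measure (`withDensity_eq_map`).
The class `m₀` is primitive; completed by a class `e` to a basis of the lattice, it makes
`translateTime H φ g e` the first return time and the return map the rotation of the level by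
`-holonomy H e` modulo `holonomy H m₀`. The orbit segments up to the first return tile the torus,
whence `∫ |f|` is the integral of the return time over one period of the level
(`lintegral_density_eq`). Dividing by `holonomy H m₀` gives the average with respect to the density
`|i_B 𝒜|`, because that density is `dH` along the curve. If the torus is irrational so is the
rotation (`irrational_of_tendsto`), and Weyl equidistribution makes the return times of every orbit
average to the same number. -/

section Flow

/-! ### Global flows of bounded Lipschitz vector fields -/

variable {E : Type*} [NormedAddCommGroup E] [NormedSpace ℝ E]

/-- `φ` is the global flow of the vector field `v`. -/
structure IsFlow (v : E → E) (φ : ℝ → E → E) : Prop where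
  zero : ∀ x, φ 0 x = x
  deriv : ∀ t x, HasDerivAt (fun r => φ r x) (v (φ t x)) t
  continuous : Continuous fun p : ℝ × E => φ p.1 p.2
  unique : ∀ (c : ℝ → E), (∀ t, HasDerivAt c (v (c t)) t) → ∀ t, c t = φ t (c 0)

theorem exists_integralCurve_of_lipschitz_bounded [CompleteSpace E] {v : E → E} {K L : NNReal}
    (hK : LipschitzWith K v) (hL : ∀ x, ‖v x‖ ≤ L) (x : E) (N : ℕ) :
    ∃ c : ℝ → E, c 0 = x ∧ ∀ t ∈ Ioo (-(N : ℝ)) N, HasDerivAt c (v (c t)) t := by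
  have h0 : (0 : ℝ) ∈ Icc (-(N : ℝ)) N := by simp
  -- At speed at most `L` a curve stays within distance `L * N` during the time `N`, so this radius
  -- allows the whole interval.
  have hP : IsPicardLindelof (fun _ => v) (⟨0, h0⟩ : Icc (-(N : ℝ)) N) x (L * N) 0 L K :=
    { lipschitzOnWith := fun _ _ => hK.lipschitzOnWith
      continuousOn := fun _ _ => continuousOn_const
      norm_le := fun _ _ y _ => hL y
      mul_max_le := by simp }
  obtain ⟨c, hc0, hc⟩ := hP.exists_eq_forall_mem_Icc_hasDerivWithinAt₀
  refine ⟨c, hc0, fun t ht => (hc t (Ioo_subset_Icc_self ht)).hasDerivAt (Icc_mem_nhds ht.1 ht.2)⟩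

/-- Grönwall's inequality; negative times are reduced to positive ones by reversing the field. -/
theorem integralCurve_dist_le {v : E → E} {K : NNReal} (hK : LipschitzWith K v) {c d : ℝ → E}
    (hc : ∀ t, HasDerivAt c (v (c t)) t) (hd : ∀ t, HasDerivAt d (v (d t)) t) (t : ℝ) :
    dist (c t) (d t) ≤ dist (c 0) (d 0) * Real.exp (K * |t|) := by
  have key : ∀ (w : E → E), LipschitzWith K w → ∀ c d : ℝ → E, (∀ t, HasDerivAt c (w (c t)) t) →
      (∀ t, HasDerivAt d (w (d t)) t) → ∀ t, 0 ≤ t →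
      dist (c t) (d t) ≤ dist (c 0) (d 0) * Real.exp (K * t) := by
    intro w hw c d hc hd t ht
    have := dist_le_of_trajectories_ODE (v := fun _ => w) (a := 0) (b := t) (fun _ => hw)
      (fun r _ => (hc r).continuousAt.continuousWithinAt) (fun r _ => (hc r).hasDerivWithinAt)
      (fun r _ => (hd r).continuousAt.continuousWithinAt) (fun r _ => (hd r).hasDerivWithinAt)
      le_rfl t ⟨ht, le_rfl⟩
    simpa using this
  rcases le_total 0 t with h | h
  · rw [abs_of_nonneg h]; exact key v hK c d hc hd t h
  · have h2 := key (fun x => - v x) hK.neg (fun r => c (-r)) (fun r => d (-r))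
      (fun r => by simpa [Function.comp_def] using (hc (-r)).scomp r (hasDerivAt_neg r))
      (fun r => by simpa [Function.comp_def] using (hd (-r)).scomp r (hasDerivAt_neg r)) (-t) (by linarith)
    rw [abs_of_nonpos h]
    simpa using h2

/-- Uniqueness makes the solutions on the intervals `(-N, N)` agree, and they glue to a flow. Joint
continuity combines Grönwall's estimate in the initial point with continuity in time. -/
theorem exists_isFlow [CompleteSpace E] {v : E → E} {K L : NNReal}
    (hK : LipschitzWith K v) (hL : ∀ x, ‖v x‖ ≤ L) : ∃ φ, IsFlow v φ := by
  choose c hc0 hc using exists_integralCurve_of_lipschitz_bounded hK hL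
  have hagree : ∀ x (m n : ℕ) (t : ℝ), |t| < m → |t| < n → c x m t = c x n t := by
    intro x
    have : ∀ (m n : ℕ), m ≤ n → ∀ t : ℝ, |t| < m → c x m t = c x n t := by
      intro m n hmn t ht
      have hmn' : (m : ℝ) ≤ n := by exact_mod_cast hmn
      have hm : (0 : ℝ) < m := (abs_nonneg t).trans_lt ht
      refine ODE_solution_unique_of_mem_Ioo (v := fun _ => v) (K := K) (s := fun _ => univ)
        (a := -(m : ℝ)) (b := m) (t₀ := 0) (fun _ _ => hK.lipschitzOnWith)
        ⟨by linarith, hm⟩ (fun r hr => ⟨hc x m r hr, trivial⟩)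
        (fun r hr => ⟨hc x n r ⟨by linarith [hr.1], by linarith [hr.2]⟩, trivial⟩)
        (by rw [hc0, hc0]) (abs_lt.1 ht)
    intro m n t hm hn
    rcases le_total m n with h | h
    · exact this m n h t hm
    · exact (this n m h t hn).symm
  -- Any interval containing `t` would do; this is an explicit choice of one.
  let φ : ℝ → E → E := fun t x => c x (⌊|t|⌋₊ + 1) t
  have hlt : ∀ t : ℝ, |t| < ((⌊|t|⌋₊ + 1 : ℕ) : ℝ) := fun t => by
    push_cast; exact Nat.lt_floor_add_one _
  have hzero : ∀ x, φ 0 x = x := fun x => hc0 x _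
  have hderiv : ∀ t x, HasDerivAt (fun r => φ r x) (v (φ t x)) t := by
    intro t x
    have h1 := hc x (⌊|t|⌋₊ + 1) t (abs_lt.1 (hlt t))
    refine h1.congr_of_eventuallyEq ?_
    have : ∀ᶠ r in 𝓝 t, |r| < ((⌊|t|⌋₊ + 1 : ℕ) : ℝ) :=
      continuous_abs.continuousAt.eventually_lt continuousAt_const (hlt t)
    filter_upwards [this] with r hr
    exact hagree x _ _ r (hlt r) hr
  refine ⟨φ, hzero, hderiv, ?_, ?_⟩
  · rw [continuous_iff_continuousAt]
    rintro ⟨t, x⟩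
    have h2 : Tendsto (fun p : ℝ × E => dist p.2 x * Real.exp (K * |p.1|) + dist (φ p.1 x) (φ t x))
        (𝓝 (t, x)) (𝓝 0) := by
      have hcont : ContinuousAt (fun p : ℝ × E => φ p.1 x) (t, x) :=
        ContinuousAt.comp (f := Prod.fst) (g := fun r => φ r x) (hderiv t x).continuousAt
          continuousAt_fst
      have h3 : ContinuousAt (fun p : ℝ × E => dist p.2 x * Real.exp (K * |p.1|)
          + dist (φ p.1 x) (φ t x)) (t, x) :=
        ((continuous_snd.dist continuous_const).mul
          (by fun_prop : Continuous fun p : ℝ × E => Real.exp (K * |p.1|))).continuousAt.add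
          (hcont.dist continuousAt_const)
      simpa [ContinuousAt] using h3
    rw [ContinuousAt, tendsto_iff_dist_tendsto_zero]
    refine squeeze_zero (fun _ => dist_nonneg) (fun p => ?_) h2
    refine (dist_triangle _ (φ p.1 x) _).trans (add_le_add ?_ le_rfl)
    have := integralCurve_dist_le hK (c := fun r => φ r p.2) (d := fun r => φ r x)
      (fun r => hderiv r _) (fun r => hderiv r _) p.1
    simpa [hzero] using this
  · intro d hd t
    have := integralCurve_dist_le hK hd (fun r => hderiv r (d 0)) t
    simpa [hzero] using this

namespace IsFlow

variable {v : E → E} {φ : ℝ → E → E}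

theorem add (h : IsFlow v φ) (s t : ℝ) (x : E) : φ (s + t) x = φ s (φ t x) := by
  have := h.unique (fun r => φ (r + t) x) (fun r => by
    simpa using (h.deriv (r + t) x).comp_add_const r t) s
  simpa using this

theorem neg_apply (h : IsFlow v φ) (t : ℝ) (x : E) : φ (-t) (φ t x) = x := by
  rw [← h.add, neg_add_cancel, h.zero]

/-- Translating an integral curve by a period of the field gives an integral curve. -/
theorem add_vec (h : IsFlow v φ) {w : E} (hw : ∀ x, v (x + w) = v x) (t : ℝ) (x : E) :
    φ t (x + w) = φ t x + w := by
  have := h.unique (fun r => φ r x + w) (fun r => by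
    simpa [hw] using (h.deriv r x).add_const w) t
  simpa [h.zero] using this.symm

theorem continuous_time (h : IsFlow v φ) (x : E) : Continuous fun t => φ t x :=
  h.continuous.comp (by fun_prop : Continuous fun t : ℝ => (t, x))

end IsFlow

end Flow

/-! ### Stream functions on the universal cover of a torus -/

section PlanarFlux

/-- The vector of `ℝ²` with the given integer coordinates. -/
def latticeVec (m : ℤ × ℤ) : ℝ × ℝ := ((m.1 : ℝ), (m.2 : ℝ))

@[simp] theorem latticeVec_fst (m : ℤ × ℤ) : (latticeVec m).1 = m.1 := rfl
@[simp] theorem latticeVec_snd (m : ℤ × ℤ) : (latticeVec m).2 = m.2 := rfl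

theorem latticeVec_add (m k : ℤ × ℤ) : latticeVec (m + k) = latticeVec m + latticeVec k := by
  ext <;> simp

theorem latticeVec_neg (m : ℤ × ℤ) : latticeVec (-m) = -latticeVec m := by
  ext <;> simp

@[simp] theorem latticeVec_zero : latticeVec 0 = 0 := by
  ext <;> simp

theorem exists_lattice_add_mem_unitSquare (x : ℝ × ℝ) :
    ∃! m : ℤ × ℤ, x + latticeVec m ∈ Ico (0 : ℝ) 1 ×ˢ Ico (0 : ℝ) 1 := by
  refine ⟨(-⌊x.1⌋, -⌊x.2⌋), ?_, ?_⟩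
  · have h1 := Int.floor_le x.1
    have h2 := Int.lt_floor_add_one x.1
    have h3 := Int.floor_le x.2
    have h4 := Int.lt_floor_add_one x.2
    simp only [mem_prod, mem_Ico, Prod.fst_add, Prod.snd_add, latticeVec_fst, latticeVec_snd]
    push_cast
    refine ⟨⟨?_, ?_⟩, ?_, ?_⟩ <;> linarith
  · rintro ⟨a, b⟩ ⟨⟨h1, h2⟩, h3, h4⟩
    simp only [Prod.fst_add, Prod.snd_add, latticeVec_fst, latticeVec_snd] at h1 h2 h3 h4
    have e1 : ⌊x.1⌋ = -a := by rw [Int.floor_eq_iff]; push_cast; constructor <;> linarith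
    have e2 : ⌊x.2⌋ = -b := by rw [Int.floor_eq_iff]; push_cast; constructor <;> linarith
    simp [e1, e2]

theorem exists_bound_of_lattice_periodic {F : Type*} [NormedAddCommGroup F] {g : ℝ × ℝ → F}
    (hg : Continuous g) (hper : ∀ m x, g (x + latticeVec m) = g x) :
    ∃ L : NNReal, ∀ x, ‖g x‖ ≤ L := by
  obtain ⟨C, hC⟩ := ((isCompact_Icc (a := (0 : ℝ)) (b := 1)).prod
    (isCompact_Icc (a := (0 : ℝ)) (b := 1))).exists_bound_of_continuousOn hg.continuousOn
  refine ⟨C.toNNReal, fun x => ?_⟩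
  obtain ⟨m, hm, -⟩ := exists_lattice_add_mem_unitSquare x
  rw [← hper m x]
  exact (hC _ ⟨Ico_subset_Icc_self hm.1, Ico_subset_Icc_self hm.2⟩).trans (Real.le_coe_toNNReal C)

/-- By compactness of the unit square, a doubly periodic `C¹` field is bounded together with its
derivative, hence globally Lipschitz. -/
theorem exists_isFlow_of_lattice_periodic {g : ℝ × ℝ → ℝ × ℝ} (hg : ContDiff ℝ 1 g)
    (hper : ∀ m x, g (x + latticeVec m) = g x) : ∃ φ, IsFlow g φ := by
  obtain ⟨L, hL⟩ := exists_bound_of_lattice_periodic hg.continuous hper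
  obtain ⟨K, hK⟩ := exists_bound_of_lattice_periodic (hg.continuous_fderiv one_ne_zero)
    (fun m x => by
      have : (fun y => g (y + latticeVec m)) = g := funext fun y => hper m y
      rw [← fderiv_comp_add_right, this])
  exact exists_isFlow (lipschitzWith_of_nnnorm_fderiv_le (hg.differentiable one_ne_zero)
    (fun x => hK x)) hL

/-- On the universal cover of a torus with area form `f dx ∧ dy`, `v` is a nowhere vanishing
doubly periodic vector field whose flux 1-form `f (v₂ dx - v₁ dy)` is the differential of `H`. -/
structure IsStreamFunction (f : ℝ × ℝ → ℝ) (v : ℝ × ℝ → ℝ × ℝ) (H : ℝ × ℝ → ℝ) : Prop where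
  contDiff_field : ContDiff ℝ 1 v
  contDiff_density : ContDiff ℝ 1 f
  density_ne : ∀ x, f x ≠ 0
  field_ne : ∀ x, v x ≠ 0
  field_periodic : ∀ m x, v (x + latticeVec m) = v x
  density_periodic : ∀ m x, f (x + latticeVec m) = f x
  hasFDerivAt : ∀ x, HasFDerivAt H ((f x * (v x).2) • ContinuousLinearMap.fst ℝ ℝ ℝ -
    (f x * (v x).1) • ContinuousLinearMap.snd ℝ ℝ ℝ) x

/-- The increment of the stream function `H` along a lattice vector. -/
def holonomy (H : ℝ × ℝ → ℝ) (m : ℤ × ℤ) : ℝ := H (latticeVec m) - H 0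

namespace IsStreamFunction

variable {f : ℝ × ℝ → ℝ} {v : ℝ × ℝ → ℝ × ℝ} {H : ℝ × ℝ → ℝ}

theorem continuous (h : IsStreamFunction f v H) : Continuous H :=
  continuous_iff_continuousAt.2 fun x => (h.hasFDerivAt x).continuousAt

theorem hasDerivAt_comp (h : IsStreamFunction f v H) {c : ℝ → ℝ × ℝ} {c' : ℝ × ℝ} {t : ℝ}
    (hc : HasDerivAt c c' t) :
    HasDerivAt (fun r => H (c r)) (f (c t) * ((v (c t)).2 * c'.1 - (v (c t)).1 * c'.2)) t := by
  refine ((h.hasFDerivAt (c t)).comp_hasDerivAt t hc).congr_deriv ?_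
  simp
  ring

/-- The differential of `H` is doubly periodic although `H` need not be, so a lattice translation
changes `H` by a constant. -/
theorem add_latticeVec (h : IsStreamFunction f v H) (m : ℤ × ℤ) (x : ℝ × ℝ) :
    H (x + latticeVec m) = H x + holonomy H m := by
  have hd : ∀ y, HasFDerivAt (fun z => H (z + latticeVec m) - H z) (0 : ℝ × ℝ →L[ℝ] ℝ) y := by
    intro y
    have h1 : HasFDerivAt (fun z => H (z + latticeVec m)) _ y :=
      (hasFDerivAt_comp_add_right (f := H) (latticeVec m)).2 (h.hasFDerivAt (y + latticeVec m))
    rw [h.field_periodic, h.density_periodic] at h1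
    exact (h1.sub (h.hasFDerivAt y)).congr_fderiv (sub_self _)
  have := is_const_of_fderiv_eq_zero (𝕜 := ℝ) (fun y => (hd y).differentiableAt)
    (fun y => (hd y).fderiv) x 0
  simp only [zero_add] at this
  rw [holonomy]; linarith

theorem holonomy_add (h : IsStreamFunction f v H) (m k : ℤ × ℤ) :
    holonomy H (m + k) = holonomy H m + holonomy H k := by
  have h1 := h.add_latticeVec k (latticeVec m)
  have h2 := h.add_latticeVec m 0
  have h3 := h.add_latticeVec (m + k) 0
  rw [zero_add] at h2 h3
  rw [← latticeVec_add] at h1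
  linarith

theorem holonomy_zero : holonomy H 0 = 0 := by simp [holonomy]

theorem holonomy_neg (h : IsStreamFunction f v H) (m : ℤ × ℤ) :
    holonomy H (-m) = -holonomy H m := by
  have := h.holonomy_add m (-m)
  rw [add_neg_cancel, holonomy_zero] at this
  linarith

theorem holonomy_zsmul (h : IsStreamFunction f v H) (k : ℤ) (m : ℤ × ℤ) :
    holonomy H (k • m) = k * holonomy H m := by
  induction k using Int.induction_on with
  | zero => simp [holonomy_zero]
  | succ i ih => rw [add_smul, one_smul, h.holonomy_add, ih]; push_cast; ring
  | pred i ih => rw [sub_smul, one_smul, sub_eq_add_neg, h.holonomy_add, h.holonomy_neg, ih]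
                 push_cast; ring

theorem flow_eq (h : IsStreamFunction f v H) {φ : ℝ → ℝ × ℝ → ℝ × ℝ} (hφ : IsFlow v φ) (t : ℝ)
    (x : ℝ × ℝ) : H (φ t x) = H x := by
  have hd : ∀ r, HasDerivAt (fun r => H (φ r x)) 0 r := fun r => by
    have := h.hasDerivAt_comp (hφ.deriv r x)
    rwa [mul_comm (v (φ r x)).2, sub_self, mul_zero] at this
  have := is_const_of_deriv_eq_zero (fun r => (hd r).differentiableAt) (fun r => (hd r).deriv) t 0
  simpa [hφ.zero] using this

/-- The linear function on `ℝ²` that is increasing along `v` near `x₀`. -/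
def alongField (v : ℝ × ℝ → ℝ × ℝ) (x₀ : ℝ × ℝ) : ℝ × ℝ →L[ℝ] ℝ :=
  (v x₀).1 • ContinuousLinearMap.fst ℝ ℝ ℝ + (v x₀).2 • ContinuousLinearMap.snd ℝ ℝ ℝ

theorem alongField_apply (v : ℝ × ℝ → ℝ × ℝ) (x₀ y : ℝ × ℝ) :
    alongField v x₀ y = (v x₀).1 * y.1 + (v x₀).2 * y.2 := by simp [alongField]

/-- Near `x₀`, points are determined by `H` and by a linear function increasing along `v`. -/
theorem exists_ball_injOn (h : IsStreamFunction f v H) (x₀ : ℝ × ℝ) :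
    ∃ r > 0, (∀ z ∈ Metric.ball x₀ r, 0 < alongField v x₀ (v z)) ∧
      InjOn (fun z => (alongField v x₀ z, H z)) (Metric.ball x₀ r) := by
  have hpos : 0 < alongField v x₀ (v x₀) := by
    rw [alongField_apply]
    have : v x₀ ≠ 0 := h.field_ne x₀
    by_contra hle
    refine this ?_
    ext <;> simp <;> nlinarith [mul_self_nonneg (v x₀).1, mul_self_nonneg (v x₀).2]
  have hc : Continuous fun z => alongField v x₀ (v z) :=
    (alongField v x₀).continuous.comp h.contDiff_field.continuous
  obtain ⟨r, hr, hball⟩ := Metric.eventually_nhds_iff_ball.1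
    (hc.continuousAt.eventually (lt_mem_nhds hpos))
  refine ⟨r, hr, hball, fun y hy z hz hyz => ?_⟩
  obtain ⟨hl, hH⟩ := Prod.mk.inj hyz
  by_contra hne
  have hd : ∀ t : ℝ, HasDerivAt (fun t : ℝ => y + t • (z - y)) (z - y) t := fun t => by
    simpa using ((hasDerivAt_id t).smul_const (z - y)).const_add y
  -- By Rolle, `dH` kills `z - y` at a point of the segment, so `z - y` is parallel to `v` there.
  -- The linear function vanishes on `z - y` but is positive on `v`, so `z = y`.
  obtain ⟨t, ht, ht0⟩ := exists_hasDerivAt_eq_zero (f := fun t : ℝ => H (y + t • (z - y)))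
    zero_lt_one (h.continuous.comp (by fun_prop)).continuousOn (by simp [hH])
    (fun t _ => h.hasDerivAt_comp (hd t))
  have hmem : y + t • (z - y) ∈ Metric.ball x₀ r :=
    (convex_ball x₀ r).add_smul_sub_mem hy hz (Ioo_subset_Icc_self ht)
  have h1 := hball _ hmem
  have h2 := (mul_eq_zero.1 ht0).resolve_left (h.density_ne _)
  generalize v (y + t • (z - y)) = w at h1 h2
  rw [alongField_apply] at h1
  have h3 : (v x₀).1 * (z - y).1 + (v x₀).2 * (z - y).2 = 0 := by
    rw [← alongField_apply, map_sub]; linarith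
  apply hne
  have e1 : ((v x₀).1 * w.1 + (v x₀).2 * w.2) * (z - y).1 = 0 := by
    linear_combination w.1 * h3 + (v x₀).2 * h2
  have e2 : ((v x₀).1 * w.1 + (v x₀).2 * w.2) * (z - y).2 = 0 := by
    linear_combination w.2 * h3 - (v x₀).1 * h2
  have e3 : z - y = 0 := by
    ext
    · exact (mul_eq_zero.1 e1).resolve_left h1.ne'
    · exact (mul_eq_zero.1 e2).resolve_left h1.ne'
  exact (sub_eq_zero.1 e3).symm

/-- Nearby points on the same level are joined by a short orbit. -/
theorem eventually_exists_flow_eq (h : IsStreamFunction f v H) {φ : ℝ → ℝ × ℝ → ℝ × ℝ}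
    (hφ : IsFlow v φ) (x₀ : ℝ × ℝ) {ε : ℝ} (hε : 0 < ε) :
    ∀ᶠ p : (ℝ × ℝ) × (ℝ × ℝ) in 𝓝 (x₀, x₀), H p.1 = H p.2 → ∃ t, |t| < ε ∧ φ t p.1 = p.2 := by
  obtain ⟨r, hr, hpos, hinj⟩ := h.exists_ball_injOn x₀
  set ℓ := alongField v x₀
  have hφ0 : Tendsto (fun p : ℝ × (ℝ × ℝ) => φ p.1 p.2) (𝓝 (0, x₀)) (𝓝 x₀) := by
    have := hφ.continuous.tendsto (0, x₀)
    simpa [hφ.zero] using this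
  have hnear := hφ0 (Metric.ball_mem_nhds x₀ hr)
  obtain ⟨δ', hδ', hδball⟩ := Metric.mem_nhds_iff.1 hnear
  set δ := min (ε / 2) (δ' / 2)
  have hδ : 0 < δ := lt_min (by linarith) (by linarith)
  have hδε : δ < ε := (min_le_left _ _).trans_lt (by linarith)
  have hδδ' : δ < δ' := (min_le_right _ _).trans_lt (by linarith)
  have hin : ∀ t, |t| ≤ δ → ∀ y ∈ Metric.ball x₀ δ', φ t y ∈ Metric.ball x₀ r := by
    intro t ht y hy
    refine hδball (a := (t, y)) ?_
    rw [Metric.mem_ball, Prod.dist_eq]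
    exact max_lt (by simpa using ht.trans_lt hδδ') hy
  have hℓd : ∀ t, HasDerivAt (fun t => ℓ (φ t x₀)) (ℓ (v (φ t x₀))) t := fun t =>
    ℓ.hasFDerivAt.comp_hasDerivAt t (hφ.deriv t x₀)
  have hmono : StrictMonoOn (fun t => ℓ (φ t x₀)) (Icc (-δ) δ) := by
    refine strictMonoOn_of_deriv_pos (convex_Icc _ _)
      (fun t _ => (hℓd t).continuousAt.continuousWithinAt) (fun t ht => ?_)
    rw [(hℓd t).deriv]
    rw [interior_Icc] at ht
    exact hpos _ (hin t (abs_le.2 ⟨ht.1.le, ht.2.le⟩) x₀ (Metric.mem_ball_self hδ'))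
  have hlt1 : ℓ x₀ < ℓ (φ δ x₀) := by
    have := hmono (a := 0) (b := δ) ⟨by linarith, hδ.le⟩ ⟨by linarith, le_rfl⟩ hδ
    simpa [hφ.zero] using this
  have hlt2 : ℓ (φ (-δ) x₀) < ℓ x₀ := by
    have := hmono (a := -δ) (b := 0) ⟨le_rfl, by linarith⟩ ⟨by linarith, hδ.le⟩ (by linarith)
    simpa [hφ.zero] using this
  have hcφ : ∀ t, Continuous fun p : (ℝ × ℝ) × (ℝ × ℝ) => ℓ (φ t p.1) := fun t =>
    ℓ.continuous.comp (hφ.continuous.comp (by fun_prop :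
      Continuous fun p : (ℝ × ℝ) × (ℝ × ℝ) => (t, p.1)))
  have hc2 : Continuous fun p : (ℝ × ℝ) × (ℝ × ℝ) => ℓ p.2 := ℓ.continuous.comp continuous_snd
  have ev1 := (hc2.continuousAt (x := (x₀, x₀))).eventually_lt (hcφ δ).continuousAt hlt1
  have ev2 := ((hcφ (-δ)).continuousAt (x := (x₀, x₀))).eventually_lt hc2.continuousAt hlt2
  have ev3 : ∀ᶠ p : (ℝ × ℝ) × (ℝ × ℝ) in 𝓝 (x₀, x₀), p.1 ∈ Metric.ball x₀ δ' :=
    continuousAt_fst.eventually (Metric.ball_mem_nhds x₀ hδ')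
  have ev4 : ∀ᶠ p : (ℝ × ℝ) × (ℝ × ℝ) in 𝓝 (x₀, x₀), p.2 ∈ Metric.ball x₀ r :=
    continuousAt_snd.eventually (Metric.ball_mem_nhds x₀ hr)
  filter_upwards [ev1, ev2, ev3, ev4] with p h1 h2 h3 h4 hH
  -- A short piece of the orbit of `p.1` attains the value of `ℓ` at `p.2`; having the same `H` as
  -- well, the two points coincide.
  obtain ⟨t, ht, hteq⟩ := intermediate_value_Icc (f := fun t => ℓ (φ t p.1))
    (by linarith : -δ ≤ δ) (ℓ.continuous.comp (hφ.continuous_time p.1)).continuousOn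
    ⟨h2.le, h1.le⟩
  have habs : |t| ≤ δ := abs_le.2 ht
  refine ⟨t, habs.trans_lt hδε, hinj (hin t habs _ h3) h4 ?_⟩
  simp only [Prod.mk.injEq]
  exact ⟨hteq, by rw [h.flow_eq hφ, hH]⟩

/-- The plane retracts onto the level of `x` along a flow transverse to the levels. -/
theorem exists_retraction_to_level (h : IsStreamFunction f v H) (x : ℝ × ℝ) :
    ∃ P : ℝ × ℝ → ℝ × ℝ, Continuous P ∧ (∀ z, H (P z) = H x) ∧ ∀ z, H z = H x → P z = z := by
  set N : ℝ × ℝ → ℝ := fun z => f z * ((v z).1 ^ 2 + (v z).2 ^ 2)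
  have hN : ∀ z, N z ≠ 0 := by
    intro z
    refine mul_ne_zero (h.density_ne z) fun h0 => h.field_ne z ?_
    ext <;> simp <;> nlinarith [sq_nonneg (v z).1, sq_nonneg (v z).2]
  -- Normalized so that `dH(ξ) = 1`: the flow of `ξ` raises `H` at unit rate.
  set ξ : ℝ × ℝ → ℝ × ℝ := fun z => ((v z).2 / N z, -(v z).1 / N z)
  have hv1 : ContDiff ℝ 1 fun z => (v z).1 := contDiff_fst.comp h.contDiff_field
  have hv2 : ContDiff ℝ 1 fun z => (v z).2 := contDiff_snd.comp h.contDiff_field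
  have hNc : ContDiff ℝ 1 N := h.contDiff_density.mul ((hv1.pow 2).add (hv2.pow 2))
  have hξ : ContDiff ℝ 1 ξ := (hv2.div hNc hN).prodMk (hv1.neg.div hNc hN)
  obtain ⟨χ, hχ⟩ := exists_isFlow_of_lattice_periodic hξ (fun m z => by
    simp only [ξ, N, h.field_periodic, h.density_periodic])
  have hHχ : ∀ r z, H (χ r z) = H z + r := by
    intro r z
    have hd : ∀ r, HasDerivAt (fun r => H (χ r z) - r) 0 r := fun r => by
      have h1 := (h.hasDerivAt_comp (hχ.deriv r z)).sub (hasDerivAt_id r)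
      have h2 := hN (χ r z)
      refine h1.congr_deriv ?_
      have h3 : f (χ r z) * ((v (χ r z)).1 ^ 2 + (v (χ r z)).2 ^ 2) ≠ 0 := h2
      simp only [ξ, N]
      have h4 := (mul_ne_zero_iff.1 h3).2
      have h5 := (mul_ne_zero_iff.1 h3).1
      field_simp
      ring
    have := is_const_of_deriv_eq_zero (fun r => (hd r).differentiableAt)
      (fun r => (hd r).deriv) r 0
    simp only [hχ.zero] at this
    linarith
  refine ⟨fun z => χ (H x - H z) z, ?_, fun z => ?_, fun z hz => ?_⟩
  · exact hχ.continuous.comp ((continuous_const.sub h.continuous).prodMk continuous_id)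
  · rw [hHχ]; ring
  · simp [hz, hχ.zero]

/-- Each level of the stream function is a single orbit. -/
theorem exists_flow_eq (h : IsStreamFunction f v H) {φ : ℝ → ℝ × ℝ → ℝ × ℝ}
    (hφ : IsFlow v φ) {x y : ℝ × ℝ} (hxy : H x = H y) : ∃ t, φ t x = y := by
  obtain ⟨P, hP, hPH, hPfix⟩ := h.exists_retraction_to_level x
  -- Nearby points retract to nearby points of one level, which lie on a common orbit. So `S` is
  -- open and closed in the connected plane.
  set S : Set (ℝ × ℝ) := {z | ∃ t, φ t x = P z}
  have hnear : ∀ z, ∀ᶠ w in 𝓝 z, (w ∈ S ↔ z ∈ S) := by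
    intro z
    have h1 := h.eventually_exists_flow_eq hφ (P z) one_pos
    have h2 : Tendsto (fun w => (P z, P w)) (𝓝 z) (𝓝 (P z, P z)) :=
      tendsto_const_nhds.prodMk_nhds (hP.tendsto z)
    filter_upwards [h2.eventually h1] with w hw
    obtain ⟨t, -, ht⟩ := hw (by simp [hPH])
    constructor
    · rintro ⟨s, hs⟩
      exact ⟨-t + s, by rw [hφ.add, hs, ← ht, hφ.neg_apply]⟩
    · rintro ⟨s, hs⟩
      exact ⟨t + s, by rw [hφ.add, hs, ht]⟩
  have hclopen : IsClopen S := by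
    refine ⟨⟨isOpen_iff_mem_nhds.2 fun z hz => ?_⟩, isOpen_iff_mem_nhds.2 fun z hz => ?_⟩
    · filter_upwards [hnear z] with w hw using fun hw' => hz (hw.1 hw')
    · filter_upwards [hnear z] with w hw using hw.2 hz
  have huniv := hclopen.eq_univ ⟨x, 0, by rw [hφ.zero, hPfix x rfl]⟩
  have hy : y ∈ S := huniv ▸ mem_univ y
  obtain ⟨t, ht⟩ := hy
  exact ⟨t, by rw [ht, hPfix y hxy.symm]⟩

/-- If some holonomy is nonzero, the levels of the stream function are unbounded. -/
theorem exists_level_far (h : IsStreamFunction f v H) {m : ℤ × ℤ} (hm : 0 < holonomy H m)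
    (a K : ℝ) : ∃ y, H y = a ∧ -(m.2 : ℝ) * y.1 + m.1 * y.2 = K := by
  have hmne : (0 : ℝ) < (m.1 : ℝ) ^ 2 + (m.2 : ℝ) ^ 2 := by
    by_contra hle
    have e1 : (m.1 : ℝ) = 0 := by nlinarith [sq_nonneg (m.1 : ℝ), sq_nonneg (m.2 : ℝ)]
    have e2 : (m.2 : ℝ) = 0 := by nlinarith [sq_nonneg (m.1 : ℝ), sq_nonneg (m.2 : ℝ)]
    have : m = 0 := by ext <;> [exact_mod_cast e1; exact_mod_cast e2]
    rw [this, holonomy_zero] at hm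
    exact hm.false
  set D := (m.1 : ℝ) ^ 2 + (m.2 : ℝ) ^ 2
  -- On the line through `x` in the direction `m` the linear form is constantly `K`, while `H` takes
  -- every value because each step by `m` adds a positive amount.
  set x : ℝ × ℝ := (K / D * -m.2, K / D * m.1)
  set F : ℝ → ℝ := fun r => H (x + r • latticeVec m)
  have hF : Continuous F := h.continuous.comp (by fun_prop)
  have hk : ∀ k : ℤ, F k = H x + k * holonomy H m := by
    intro k
    have : (k : ℝ) • latticeVec m = latticeVec (k • m) := by ext <;> simp
    simp only [F, this, h.add_latticeVec, h.holonomy_zsmul]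
  obtain ⟨k, hk1⟩ := exists_int_gt ((a - H x) / holonomy H m)
  obtain ⟨j, hj1⟩ := exists_int_lt ((a - H x) / holonomy H m)
  rw [div_lt_iff₀ hm] at hk1
  rw [lt_div_iff₀ hm] at hj1
  have hrange : a ∈ range F := by
    refine mem_range_of_exists_le_of_exists_ge hF ⟨j, ?_⟩ ⟨k, ?_⟩
    · rw [hk]; linarith
    · rw [hk]; linarith
  obtain ⟨r, hr⟩ := hrange
  refine ⟨_, hr, ?_⟩
  simp only [x, Prod.fst_add, Prod.snd_add, Prod.smul_fst, Prod.smul_snd, latticeVec_fst,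
    latticeVec_snd, smul_eq_mul]
  have : K / D * D = K := div_mul_cancel₀ K hmne.ne'
  linear_combination this

/-- If some holonomy is nonzero, there are no closed orbits. -/
theorem flow_injective (h : IsStreamFunction f v H) {φ : ℝ → ℝ × ℝ → ℝ × ℝ}
    (hφ : IsFlow v φ) {m : ℤ × ℤ} (hm : 0 < holonomy H m) (x : ℝ × ℝ) :
    Function.Injective fun t => φ t x := by
  have key : ∀ t, 0 < t → φ t x ≠ x := by
    intro t ht htx
    have hper : Function.Periodic (fun r => φ r x) t := fun r => by
      simp only [hφ.add, htx]
    have hcont : Continuous fun r => -(m.2 : ℝ) * (φ r x).1 + m.1 * (φ r x).2 := by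
      have := hφ.continuous_time x
      fun_prop
    obtain ⟨C, hC⟩ := (isCompact_Icc (a := (0 : ℝ)) (b := t)).exists_bound_of_continuousOn
      hcont.continuousOn
    -- A closed orbit would be bounded, yet it is the whole level of `x`, on which the linear form
    -- exceeds the bound `C`.
    obtain ⟨y, hy, hyK⟩ := h.exists_level_far hm (H x) (C + 1)
    obtain ⟨r, hr⟩ := h.exists_flow_eq hφ hy.symm
    obtain ⟨r', hr', hrr⟩ := hper.exists_mem_Ico₀ ht r
    have h1 := hC r' (Ico_subset_Icc_self hr')
    have h2 : y = φ r' x := hr.symm.trans hrr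
    rw [← h2, hyK, Real.norm_eq_abs] at h1
    linarith [le_abs_self (C + 1)]
  have key2 : ∀ s t, s < t → φ s x ≠ φ t x := by
    intro s t hst heq
    refine key (t - s) (by linarith) ?_
    rw [sub_eq_neg_add, hφ.add, ← heq, hφ.neg_apply]
  intro s t hst
  rcases lt_trichotomy s t with h1 | h1 | h1
  · exact absurd hst (key2 s t h1)
  · exact h1
  · exact absurd hst.symm (key2 t s h1)

end IsStreamFunction

end PlanarFlux

/-! ### Crossing levels, translate times, and the homology class of a transverse curve -/

noncomputable section TransverseLift

/-- `g` is the lift to the plane of a simple closed curve on the torus that is transverse to the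
flow `φ` of `v`; it represents the homology class `m₀`, and `w` is the rate of change of the stream
function `H` along `g`. -/
structure IsTransverseLift (f : ℝ × ℝ → ℝ) (v : ℝ × ℝ → ℝ × ℝ) (H : ℝ × ℝ → ℝ)
    (φ : ℝ → ℝ × ℝ → ℝ × ℝ) (g : ℝ → ℝ × ℝ) (w : ℝ → ℝ) (m₀ : ℤ × ℤ) : Prop where
  stream : IsStreamFunction f v H
  flow : IsFlow v φ
  continuous : Continuous g
  add_one : ∀ u, g (u + 1) = g u + latticeVec m₀
  simple : ∀ u u' m, g u' = g u + latticeVec m → ∃ k : ℤ, u' = u + k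
  hasDerivAt : ∀ u, HasDerivAt (fun u => H (g u)) (w u) u
  rate_pos : ∀ u, 0 < w u
  rate_continuous : Continuous w

/-- The point at which the curve `g` crosses the level `a` of `H`. -/
def crossing (H : ℝ × ℝ → ℝ) (g : ℝ → ℝ × ℝ) (a : ℝ) : ℝ × ℝ :=
  g (Function.invFun (fun u => H (g u)) a)

/-- The time that the flow takes from the curve `g` to the point `x`. -/
def hitTime (H : ℝ × ℝ → ℝ) (φ : ℝ → ℝ × ℝ → ℝ × ℝ) (g : ℝ → ℝ × ℝ) (x : ℝ × ℝ) : ℝ :=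
  Classical.epsilon fun t => φ t (crossing H g (H x)) = x

/-- The time that the orbit starting on `g` at the level `a` takes to the translate of `g` by `m`. -/
def translateTime (H : ℝ × ℝ → ℝ) (φ : ℝ → ℝ × ℝ → ℝ × ℝ) (g : ℝ → ℝ × ℝ) (m : ℤ × ℤ) (a : ℝ) : ℝ :=
  hitTime H φ g (crossing H g (a - holonomy H m) + latticeVec m)

namespace IsTransverseLift

variable {f : ℝ × ℝ → ℝ} {v : ℝ × ℝ → ℝ × ℝ} {H : ℝ × ℝ → ℝ} {φ : ℝ → ℝ × ℝ → ℝ × ℝ}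
  {g : ℝ → ℝ × ℝ} {w : ℝ → ℝ} {m₀ : ℤ × ℤ}

theorem strictMono (h : IsTransverseLift f v H φ g w m₀) : StrictMono fun u => H (g u) :=
  strictMono_of_deriv_pos fun u => by rw [(h.hasDerivAt u).deriv]; exact h.rate_pos u

theorem level_add_one (h : IsTransverseLift f v H φ g w m₀) (u : ℝ) :
    H (g (u + 1)) = H (g u) + holonomy H m₀ := by
  rw [h.add_one, h.stream.add_latticeVec]

theorem holonomy_pos (h : IsTransverseLift f v H φ g w m₀) : 0 < holonomy H m₀ := by
  have h1 := h.level_add_one 0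
  have h2 : H (g 0) < H (g (0 + 1)) := h.strictMono (by norm_num)
  linarith

theorem continuous_level (h : IsTransverseLift f v H φ g w m₀) : Continuous fun u => H (g u) :=
  h.stream.continuous.comp h.continuous

theorem apply_add_int (h : IsTransverseLift f v H φ g w m₀) (u : ℝ) (k : ℤ) :
    g (u + k) = g u + latticeVec (k • m₀) := by
  induction k using Int.induction_on with
  | zero => simp
  | succ i ih =>
    push_cast at ih ⊢
    rw [← add_assoc, h.add_one, ih, add_smul, one_smul, latticeVec_add, add_assoc]
  | pred i ih =>
    have := h.add_one (u + ((-(i : ℤ) - 1 : ℤ) : ℝ))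
    have e : u + ((-(i : ℤ) - 1 : ℤ) : ℝ) + 1 = u + ((-(i : ℤ) : ℤ) : ℝ) := by push_cast; ring
    rw [e, ih, ← sub_eq_iff_eq_add] at this
    rw [← this, sub_smul, one_smul, sub_eq_add_neg (-(i : ℤ) • m₀), latticeVec_add,
      latticeVec_neg]
    abel

/-- Each period adds the same positive amount to `H ∘ g`. With strict monotonicity this makes the
level a global parameter of the lifted curve. -/
theorem surjective (h : IsTransverseLift f v H φ g w m₀) :
    Function.Surjective fun u => H (g u) := by
  intro a
  have hk : ∀ k : ℤ, H (g k) = H (g 0) + k * holonomy H m₀ := fun k => by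
    have := h.apply_add_int 0 k
    rw [zero_add] at this
    rw [this, h.stream.add_latticeVec, h.stream.holonomy_zsmul]
  have hpos := h.holonomy_pos
  obtain ⟨k, hk1⟩ := exists_int_gt ((a - H (g 0)) / holonomy H m₀)
  obtain ⟨j, hj1⟩ := exists_int_lt ((a - H (g 0)) / holonomy H m₀)
  rw [div_lt_iff₀ hpos] at hk1
  rw [lt_div_iff₀ hpos] at hj1
  refine mem_range_of_exists_le_of_exists_ge h.continuous_level ⟨j, ?_⟩ ⟨k, ?_⟩
  · simp only [hk]; linarith
  · simp only [hk]; linarith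

theorem level_crossing (h : IsTransverseLift f v H φ g w m₀) (a : ℝ) : H (crossing H g a) = a :=
  Function.rightInverse_invFun h.surjective a

theorem crossing_level (h : IsTransverseLift f v H φ g w m₀) (u : ℝ) :
    crossing H g (H (g u)) = g u :=
  congrArg g (Function.leftInverse_invFun h.strictMono.injective u)

theorem continuous_crossing (h : IsTransverseLift f v H φ g w m₀) :
    Continuous (crossing H g) := by
  refine h.continuous.comp ?_
  have hmono : StrictMono (Function.invFun fun u => H (g u)) := fun a b hab => by
    by_contra hle
    have h1 := h.strictMono.monotone (not_lt.1 hle)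
    have ha := Function.rightInverse_invFun h.surjective a
    have hb := Function.rightInverse_invFun h.surjective b
    exact absurd (hb.symm.le.trans (h1.trans ha.le)) (not_le.2 hab)
  exact hmono.monotone.continuous_of_surjective
    (Function.invFun_surjective h.strictMono.injective)

theorem crossing_add (h : IsTransverseLift f v H φ g w m₀) (a : ℝ) :
    crossing H g (a + holonomy H m₀) = crossing H g a + latticeVec m₀ := by
  obtain ⟨u, rfl⟩ := h.surjective a
  simp only
  rw [h.crossing_level, ← h.add_one, ← h.level_add_one, h.crossing_level]

theorem flow_injective (h : IsTransverseLift f v H φ g w m₀) (x : ℝ × ℝ) :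
    Function.Injective fun t => φ t x :=
  h.stream.flow_injective h.flow h.holonomy_pos x

theorem flow_hitTime (h : IsTransverseLift f v H φ g w m₀) (x : ℝ × ℝ) :
    φ (hitTime H φ g x) (crossing H g (H x)) = x :=
  Classical.epsilon_spec (h.stream.exists_flow_eq h.flow (h.level_crossing (H x)))

theorem hitTime_eq (h : IsTransverseLift f v H φ g w m₀) {x : ℝ × ℝ} {t : ℝ}
    (ht : φ t (crossing H g (H x)) = x) : hitTime H φ g x = t :=
  h.flow_injective _ ((h.flow_hitTime x).trans ht.symm)

theorem hitTime_flow (h : IsTransverseLift f v H φ g w m₀) (t a : ℝ) :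
    hitTime H φ g (φ t (crossing H g a)) = t :=
  h.hitTime_eq (by rw [h.stream.flow_eq h.flow, h.level_crossing])

theorem continuous_hitTime (h : IsTransverseLift f v H φ g w m₀) :
    Continuous (hitTime H φ g) := by
  rw [continuous_iff_continuousAt]
  intro x
  rw [Metric.continuousAt_iff']
  intro ε hε
  set t₀ := hitTime H φ g x
  have h1 := h.stream.eventually_exists_flow_eq h.flow x hε
  have h2 : Continuous fun y => (φ t₀ (crossing H g (H y)), y) := by
    have h3 : Continuous fun y => (t₀, crossing H g (H y)) :=
      continuous_const.prodMk (h.continuous_crossing.comp h.stream.continuous)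
    exact (h.flow.continuous.comp h3).prodMk continuous_id
  have h3 := h2.tendsto x
  rw [h.flow_hitTime x] at h3
  -- The crossing at the level of `y`, moved for the time `t₀`, lands near `y` on the same level; a
  -- correction shorter than `ε` brings it to `y`.
  filter_upwards [h3.eventually h1] with y hy
  obtain ⟨t, ht, hty⟩ := hy (by rw [h.stream.flow_eq h.flow, h.level_crossing])
  rw [← h.flow.add] at hty
  rw [h.hitTime_eq hty, Real.dist_eq]
  simpa using ht

theorem flow_translateTime (h : IsTransverseLift f v H φ g w m₀) (m : ℤ × ℤ) (a : ℝ) :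
    φ (translateTime H φ g m a) (crossing H g a)
      = crossing H g (a - holonomy H m) + latticeVec m := by
  have := h.flow_hitTime (crossing H g (a - holonomy H m) + latticeVec m)
  rwa [h.stream.add_latticeVec, h.level_crossing, sub_add_cancel] at this

theorem translateTime_eq (h : IsTransverseLift f v H φ g w m₀) {m : ℤ × ℤ} {a t : ℝ}
    (ht : φ t (crossing H g a) = crossing H g (a - holonomy H m) + latticeVec m) :
    translateTime H φ g m a = t :=
  h.flow_injective _ ((h.flow_translateTime m a).trans ht.symm)

theorem continuous_translateTime (h : IsTransverseLift f v H φ g w m₀) (m : ℤ × ℤ) :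
    Continuous (translateTime H φ g m) :=
  h.continuous_hitTime.comp
    ((h.continuous_crossing.comp (continuous_id.sub continuous_const)).add continuous_const)

/-- The cocycle identity. On reaching the translate by `m`, shift back by `m`: the flow is unchanged
and the orbit restarts on `g` at the level `a - holonomy H m`. -/
theorem translateTime_add (h : IsTransverseLift f v H φ g w m₀) (m k : ℤ × ℤ) (a : ℝ) :
    translateTime H φ g (m + k) a
      = translateTime H φ g m a + translateTime H φ g k (a - holonomy H m) := by
  refine h.translateTime_eq ?_
  rw [add_comm (translateTime H φ g m a), h.flow.add, h.flow_translateTime,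
    h.flow.add_vec (h.stream.field_periodic m), h.flow_translateTime, h.stream.holonomy_add,
    latticeVec_add, sub_sub, add_assoc, add_comm (latticeVec k)]

theorem translateTime_self (h : IsTransverseLift f v H φ g w m₀) (a : ℝ) :
    translateTime H φ g m₀ a = 0 := by
  refine h.translateTime_eq ?_
  rw [h.flow.zero, ← h.crossing_add, sub_add_cancel]

theorem translateTime_zero (h : IsTransverseLift f v H φ g w m₀) (a : ℝ) :
    translateTime H φ g 0 a = 0 := by
  refine h.translateTime_eq ?_
  simp [h.flow.zero, IsStreamFunction.holonomy_zero]

theorem translateTime_neg (h : IsTransverseLift f v H φ g w m₀) (m : ℤ × ℤ) (a : ℝ) :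
    translateTime H φ g (-m) a = -translateTime H φ g m (a + holonomy H m) := by
  have := h.translateTime_add (-m) m a
  rw [neg_add_cancel, h.translateTime_zero, h.stream.holonomy_neg, sub_neg_eq_add] at this
  linarith

theorem translateTime_zsmul_self (h : IsTransverseLift f v H φ g w m₀) (k : ℤ) (a : ℝ) :
    translateTime H φ g (k • m₀) a = 0 := by
  induction k using Int.induction_on generalizing a with
  | zero => simpa using h.translateTime_zero a
  | succ i ih => rw [add_smul, one_smul, h.translateTime_add, ih, h.translateTime_self, add_zero]
  | pred i ih =>
    rw [sub_smul, one_smul, sub_eq_add_neg, h.translateTime_add, ih, h.translateTime_neg,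
      h.translateTime_self, neg_zero, add_zero]

/-- Expand the cocycle for `m` and `m₀` in both orders; the time to the translate by `m₀` is zero
because `g` coincides with that translate up to reparametrization. -/
theorem translateTime_periodic (h : IsTransverseLift f v H φ g w m₀) (m : ℤ × ℤ) :
    Function.Periodic (translateTime H φ g m) (holonomy H m₀) := by
  intro a
  have h1 := h.translateTime_add m m₀ (a + holonomy H m₀)
  have h2 := h.translateTime_add m₀ m (a + holonomy H m₀)
  rw [h.translateTime_self, add_comm m₀ m, add_sub_cancel_right] at h2
  rw [h.translateTime_self] at h1
  linarith

/-- At time zero `g` meets its own translate by `m`; as the curve on the torus is simple, this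
happens only after a whole number of periods. -/
theorem exists_zsmul_of_translateTime_eq_zero (h : IsTransverseLift f v H φ g w m₀) {m : ℤ × ℤ}
    {a : ℝ} (hm : translateTime H φ g m a = 0) : ∃ k : ℤ, m = k • m₀ := by
  have h1 := h.flow_translateTime m a
  rw [hm, h.flow.zero] at h1
  obtain ⟨k, hk⟩ := h.simple _ _ _ h1
  refine ⟨k, ?_⟩
  have h2 := h.apply_add_int (Function.invFun (fun u => H (g u)) (a - holonomy H m)) k
  rw [← hk] at h2
  have h3 := (h1.symm.trans h2 :
    crossing H g (a - holonomy H m) + latticeVec m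
      = crossing H g (a - holonomy H m) + latticeVec (k • m₀))
  have h4 := add_left_cancel h3
  have e1 := congrArg Prod.fst h4
  have e2 := congrArg Prod.snd h4
  simp only [latticeVec_fst, latticeVec_snd, Int.cast_inj] at e1 e2
  exact Prod.ext e1 e2

/-- The translate is disjoint from `g`, so the time to it never vanishes; by continuity it has a
constant sign. -/
theorem translateTime_sign (h : IsTransverseLift f v H φ g w m₀) {m : ℤ × ℤ}
    (hm : ∀ k : ℤ, m ≠ k • m₀) :
    (∀ a, 0 < translateTime H φ g m a) ∨ ∀ a, translateTime H φ g m a < 0 := by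
  have hne : ∀ a, translateTime H φ g m a ≠ 0 := fun a ha => by
    obtain ⟨k, hk⟩ := h.exists_zsmul_of_translateTime_eq_zero ha
    exact hm k hk
  by_contra! hcon
  obtain ⟨⟨a, ha⟩, b, hb⟩ := hcon
  obtain ⟨z, hz⟩ := mem_range_of_exists_le_of_exists_ge (h.continuous_translateTime m)
    ⟨a, ha⟩ ⟨b, hb⟩
  exact hne z hz

theorem translateTime_nsmul_pos (h : IsTransverseLift f v H φ g w m₀) {m : ℤ × ℤ}
    (hm : ∀ a, 0 < translateTime H φ g m a) (n : ℕ) (a : ℝ) :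
    0 < translateTime H φ g ((n + 1) • m) a := by
  induction n generalizing a with
  | zero => simpa using hm a
  | succ n ih => rw [succ_nsmul, h.translateTime_add]; exact add_pos (ih a) (hm _)

/-- The homology class of a simple closed transverse curve is primitive. -/
theorem gcd_eq_one (h : IsTransverseLift f v H φ g w m₀) : Int.gcd m₀.1 m₀.2 = 1 := by
  have hne : m₀ ≠ 0 := fun h0 => by
    have := h.holonomy_pos
    rw [h0, IsStreamFunction.holonomy_zero] at this
    exact this.false
  have hd : 0 < Int.gcd m₀.1 m₀.2 := by
    rw [Int.gcd_pos_iff]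
    by_contra! hcon
    exact hne (Prod.ext hcon.1 hcon.2)
  obtain ⟨d, hdd⟩ : ∃ d : ℕ, Int.gcd m₀.1 m₀.2 = d + 1 := ⟨_, (Nat.succ_pred_eq_of_pos hd).symm⟩
  obtain ⟨x, hx⟩ := Int.gcd_dvd_left m₀.1 m₀.2
  obtain ⟨y, hy⟩ := Int.gcd_dvd_right m₀.1 m₀.2
  have hm : m₀ = (d + 1) • ((x, y) : ℤ × ℤ) := by
    rw [← hdd]
    ext <;> simp [← hx, ← hy]
  -- Otherwise the time to the translate by `(x, y)` has one sign, and a sum of `d + 1` such times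
  -- would be the time to the translate by `m₀`, which is zero.
  have hmul : ∃ k : ℤ, ((x, y) : ℤ × ℤ) = k • m₀ := by
    by_contra! hcon
    rcases h.translateTime_sign hcon with hs | hs
    · have := h.translateTime_nsmul_pos hs d 0
      rw [← hm, h.translateTime_self] at this
      exact this.false
    · have hs' : ∀ a, 0 < translateTime H φ g (-((x, y) : ℤ × ℤ)) a := fun a => by
        rw [h.translateTime_neg]
        linarith [hs (a + holonomy H (x, y))]
      have := h.translateTime_nsmul_pos hs' d 0
      rw [smul_neg, ← hm, h.translateTime_neg, h.translateTime_self, neg_zero] at this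
      exact this.false
  obtain ⟨k, hk⟩ := hmul
  have e1 := congrArg Prod.fst hk
  have e2 := congrArg Prod.snd hk
  simp only [Prod.smul_fst, Prod.smul_snd, smul_eq_mul] at e1 e2
  set D : ℤ := (Int.gcd m₀.1 m₀.2 : ℤ) with hD
  have hz : D * k = 1 := by
    by_contra hne1
    have f1 : (D * k - 1) * m₀.1 = 0 := by
      have : m₀.1 = D * (k * m₀.1) := by rw [← e1]; exact hx
      linear_combination -this
    have f2 : (D * k - 1) * m₀.2 = 0 := by
      have : m₀.2 = D * (k * m₀.2) := by rw [← e2]; exact hy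
      linear_combination -this
    have hne2 : D * k - 1 ≠ 0 := fun h0 => hne1 (by linarith)
    exact hne (Prod.ext ((mul_eq_zero.1 f1).resolve_left hne2)
      ((mul_eq_zero.1 f2).resolve_left hne2))
  have h1 : D = 1 := Int.eq_one_of_mul_eq_one_right (by positivity) hz
  rw [hD] at h1
  exact_mod_cast h1

/-- A class `e` complementary to that of the curve; the time to the translate by `e` is the first
return time. -/
theorem exists_complement (h : IsTransverseLift f v H φ g w m₀) :
    ∃ e : ℤ × ℤ, (∀ m : ℤ × ℤ, ∃ i j : ℤ, m = i • m₀ + j • e) ∧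
      ∀ a, 0 < translateTime H φ g e a := by
  obtain ⟨x, y, hxy⟩ := Int.isCoprime_iff_gcd_eq_one.2 h.gcd_eq_one
  -- The Bézout relation says that `m₀` and `e` have determinant 1, so they form a basis of the
  -- lattice.
  set e : ℤ × ℤ := (-y, x) with he
  have hspan : ∀ m : ℤ × ℤ, m = (m.1 * x + m.2 * y) • m₀ + (m₀.1 * m.2 - m₀.2 * m.1) • e := by
    intro m
    ext
    · simp [he]; linear_combination -m.1 * hxy
    · simp [he]; linear_combination -m.2 * hxy
  have hne : ∀ k : ℤ, e ≠ k • m₀ := by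
    intro k hk
    have e1 := congrArg Prod.fst hk
    have e2 := congrArg Prod.snd hk
    simp only [he, Prod.smul_fst, Prod.smul_snd, smul_eq_mul] at e1 e2
    rw [e2, show y = -(k * m₀.1) by linarith] at hxy
    have : (0 : ℤ) = 1 := by linear_combination hxy
    exact zero_ne_one this
  -- The sign of `e` is still free and is chosen to make the time positive.
  rcases h.translateTime_sign hne with hs | hs
  · exact ⟨e, fun m => ⟨_, _, hspan m⟩, hs⟩
  · refine ⟨-e, fun m => ⟨m.1 * x + m.2 * y, -(m₀.1 * m.2 - m₀.2 * m.1), ?_⟩, fun a => ?_⟩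
    · rw [neg_smul_neg]; exact hspan m
    · rw [h.translateTime_neg]; linarith [hs (a + holonomy H e)]

theorem translateTime_span (h : IsTransverseLift f v H φ g w m₀) (e : ℤ × ℤ) (i j : ℤ) (a : ℝ) :
    translateTime H φ g (i • m₀ + j • e) a = translateTime H φ g (j • e) a := by
  rw [add_comm, h.translateTime_add, h.translateTime_zsmul_self, add_zero]

theorem translateTime_add_one_zsmul (h : IsTransverseLift f v H φ g w m₀) (e : ℤ × ℤ) (j : ℤ)
    (a : ℝ) : translateTime H φ g ((j + 1) • e) a
      = translateTime H φ g (j • e) a + translateTime H φ g e (a - j * holonomy H e) := by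
  rw [add_smul, one_smul, h.translateTime_add, h.stream.holonomy_zsmul]

theorem strictMono_translateTime (h : IsTransverseLift f v H φ g w m₀) {e : ℤ × ℤ}
    (he : ∀ a, 0 < translateTime H φ g e a) (a : ℝ) :
    StrictMono fun j : ℤ => translateTime H φ g (j • e) a :=
  strictMono_int_of_lt_succ fun j => by
    rw [h.translateTime_add_one_zsmul]
    linarith [he (a - j * holonomy H e)]

/-- The cocycle identity turns the `n`-th return time into a Birkhoff sum over the rotation by
`-holonomy H e`. -/
theorem translateTime_nsmul_eq_sum (h : IsTransverseLift f v H φ g w m₀) (e : ℤ × ℤ) (n : ℕ)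
    (a : ℝ) : translateTime H φ g ((n : ℤ) • e) a
      = ∑ j ∈ Finset.range n, translateTime H φ g e (a - j * holonomy H e) := by
  induction n with
  | zero => simpa using h.translateTime_zero a
  | succ n ih =>
    rw [Finset.sum_range_succ, ← ih]
    push_cast
    rw [h.translateTime_add_one_zsmul]
    simp

/-- The times at which the orbit meets the lifts of the closed curve. -/
theorem exists_translate_iff (h : IsTransverseLift f v H φ g w m₀) {e : ℤ × ℤ}
    (hspan : ∀ m : ℤ × ℤ, ∃ i j : ℤ, m = i • m₀ + j • e) (a t : ℝ) :
    (∃ u m, φ t (crossing H g a) = g u + latticeVec m) ↔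
      ∃ j : ℤ, t = translateTime H φ g (j • e) a := by
  constructor
  · rintro ⟨u, m, hu⟩
    obtain ⟨i, j, rfl⟩ := hspan m
    refine ⟨j, ?_⟩
    rw [← h.translateTime_span e i j]
    symm
    refine h.translateTime_eq ?_
    have h1 := congrArg H hu
    rw [h.stream.flow_eq h.flow, h.level_crossing, h.stream.add_latticeVec] at h1
    rw [hu, h1, add_sub_cancel_right, h.crossing_level]
  · rintro ⟨j, rfl⟩
    exact ⟨_, j • e, h.flow_translateTime (j • e) a⟩

theorem exists_pos_le_translateTime (h : IsTransverseLift f v H φ g w m₀) {e : ℤ × ℤ}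
    (he : ∀ a, 0 < translateTime H φ g e a) :
    ∃ δ > 0, ∀ a, δ ≤ translateTime H φ g e a := by
  obtain ⟨b, -, hb⟩ := (isCompact_Icc (a := 0) (b := holonomy H m₀)).exists_isMinOn
    ⟨0, le_rfl, h.holonomy_pos.le⟩ (h.continuous_translateTime e).continuousOn
  refine ⟨_, he b, fun a => ?_⟩
  obtain ⟨a', ha', haa⟩ := (h.translateTime_periodic e).exists_mem_Ico₀ h.holonomy_pos a
  rw [haa]
  exact hb (Ico_subset_Icc_self ha')

end IsTransverseLift

end TransverseLift

/-! ### The area of the torus in level and time coordinates -/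

noncomputable section AreaOfTorus

/-- Two fundamental domains of the lattice: cut each by the translates of the other and match the
pieces by translation. -/
theorem measure_eq_of_lattice_tilings {μ : Measure (ℝ × ℝ)}
    (hμ : ∀ m E, MeasurableSet E → μ ((fun x => x + latticeVec m) ⁻¹' E) = μ E)
    {E₀ E₁ : Set (ℝ × ℝ)} (hE₀ : MeasurableSet E₀) (hE₁ : MeasurableSet E₁)
    (h₀ : ∀ x, ∃! m, x + latticeVec m ∈ E₀) (h₁ : ∀ x, ∃! m, x + latticeVec m ∈ E₁) :
    μ E₀ = μ E₁ := by
  have hmeas : ∀ m, Measurable fun x : ℝ × ℝ => x + latticeVec m := fun m => measurable_add_const _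
  have key : ∀ A B : Set (ℝ × ℝ), MeasurableSet A → MeasurableSet B →
      (∀ x, ∃! m, x + latticeVec m ∈ B) →
      μ A = ∑' m, μ (A ∩ (fun x => x + latticeVec m) ⁻¹' B) := by
    intro A B hA hB h
    rw [← measure_iUnion]
    · congr 1
      ext x
      obtain ⟨m, hm, -⟩ := h x
      simp only [mem_iUnion, mem_inter_iff, mem_preimage]
      exact ⟨fun hx => ⟨m, hx, hm⟩, fun ⟨_, hx, _⟩ => hx⟩
    · intro i j hij
      refine disjoint_left.2 fun x hx hx' => hij ?_
      exact (h x).unique hx.2 hx'.2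
    · exact fun m => hA.inter (hmeas m hB)
  rw [key E₀ E₁ hE₀ hE₁ h₁, key E₁ E₀ hE₁ hE₀ h₀, ← (Equiv.neg (ℤ × ℤ)).tsum_eq]
  refine tsum_congr fun m => ?_
  rw [← hμ m _ (hE₀.inter (hmeas _ hE₁))]
  congr 1
  ext x
  simp [latticeVec_neg, and_comm]

namespace IsTransverseLift

variable {f : ℝ × ℝ → ℝ} {v : ℝ × ℝ → ℝ × ℝ} {H : ℝ × ℝ → ℝ} {φ : ℝ → ℝ × ℝ → ℝ × ℝ}
  {g : ℝ → ℝ × ℝ} {w : ℝ → ℝ} {m₀ : ℤ × ℤ}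

theorem continuous_flowCoordinates (h : IsTransverseLift f v H φ g w m₀) :
    Continuous fun p : ℝ × ℝ => φ p.2 (crossing H g p.1) :=
  h.flow.continuous.comp (continuous_snd.prodMk (h.continuous_crossing.comp continuous_fst))

/-- Both measures, weighted by `ρ = ℓ(v)`, are compared with the Lebesgue measure of the image under
`G = (ℓ, H)`. For the density `|f|` this is the planar change of variables; for the flow coordinates
it is Fubini over the levels and a change of variables in time alone. The flow is thus never
differentiated in its initial point. -/
theorem exists_nhds_restrict_eq (h : IsTransverseLift f v H φ g w m₀) (x₀ : ℝ × ℝ) :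
    ∃ W ∈ 𝓝 x₀, (volume.withDensity fun x => ENNReal.ofReal |f x|).restrict W
      = (Measure.map (fun p : ℝ × ℝ => φ p.2 (crossing H g p.1)) volume).restrict W := by
  obtain ⟨r, hr, hpos, hinj⟩ := h.stream.exists_ball_injOn x₀
  set ℓ := IsStreamFunction.alongField v x₀
  set W := Metric.ball x₀ r
  have hW : MeasurableSet W := Metric.isOpen_ball.measurableSet
  set ρ : ℝ × ℝ → ENNReal := fun z => ENNReal.ofReal (ℓ (v z))
  have hρ : Measurable ρ := ENNReal.measurable_ofReal.comp
    (ℓ.continuous.comp h.stream.contDiff_field.continuous).measurable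
  have hf : Measurable fun x => ENNReal.ofReal |f x| := ENNReal.measurable_ofReal.comp
    (continuous_abs.comp h.stream.contDiff_density.continuous).measurable
  set μ := volume.withDensity fun x => ENNReal.ofReal |f x|
  have hΨ := h.continuous_flowCoordinates.measurable
  set ν := Measure.map (fun p : ℝ × ℝ => φ p.2 (crossing H g p.1)) volume
  refine ⟨W, Metric.ball_mem_nhds x₀ hr, ?_⟩
  have hdens : (μ.restrict W).withDensity ρ = (ν.restrict W).withDensity ρ := by
    ext E hE
    rw [withDensity_apply _ hE, withDensity_apply _ hE, Measure.restrict_restrict hE,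
      Measure.restrict_restrict hE]
    have hD : MeasurableSet (E ∩ W) := hE.inter hW
    have hDW : E ∩ W ⊆ W := inter_subset_right
    generalize E ∩ W = D at hD hDW
    rw [setLIntegral_withDensity_eq_setLIntegral_mul _ hf hρ hD]
    set G : ℝ × ℝ → ℝ × ℝ := fun z => (ℓ z, H z)
    have hG : ∀ x ∈ D, HasFDerivWithinAt G (ℓ.prod ((f x * (v x).2) • ContinuousLinearMap.fst ℝ ℝ ℝ
        - (f x * (v x).1) • ContinuousLinearMap.snd ℝ ℝ ℝ)) D x := fun x _ =>
      (ℓ.hasFDerivAt.prodMk (h.stream.hasFDerivAt x)).hasFDerivWithinAt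
    -- The Jacobian of `G` is, up to sign, the density times the weight.
    have hdet : ∀ x, (ℓ.prod ((f x * (v x).2) • ContinuousLinearMap.fst ℝ ℝ ℝ
        - (f x * (v x).1) • ContinuousLinearMap.snd ℝ ℝ ℝ)).det = -(f x * ℓ (v x)) := by
      intro x
      have : ((ℓ.prod ((f x * (v x).2) • ContinuousLinearMap.fst ℝ ℝ ℝ
        - (f x * (v x).1) • ContinuousLinearMap.snd ℝ ℝ ℝ) : ℝ × ℝ →L[ℝ] ℝ × ℝ) :
          ℝ × ℝ →ₗ[ℝ] ℝ × ℝ) = Matrix.toLin (Module.Basis.finTwoProd ℝ) (Module.Basis.finTwoProd ℝ)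
          !![(v x₀).1, (v x₀).2; f x * (v x).2, -(f x * (v x).1)] := by
        rw [Matrix.toLin_finTwoProd]
        ext <;> simp [ℓ, IsStreamFunction.alongField]
      rw [ContinuousLinearMap.det, this, LinearMap.det_toLin, Matrix.det_fin_two_of,
        IsStreamFunction.alongField_apply]
      ring
    have hinjD : InjOn G D := hinj.mono hDW
    have hGD : MeasurableSet (G '' D) := measurable_image_of_fderivWithin hD hG hinjD
    have h1 : ∫⁻ x in D, ((fun x => ENNReal.ofReal |f x|) * ρ) x = volume (G '' D) := by
      rw [← lintegral_abs_det_fderiv_eq_addHaar_image volume hD hG hinjD]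
      refine setLIntegral_congr_fun hD fun x hx => ?_
      simp only [Pi.mul_apply, ρ, hdet]
      rw [abs_neg, abs_mul, ENNReal.ofReal_mul (abs_nonneg _), abs_of_pos (hpos x (hDW hx))]
    rw [h1, Measure.volume_eq_prod, Measure.prod_apply_symm hGD, ← lintegral_indicator hD,
      lintegral_map (hρ.indicator hD) hΨ, Measure.volume_eq_prod, lintegral_prod]
    swap
    · exact ((hρ.indicator hD).comp hΨ).aemeasurable
    refine lintegral_congr fun a => ?_
    set S : Set ℝ := {t | φ t (crossing H g a) ∈ D}
    have hS : MeasurableSet S := (h.flow.continuous_time _).measurable hD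
    -- The slice of the image at the level `a` is traced by the single orbit on that level.
    have himg : (fun b => (b, a)) ⁻¹' (G '' D) = (fun t => ℓ (φ t (crossing H g a))) '' S := by
      ext b
      constructor
      · rintro ⟨x, hx, hxb⟩
        obtain ⟨hb, ha⟩ := Prod.mk.inj hxb
        have hft := h.flow_hitTime x
        rw [ha] at hft
        refine ⟨hitTime H φ g x, ?_, ?_⟩
        · simpa only [S, mem_ofPred_eq, hft] using hx
        · simp only [hft, hb]
      · rintro ⟨t, ht, rfl⟩
        exact ⟨_, ht, by simp only [G, h.stream.flow_eq h.flow, h.level_crossing]⟩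
    have hinjS : InjOn (fun t => ℓ (φ t (crossing H g a))) S := by
      intro s hs t ht hst
      refine h.flow_injective (crossing H g a) (hinjD hs ht ?_)
      simp only [G, h.stream.flow_eq h.flow, Prod.mk.injEq, and_true]
      exact hst
    have h2 := lintegral_image_eq_lintegral_abs_deriv_mul (f := fun t => ℓ (φ t (crossing H g a)))
      (f' := fun t => ℓ (v (φ t (crossing H g a)))) hS
      (fun t _ => (ℓ.hasFDerivAt.comp_hasDerivAt t (h.flow.deriv t _)).hasDerivWithinAt) hinjS
      (fun _ => 1)
    rw [setLIntegral_one] at h2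
    rw [himg, h2, ← lintegral_indicator hS]
    refine lintegral_congr fun t => ?_
    by_cases ht : t ∈ S
    · have ht' : φ t (crossing H g a) ∈ D := ht
      rw [indicator_of_mem ht, indicator_of_mem ht', mul_one, abs_of_pos (hpos _ (hDW ht'))]
    · have ht' : φ t (crossing H g a) ∉ D := ht
      rw [indicator_of_notMem ht, indicator_of_notMem ht']
  have hne : ∀ κ : Measure (ℝ × ℝ), ∀ᵐ x ∂κ.restrict W, ρ x ≠ 0 := fun κ =>
    (ae_restrict_iff' hW).2 (Eventually.of_forall fun x hx => by simpa [ρ] using hpos x hx)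
  have htop : ∀ κ : Measure (ℝ × ℝ), ∀ᵐ x ∂κ.restrict W, ρ x ≠ ⊤ := fun κ =>
    Eventually.of_forall fun x => ENNReal.ofReal_ne_top
  -- The weight is positive and finite on `W`, so it can be divided out.
  rw [← withDensity_inv_same hρ (hne μ) (htop μ), hdens, withDensity_inv_same hρ (hne ν) (htop ν)]

/-- In the coordinates (level, time) the area form `f dx ∧ dy` is the standard one. -/
theorem withDensity_eq_map (h : IsTransverseLift f v H φ g w m₀) :
    (volume.withDensity fun x => ENNReal.ofReal |f x|)
      = Measure.map (fun p : ℝ × ℝ => φ p.2 (crossing H g p.1)) volume := by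
  choose W hW hWeq using h.exists_nhds_restrict_eq
  obtain ⟨s, hs, hcov⟩ := TopologicalSpace.countable_cover_nhds hW
  have := hs.to_subtype
  rw [biUnion_eq_iUnion] at hcov
  exact (Measure.ext_iff_of_iUnion_eq_univ hcov).2 fun i => hWeq i

theorem hitTime_add_latticeVec (h : IsTransverseLift f v H φ g w m₀) (m : ℤ × ℤ) (x : ℝ × ℝ) :
    hitTime H φ g (x + latticeVec m)
      = hitTime H φ g x + translateTime H φ g m (H x + holonomy H m) := by
  refine h.hitTime_eq ?_
  rw [h.stream.add_latticeVec, h.flow.add, h.flow_translateTime, add_sub_cancel_right,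
    h.flow.add_vec (h.stream.field_periodic m), h.flow_hitTime]

/-- Consecutive return times differ by at least a fixed `δ > 0`, so they are unbounded in both
directions and partition the time axis. -/
theorem existsUnique_translateTime_le_lt (h : IsTransverseLift f v H φ g w m₀) {e : ℤ × ℤ}
    (he : ∀ a, 0 < translateTime H φ g e a) (a t : ℝ) :
    ∃! k : ℤ, translateTime H φ g (k • e) a ≤ t ∧ t < translateTime H φ g ((k + 1) • e) a := by
  obtain ⟨δ, hδ, hle⟩ := h.exists_pos_le_translateTime he
  have hmono := h.strictMono_translateTime he a
  have hup : ∀ k : ℕ, k * δ ≤ translateTime H φ g ((k : ℤ) • e) a := by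
    intro k
    induction k with
    | zero => simp [h.translateTime_zero]
    | succ k ih =>
      push_cast
      rw [h.translateTime_add_one_zsmul]
      linarith [hle (a - (k : ℤ) * holonomy H e)]
  have hdown : ∀ k : ℕ, translateTime H φ g ((-(k : ℤ)) • e) a ≤ -(k * δ) := by
    intro k
    induction k with
    | zero => simp [h.translateTime_zero]
    | succ k ih =>
      have := h.translateTime_add_one_zsmul e (-((k + 1 : ℕ) : ℤ)) a
      have e1 : -((k + 1 : ℕ) : ℤ) + 1 = -(k : ℤ) := by push_cast; ring
      rw [e1] at this
      have h2 := hle (a - ((-((k + 1 : ℕ) : ℤ) : ℤ) : ℝ) * holonomy H e)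
      have e2 : ((k + 1 : ℕ) : ℝ) * δ = k * δ + δ := by push_cast; ring
      rw [e2]
      linarith
  obtain ⟨k, hk, hmax⟩ := Int.exists_greatest_of_bdd
    (P := fun k => translateTime H φ g (k • e) a ≤ t) (by
      obtain ⟨n, hn⟩ := exists_nat_gt (t / δ)
      rw [div_lt_iff₀ hδ] at hn
      refine ⟨n, fun z hz => ?_⟩
      by_contra! hlt
      have : translateTime H φ g ((n : ℤ) • e) a < translateTime H φ g (z • e) a := hmono hlt
      linarith [hup n]) (by
      obtain ⟨n, hn⟩ := exists_nat_gt (-t / δ)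
      rw [div_lt_iff₀ hδ] at hn
      exact ⟨-(n : ℤ), by linarith [hdown n]⟩)
  refine ⟨k, ⟨hk, ?_⟩, ?_⟩
  · by_contra! hle
    have := hmax (k + 1) hle
    omega
  · rintro j ⟨hj1, hj2⟩
    refine le_antisymm (hmax j hj1) ?_
    by_contra! hlt
    have : translateTime H φ g ((j + 1) • e) a ≤ translateTime H φ g (k • e) a :=
      hmono.monotone (show j + 1 ≤ k by omega)
    linarith

/-- The orbit segments between consecutive crossings of the curve tile the torus. -/
theorem existsUnique_mem_flowBox (h : IsTransverseLift f v H φ g w m₀) {e : ℤ × ℤ}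
    (hspan : ∀ m : ℤ × ℤ, ∃ i j : ℤ, m = i • m₀ + j • e)
    (he : ∀ a, 0 < translateTime H φ g e a) (x : ℝ × ℝ) :
    ∃! m, x + latticeVec m ∈ {y | H y ∈ Ico 0 (holonomy H m₀) ∧
      hitTime H φ g y ∈ Ico 0 (translateTime H φ g e (H y))} := by
  set c := holonomy H m₀
  have hc : 0 < c := h.holonomy_pos
  -- The two coefficients decouple: the hitting time determines `j`, because `m₀` costs no time, and
  -- then the level modulo `c` determines `i`.
  have key : ∀ i j : ℤ, x + latticeVec (i • m₀ + j • e) ∈ {y | H y ∈ Ico 0 c ∧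
      hitTime H φ g y ∈ Ico 0 (translateTime H φ g e (H y))} ↔
      (H x + j * holonomy H e + i * c ∈ Ico 0 c) ∧
      translateTime H φ g ((-j) • e) (H x) ≤ hitTime H φ g x ∧
        hitTime H φ g x < translateTime H φ g ((-j + 1) • e) (H x) := by
    intro i j
    have e1 : holonomy H (i • m₀ + j • e) = j * holonomy H e + i * c := by
      rw [h.stream.holonomy_add, h.stream.holonomy_zsmul, h.stream.holonomy_zsmul, add_comm]
    have hper : ∀ m, translateTime H φ g m (H x + (j * holonomy H e + i * c))
        = translateTime H φ g m (H x + j * holonomy H e) := fun m => by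
      rw [← add_assoc]
      simpa using ((h.translateTime_periodic m).int_mul i) (H x + j * holonomy H e)
    have e2 : translateTime H φ g (j • e) (H x + j * holonomy H e)
        = -translateTime H φ g ((-j) • e) (H x) := by
      rw [neg_smul, h.translateTime_neg, neg_neg, h.stream.holonomy_zsmul]
    have e3 := h.translateTime_add_one_zsmul e (-j) (H x)
    have e4 : H x - ((-j : ℤ) : ℝ) * holonomy H e = H x + j * holonomy H e := by push_cast; ring
    rw [e4] at e3
    simp only [mem_ofPred_eq, h.stream.add_latticeVec, h.hitTime_add_latticeVec, e1, hper,
      h.translateTime_span, e2, e3, mem_Ico, add_assoc]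
    refine and_congr Iff.rfl (and_congr ?_ ?_)
    · constructor <;> intro hh <;> linarith
    · constructor <;> intro hh <;> linarith
  obtain ⟨k, hk, hkuniq⟩ := h.existsUnique_translateTime_le_lt he (H x) (hitTime H φ g x)
  obtain ⟨i, hi, hiuniq⟩ := existsUnique_add_zsmul_mem_Ico hc (H x + ((-k : ℤ) : ℝ) * holonomy H e) 0
  simp only [zero_add, zsmul_eq_mul] at hi hiuniq
  refine ⟨i • m₀ + (-k) • e, (key i (-k)).2 ⟨hi, by simpa using hk⟩, ?_⟩
  intro m hm
  obtain ⟨i', j', rfl⟩ := hspan m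
  obtain ⟨h1, h2⟩ := (key i' j').1 hm
  have hj : j' = -k := by
    have := hkuniq (-j') h2
    omega
  subst hj
  rw [hiuniq i' h1]

/-- The area of the torus is the integral over the curve of the return time. -/
theorem lintegral_density_eq (h : IsTransverseLift f v H φ g w m₀) {e : ℤ × ℤ}
    (hspan : ∀ m : ℤ × ℤ, ∃ i j : ℤ, m = i • m₀ + j • e)
    (he : ∀ a, 0 < translateTime H φ g e a) :
    ∫⁻ x in Ico (0 : ℝ) 1 ×ˢ Ico (0 : ℝ) 1, ENNReal.ofReal |f x|
      = ∫⁻ a in Ico 0 (holonomy H m₀), ENNReal.ofReal (translateTime H φ g e a) := by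
  have hH := h.stream.continuous.measurable
  have hτ := h.continuous_hitTime.measurable
  have hT := (h.continuous_translateTime e).measurable
  set E₁ := {y | H y ∈ Ico 0 (holonomy H m₀) ∧
      hitTime H φ g y ∈ Ico 0 (translateTime H φ g e (H y))}
  have hE₁ : MeasurableSet E₁ := (hH measurableSet_Ico).inter
    ((measurableSet_le measurable_const hτ).inter (measurableSet_lt hτ (hT.comp hH)))
  have hE₀ : MeasurableSet (Ico (0 : ℝ) 1 ×ˢ Ico (0 : ℝ) 1) :=
    measurableSet_Ico.prod measurableSet_Ico
  have h1 := measure_eq_of_lattice_tilings (μ := volume.withDensity fun x => ENNReal.ofReal |f x|)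
    (fun m E hE => by
      have hmeas : Measurable fun x : ℝ × ℝ => x + latticeVec m := measurable_add_const _
      rw [withDensity_apply _ hE, withDensity_apply _ (hmeas hE), ← lintegral_indicator hE,
        ← lintegral_indicator (hmeas hE), 
        ← lintegral_add_right_eq_self (E.indicator fun a => ENNReal.ofReal |f a|) (latticeVec m)]
      refine lintegral_congr fun x => ?_
      by_cases hx : x + latticeVec m ∈ E
      · have hx' : x ∈ (fun x => x + latticeVec m) ⁻¹' E := hx
        rw [indicator_of_mem hx, indicator_of_mem hx', h.stream.density_periodic]
      · have hx' : x ∉ (fun x => x + latticeVec m) ⁻¹' E := hx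
        rw [indicator_of_notMem hx, indicator_of_notMem hx'])
    hE₀ hE₁ exists_lattice_add_mem_unitSquare (h.existsUnique_mem_flowBox hspan he)
  rw [withDensity_apply _ hE₀] at h1
  have hΨ := h.continuous_flowCoordinates.measurable
  rw [h1, h.withDensity_eq_map, Measure.map_apply hΨ hE₁, Measure.volume_eq_prod,
    Measure.prod_apply (hΨ hE₁), ← lintegral_indicator measurableSet_Ico]
  refine lintegral_congr fun a => ?_
  -- Over the level `a` the flow box is the time interval up to the first return.
  have hset : Prod.mk a ⁻¹' ((fun p : ℝ × ℝ => φ p.2 (crossing H g p.1)) ⁻¹' E₁)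
      = {t | a ∈ Ico 0 (holonomy H m₀) ∧ t ∈ Ico 0 (translateTime H φ g e a)} := by
    ext t
    simp only [E₁, mem_preimage, mem_ofPred_eq, h.stream.flow_eq h.flow, h.level_crossing,
      h.hitTime_flow]
  rw [hset]
  by_cases ha : a ∈ Ico 0 (holonomy H m₀)
  · have hIco : {t | a ∈ Ico 0 (holonomy H m₀) ∧ t ∈ Ico 0 (translateTime H φ g e a)}
        = Ico 0 (translateTime H φ g e a) := by ext t; simp only [mem_ofPred_eq, ha, true_and]
    rw [hIco, indicator_of_mem ha, Real.volume_Ico, sub_zero]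
  · simp [ha]

end IsTransverseLift

end AreaOfTorus

/-! ### Weyl equidistribution for a rotation of the circle -/

section Equidistribution

/-- The averaging functionals have norm at most 1 and `I` is bounded, so the functions whose
averages converge to `I` form a closed subspace. -/
theorem tendsto_average_of_dense {X : Type*} [TopologicalSpace X] [CompactSpace X]
    (x : ℕ → X) (I : C(X, ℂ) →L[ℂ] ℂ) (S : Set C(X, ℂ))
    (hS : (Submodule.span ℂ S).topologicalClosure = ⊤)
    (h : ∀ F ∈ S, Tendsto (fun n : ℕ => (∑ j ∈ Finset.range n, F (x j)) / (n : ℂ)) atTop (𝓝 (I F)))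
    (F : C(X, ℂ)) :
    Tendsto (fun n : ℕ => (∑ j ∈ Finset.range n, F (x j)) / (n : ℂ)) atTop (𝓝 (I F)) := by
  have hspan : ∀ F ∈ Submodule.span ℂ S,
      Tendsto (fun n : ℕ => (∑ j ∈ Finset.range n, F (x j)) / (n : ℂ)) atTop (𝓝 (I F)) := by
    intro F hF
    induction hF using Submodule.span_induction with
    | mem F hF => exact h F hF
    | zero => simp
    | add F G _ _ hF hG =>
      rw [map_add]
      refine (hF.add hG).congr fun n => ?_
      simp [Finset.sum_add_distrib, add_div]
    | smul a F _ hF =>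
      rw [map_smul, smul_eq_mul]
      refine (hF.const_mul a).congr fun n => ?_
      simp [← Finset.mul_sum, mul_div_assoc]
  have hnorm : ∀ (G : C(X, ℂ)) (n : ℕ), ‖(∑ j ∈ Finset.range n, G (x j)) / (n : ℂ)‖ ≤ ‖G‖ := by
    intro G n
    rw [norm_div, Complex.norm_natCast]
    refine div_le_of_le_mul₀ (Nat.cast_nonneg n) (norm_nonneg _) ?_
    refine (norm_sum_le _ _).trans ((Finset.sum_le_card_nsmul _ _ ‖G‖
      fun j _ => G.norm_coe_le_norm _).trans ?_)
    simp [mul_comm]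
  rw [Metric.tendsto_atTop]
  intro ε hε
  have hF : F ∈ closure (Submodule.span ℂ S : Set C(X, ℂ)) := by
    rw [← Submodule.topologicalClosure_coe, hS]; trivial
  set δ := ε / (2 * (1 + ‖I‖) + 2)
  have hI := norm_nonneg I
  have hδ : 0 < δ := by positivity
  obtain ⟨G, hG, hFG⟩ := Metric.mem_closure_iff.1 hF δ hδ
  obtain ⟨N, hN⟩ := Metric.tendsto_atTop.1 (hspan G hG) δ hδ
  refine ⟨N, fun n hn => ?_⟩
  have h1 := hN n hn
  rw [dist_eq_norm] at h1 hFG ⊢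
  have h2 := hnorm (F - G) n
  have h3 := I.le_opNorm (F - G)
  have h4 : (∑ j ∈ Finset.range n, F (x j)) / (n : ℂ) - I F
      = (∑ j ∈ Finset.range n, (F - G) (x j)) / (n : ℂ)
        + ((∑ j ∈ Finset.range n, G (x j)) / (n : ℂ) - I G) - I (F - G) := by
    simp [Finset.sum_sub_distrib, sub_div]
  rw [h4]
  refine (norm_sub_le _ _).trans_lt ((add_le_add_left (norm_add_le _ _) _).trans_lt ?_)
  have h5 : ‖I‖ * ‖F - G‖ ≤ ‖I‖ * δ := mul_le_mul_of_nonneg_left hFG.le hI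
  have h6 : δ * (2 * (1 + ‖I‖) + 2) = ε := by
    simp only [δ]; field_simp
  nlinarith

/-- The sum is geometric with ratio `z` on the unit circle, hence bounded. Irrationality of `r / c`
is what excludes `z = 1`. -/
theorem tendsto_average_fourier {c r : ℝ} [Fact (0 < c)] (hr : Irrational (r / c)) {k : ℤ}
    (hk : k ≠ 0) (a : ℝ) :
    Tendsto (fun n : ℕ => (∑ j ∈ Finset.range n, fourier k ((a - j * r : ℝ) : AddCircle c)) / (n : ℂ))
      atTop (𝓝 0) := by
  have hc : 0 < c := Fact.out
  set z : ℂ := fourier k ((-r : ℝ) : AddCircle c)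
  have hz : z ≠ 1 := by
    simp only [z, fourier_coe_apply]
    intro h1
    obtain ⟨n, hn⟩ := Complex.exp_eq_one_iff.1 h1
    have hpi : (2 * Real.pi * Complex.I : ℂ) ≠ 0 := Complex.two_pi_I_ne_zero
    have hc' : (c : ℂ) ≠ 0 := by exact_mod_cast hc.ne'
    have h2 : (k : ℂ) * (-r) = n * c := by
      rw [div_eq_iff hc'] at hn
      apply mul_left_cancel₀ hpi
      push_cast at hn
      linear_combination hn
    have h3 : (k : ℝ) * (-r) = n * c := by exact_mod_cast h2
    have h4 : r / c = ((-n : ℤ) : ℝ) / k := by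
      have hk' : (k : ℝ) ≠ 0 := by exact_mod_cast hk
      rw [div_eq_div_iff hc.ne' hk']
      push_cast
      linarith
    rw [h4] at hr
    exact hr ⟨(-n : ℤ) / k, by push_cast; rfl⟩
  have hterm : ∀ j : ℕ, fourier k ((a - j * r : ℝ) : AddCircle c)
      = fourier k (a : AddCircle c) * z ^ j := by
    intro j
    simp only [z, fourier_coe_apply, ← Complex.exp_nat_mul, ← Complex.exp_add]
    congr 1
    push_cast
    ring
  have hzn : ‖z‖ = 1 := by simp only [z, fourier_apply]; exact Circle.norm_coe _
  have han : ‖(fourier k (a : AddCircle c) : ℂ)‖ = 1 := by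
    simp only [fourier_apply]; exact Circle.norm_coe _
  have hbound : ∀ n : ℕ, ‖(∑ j ∈ Finset.range n, fourier k ((a - j * r : ℝ) : AddCircle c)) / (n : ℂ)‖
      ≤ (2 / ‖z - 1‖) / n := by
    intro n
    rw [norm_div, Complex.norm_natCast]
    refine div_le_div_of_nonneg_right ?_ (Nat.cast_nonneg n)
    simp only [hterm]
    rw [← Finset.mul_sum, geom_sum_eq hz, norm_mul, han, one_mul, norm_div]
    refine div_le_div_of_nonneg_right ((norm_sub_le _ _).trans ?_) (norm_nonneg _)
    rw [norm_pow, hzn, one_pow, norm_one]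
    norm_num
  exact squeeze_zero_norm hbound (tendsto_const_div_atTop_nhds_zero_nat _)

/-- Weyl's equidistribution theorem for irrational rotations of a circle. -/
theorem tendsto_average_rotation {T : ℝ → ℝ} {c r : ℝ} (hc : 0 < c) (hT : Continuous T)
    (hper : Function.Periodic T c) (hr : Irrational (r / c)) (a : ℝ) :
    Tendsto (fun n : ℕ => (∑ j ∈ Finset.range n, T (a - j * r)) / n) atTop
      (𝓝 ((∫ x in (0 : ℝ)..c, T x) / c)) := by
  have : Fact (0 < c) := ⟨hc⟩
  have hint : ∀ F : C(AddCircle c, ℂ), Integrable F (AddCircle.haarAddCircle (T := c)) := fun F =>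
    F.continuous.integrable_of_hasCompactSupport (HasCompactSupport.of_compactSpace _)
  -- The zeroth Fourier coefficient, which is the mean with respect to Haar measure.
  let I : C(AddCircle c, ℂ) →L[ℂ] ℂ := LinearMap.mkContinuous
    { toFun := fun F => fourierCoeff F 0
      map_add' := fun F G => by
        rw [ContinuousMap.coe_add, fourierCoeff.add (hint F) (hint G)]; rfl
      map_smul' := fun b F => by
        rw [ContinuousMap.coe_smul]; exact fourierCoeff.const_smul _ _ _ } 1 (fun F => by
      have h1 : ∀ᵐ t ∂(AddCircle.haarAddCircle (T := c)),
          ‖(fourier (-0) t : ℂ) • F t‖ ≤ ‖F‖ := Eventually.of_forall fun t => by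
        simpa using F.norm_coe_le_norm t
      simpa [fourierCoeff] using norm_integral_le_of_norm_le_const h1)
  have hI : ∀ F, I F = fourierCoeff F 0 := fun _ => rfl
  have key := tendsto_average_of_dense (fun j : ℕ => ((a - j * r : ℝ) : AddCircle c)) I
    (range fourier) span_fourier_closure_eq_top (by
      rintro _ ⟨k, rfl⟩
      rw [hI, fourierCoeff_fourier]
      rcases eq_or_ne k 0 with rfl | hk
      · refine tendsto_const_nhds.congr' ?_
        filter_upwards [eventually_gt_atTop 0] with n hn
        have : (n : ℂ) ≠ 0 := by exact_mod_cast hn.ne'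
        simp [this]
      · rw [Pi.single_eq_of_ne hk.symm]
        exact tendsto_average_fourier hr hk a)
  have hlift : Continuous (hper.lift : AddCircle c → ℝ) :=
    continuous_quot_lift _ hT
  have h2 := key ⟨fun x => ((hper.lift x : ℝ) : ℂ), Complex.continuous_ofReal.comp hlift⟩
  rw [hI, fourierCoeff_eq_intervalIntegral _ _ 0] at h2
  simp only [ContinuousMap.coe_mk, Function.Periodic.lift_coe, neg_zero, fourier_zero, one_smul,
    zero_add, intervalIntegral.integral_ofReal] at h2
  have h3 := (Complex.continuous_re.tendsto _).comp h2
  refine (h3.congr fun n => ?_).trans_eq ?_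
  · simp only [Function.comp_apply]
    norm_cast
  · congr 1
    simp only [one_div, Complex.smul_re, Complex.ofReal_re, smul_eq_mul]
    rw [div_eq_inv_mul]

end Equidistribution

/-! ### Averages of the return time and irrational winding -/

noncomputable section ReturnTime

namespace IsTransverseLift

variable {f : ℝ × ℝ → ℝ} {v : ℝ × ℝ → ℝ × ℝ} {H : ℝ × ℝ → ℝ} {φ : ℝ → ℝ × ℝ → ℝ × ℝ}
  {g : ℝ → ℝ × ℝ} {w : ℝ → ℝ} {m₀ : ℤ × ℤ}

theorem integral_translateTime (h : IsTransverseLift f v H φ g w m₀) {e : ℤ × ℤ}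
    (hspan : ∀ m : ℤ × ℤ, ∃ i j : ℤ, m = i • m₀ + j • e)
    (he : ∀ a, 0 < translateTime H φ g e a) :
    ∫ a in (0 : ℝ)..holonomy H m₀, translateTime H φ g e a
      = ∫ x in Ico (0 : ℝ) 1 ×ˢ Ico (0 : ℝ) 1, |f x| := by
  rw [intervalIntegral.integral_of_le h.holonomy_pos.le, ← integral_Ico_eq_integral_Ioc,
    integral_eq_lintegral_of_nonneg_ae (Eventually.of_forall fun a => (he a).le)
      (h.continuous_translateTime e).aestronglyMeasurable,
    integral_eq_lintegral_of_nonneg_ae (Eventually.of_forall fun x => abs_nonneg _)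
      (continuous_abs.comp h.stream.contDiff_density.continuous).aestronglyMeasurable,
    h.lintegral_density_eq hspan he]

theorem integral_rate (h : IsTransverseLift f v H φ g w m₀) :
    ∫ u in (0 : ℝ)..1, w u = holonomy H m₀ := by
  rw [intervalIntegral.integral_eq_sub_of_hasDerivAt (fun u _ => h.hasDerivAt u)
    (h.rate_continuous.intervalIntegrable _ _)]
  have := h.level_add_one 0
  rw [zero_add] at this
  linarith

/-- Substitute the level `a = H (g u)`; one turn of the curve sweeps one period of the return time,
and periodicity moves that period to start at 0. -/
theorem integral_translateTime_mul_rate (h : IsTransverseLift f v H φ g w m₀) (e : ℤ × ℤ) :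
    ∫ u in (0 : ℝ)..1, translateTime H φ g e (H (g u)) * w u
      = ∫ a in (0 : ℝ)..holonomy H m₀, translateTime H φ g e a := by
  have h1 := intervalIntegral.integral_comp_mul_deriv (a := 0) (b := 1) (f := fun u => H (g u))
    (f' := w) (g := translateTime H φ g e) (fun u _ => h.hasDerivAt u)
    h.rate_continuous.continuousOn (h.continuous_translateTime e)
  have h2 := h.level_add_one 0
  rw [zero_add] at h2
  have h3 := (h.translateTime_periodic e).intervalIntegral_add_eq (H (g 0)) 0
  rw [zero_add] at h3
  rw [← h3, ← h2, ← h1]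
  rfl

/-- The successive return times of an orbit have the mean `τ` if they wind irrationally. -/
theorem tendsto_translateTime_div (h : IsTransverseLift f v H φ g w m₀) {e : ℤ × ℤ}
    (hirr : Irrational (holonomy H e / holonomy H m₀)) (a : ℝ) :
    Tendsto (fun n : ℕ => translateTime H φ g ((n : ℤ) • e) a / n) atTop
      (𝓝 ((∫ b in (0 : ℝ)..holonomy H m₀, translateTime H φ g e b) / holonomy H m₀)) := by
  simp only [h.translateTime_nsmul_eq_sum]
  exact tendsto_average_rotation h.holonomy_pos (h.continuous_translateTime e)
    (h.translateTime_periodic e) hirr a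

/-- An orbit on the torus that closes up does not wind irrationally. -/
theorem not_tendsto_irrational_of_translate {x : ℝ × ℝ} {σ : ℝ} {m : ℤ × ℤ} (hσ : 0 < σ)
    (hm : m ≠ 0) (hφ : ∀ k : ℕ, φ (k * σ) x = x + latticeVec (k • m)) {ι : ℝ} (hι : Irrational ι)
    (hlim : Tendsto (fun t => (φ t x).2 / (φ t x).1) atTop (𝓝 ι)) : False := by
  have hseq : Tendsto (fun k : ℕ => (k : ℝ) * σ) atTop atTop :=
    tendsto_natCast_atTop_atTop.atTop_mul_const hσ
  have h1 := hlim.comp hseq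
  have h2 : ∀ k : ℕ, (φ (k * σ) x).1 = x.1 + k * m.1 := fun k => by rw [hφ]; simp
  have h3 : ∀ k : ℕ, (φ (k * σ) x).2 = x.2 + k * m.2 := fun k => by rw [hφ]; simp
  simp only [Function.comp_def, h2, h3] at h1
  -- Here every denominator is zero, so the ratio has the default value 0, which is not irrational.
  by_cases hz : x.1 = 0 ∧ m.1 = 0
  · simp only [hz.1, hz.2, Int.cast_zero, mul_zero, add_zero, div_zero] at h1
    exact hι.ne_zero (tendsto_nhds_unique h1 tendsto_const_nhds)
  have hne : ∀ᶠ k : ℕ in atTop, x.1 + k * (m.1 : ℝ) ≠ 0 := by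
    by_cases hm1 : (m.1 : ℝ) = 0
    · refine Eventually.of_forall fun k => ?_
      have hm1' : m.1 = 0 := by exact_mod_cast hm1
      rw [hm1, mul_zero, add_zero]
      exact fun hx => hz ⟨hx, hm1'⟩
    · have : ∀ᶠ k : ℕ in atTop, |x.1 / m.1| < k :=
        tendsto_natCast_atTop_atTop.eventually_gt_atTop _
      filter_upwards [this] with k hk h0
      have : x.1 / m.1 = -k := by field_simp; linarith
      rw [this, abs_neg, Nat.abs_cast] at hk
      exact hk.false
  -- Clearing the denominator at the scale `k` and passing to the limit yields `ι * m.1 = m.2`, so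
  -- `m = 0` or `ι` is rational.
  have h4 : Tendsto (fun k : ℕ => (x.2 + k * m.2) / (x.1 + k * m.1) * (x.1 / k + m.1)) atTop
      (𝓝 (ι * (0 + m.1))) :=
    h1.mul ((tendsto_const_div_atTop_nhds_zero_nat x.1).add tendsto_const_nhds)
  have h5 : Tendsto (fun k : ℕ => x.2 / k + (m.2 : ℝ)) atTop (𝓝 (0 + m.2)) :=
    (tendsto_const_div_atTop_nhds_zero_nat x.2).add tendsto_const_nhds
  have h6 := tendsto_nhds_unique (h4.congr' (by
    filter_upwards [hne, eventually_gt_atTop 0] with k hk hk0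
    have hk0' : (k : ℝ) ≠ 0 := by exact_mod_cast hk0.ne'
    field_simp)) h5
  rw [zero_add, zero_add] at h6
  by_cases hm1 : (m.1 : ℝ) = 0
  · rw [hm1, mul_zero] at h6
    exact hm (Prod.ext (by exact_mod_cast hm1) (by exact_mod_cast h6.symm))
  · refine hι ⟨(m.2 : ℚ) / m.1, ?_⟩
    push_cast
    rw [div_eq_iff hm1, h6]

/-- If the ratio were `p / d`, the class `d e - p m₀` would have zero holonomy. An orbit would then
pass from a point to its translate by that class in positive time, that is, close up on the torus.
-/
theorem irrational_of_tendsto (h : IsTransverseLift f v H φ g w m₀) {e : ℤ × ℤ}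
    (he : ∀ a, 0 < translateTime H φ g e a) {ι : ℝ} (hι : Irrational ι)
    (hlim : ∀ x, Tendsto (fun t => (φ t x).2 / (φ t x).1) atTop (𝓝 ι)) :
    Irrational (holonomy H e / holonomy H m₀) := by
  rintro ⟨q, hq⟩
  have hc := h.holonomy_pos
  set m : ℤ × ℤ := (q.den : ℤ) • e + (-q.num) • m₀
  have hden : (q.den : ℝ) ≠ 0 := by exact_mod_cast q.den_nz
  have hhol : holonomy H m = 0 := by
    rw [h.stream.holonomy_add, h.stream.holonomy_zsmul, h.stream.holonomy_zsmul]
    rw [eq_div_iff hc.ne', Rat.cast_def, div_mul_eq_mul_div, div_eq_iff hden] at hq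
    push_cast
    linarith
  -- Any level would serve.
  set a : ℝ := 0
  set σ := translateTime H φ g m a
  have hσ : 0 < σ := by
    have h1 := h.strictMono_translateTime he a (show (0 : ℤ) < q.den by exact_mod_cast q.pos)
    simp only [zero_smul, h.translateTime_zero] at h1
    have h2 : σ = translateTime H φ g ((q.den : ℤ) • e) a := by
      simp only [σ, m]
      rw [add_comm, h.translateTime_span]
    rw [h2]; exact h1
  have hm : m ≠ 0 := fun h0 => by
    simp only [σ, h0, h.translateTime_zero] at hσ
    exact hσ.false
  have hstep : φ σ (crossing H g a) = crossing H g a + latticeVec m := by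
    have := h.flow_translateTime m a
    rwa [hhol, sub_zero] at this
  refine not_tendsto_irrational_of_translate hσ hm (fun k => ?_) hι (hlim (crossing H g a))
  induction k with
  | zero => simp [h.flow.zero]
  | succ k ih =>
    have e1 : ((k + 1 : ℕ) : ℝ) * σ = σ + k * σ := by push_cast; ring
    rw [e1, h.flow.add, ih, h.flow.add_vec (h.stream.field_periodic _), hstep, succ_nsmul,
      latticeVec_add (k • m), add_assoc, add_comm (latticeVec m)]

end IsTransverseLift

end ReturnTime

/-! ### Pulling forms back to the parameter space -/

noncomputable section Pullback

variable {M : Type*} [TopologicalSpace M] [ChartedSpace R3 M]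

/-- The pullback `F^* η` of a form on `M` to the parameter space. -/
def pullForm {k : ℕ} (F : ℝ × (ℝ × ℝ) → M) (η : ∀ x : M, (TangentSpace (𝓡 3) x) [⋀^Fin k]→L[ℝ] ℝ)
    (p : ℝ × (ℝ × ℝ)) : (ℝ × (ℝ × ℝ)) [⋀^Fin k]→L[ℝ] ℝ :=
  ContinuousAlternatingMap.compContinuousLinearMap (η (F p))
    (mfderiv 𝓘(ℝ, ℝ × (ℝ × ℝ)) (𝓡 3) F p)

theorem pullForm_apply {k : ℕ} (F : ℝ × (ℝ × ℝ) → M)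
    (η : ∀ x : M, (TangentSpace (𝓡 3) x) [⋀^Fin k]→L[ℝ] ℝ) (p : ℝ × (ℝ × ℝ))
    (u : Fin k → ℝ × (ℝ × ℝ)) :
    pullForm F η p u = η (F p) fun i => mfderiv 𝓘(ℝ, ℝ × (ℝ × ℝ)) (𝓡 3) F p (u i) := rfl

variable {J : Set ℝ} {F : ℝ × (ℝ × ℝ) → M}

theorem contDiffAt_chart_comp [IsManifold (𝓡 3) ∞ M] (hJ : IsOpen J)
    (hF : ContMDiffOn 𝓘(ℝ, ℝ × (ℝ × ℝ)) (𝓡 3) ∞ F (J ×ˢ univ)) {p : ℝ × (ℝ × ℝ)} (hp : p.1 ∈ J)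
    {c : M} (hc : F p ∈ (extChartAt (𝓡 3) c).source) :
    ContDiffAt ℝ ∞ (fun q => extChartAt (𝓡 3) c (F q)) p := by
  have h1 : ContMDiffAt 𝓘(ℝ, ℝ × (ℝ × ℝ)) (𝓡 3) ∞ F p :=
    hF.contMDiffAt ((hJ.prod isOpen_univ).mem_nhds ⟨hp, trivial⟩)
  have h2 : ContMDiffAt (𝓡 3) 𝓘(ℝ, R3) ∞ (extChartAt (𝓡 3) c) (F p) :=
    contMDiffAt_extChartAt' (by rwa [extChartAt_source] at hc)
  exact contMDiffAt_iff_contDiffAt.1 (h2.comp p h1)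

theorem mfderiv_eq_chart_comp [IsManifold (𝓡 3) ∞ M] (hJ : IsOpen J)
    (hF : ContMDiffOn 𝓘(ℝ, ℝ × (ℝ × ℝ)) (𝓡 3) ∞ F (J ×ˢ univ)) {p : ℝ × (ℝ × ℝ)} (hp : p.1 ∈ J)
    {c : M} (hc : F p ∈ (extChartAt (𝓡 3) c).source) (u : ℝ × (ℝ × ℝ)) :
    (mfderiv 𝓘(ℝ, ℝ × (ℝ × ℝ)) (𝓡 3) F p u : R3)
      = mfderiv 𝓘(ℝ, R3) (𝓡 3) (extChartAt (𝓡 3) c).symm (extChartAt (𝓡 3) c (F p))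
        (fderiv ℝ (fun q => extChartAt (𝓡 3) c (F q)) p u) := by
  have hFc : ContinuousAt F p :=
    hF.continuousOn.continuousAt ((hJ.prod isOpen_univ).mem_nhds ⟨hp, trivial⟩)
  have hG := contDiffAt_chart_comp hJ hF hp hc
  have h1 : MDifferentiableAt 𝓘(ℝ, ℝ × (ℝ × ℝ)) 𝓘(ℝ, R3)
      (fun q => extChartAt (𝓡 3) c (F q)) p :=
    (hG.differentiableAt (by simp)).mdifferentiableAt
  have h2 : MDifferentiableAt 𝓘(ℝ, R3) (𝓡 3) (extChartAt (𝓡 3) c).symm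
      (extChartAt (𝓡 3) c (F p)) :=
    ((contMDiffOn_extChartAt_symm (I := 𝓡 3) (n := ∞) c).contMDiffAt
      ((isOpen_extChartAt_target c).mem_nhds ((extChartAt (𝓡 3) c).map_source hc))).mdifferentiableAt
      (by simp)
  have h3 : F =ᶠ[𝓝 p] (extChartAt (𝓡 3) c).symm ∘ fun q => extChartAt (𝓡 3) c (F q) := by
    filter_upwards [hFc ((isOpen_extChartAt_source (I := 𝓡 3) c).mem_nhds hc)] with q hq
    exact ((extChartAt (𝓡 3) c).left_inv hq).symm
  have h4 := h3.mfderiv_eq (I := 𝓘(ℝ, ℝ × (ℝ × ℝ))) (I' := 𝓡 3)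
  have h5 := mfderiv_comp p h2 h1
  rw [mfderiv_eq_fderiv] at h5
  exact congrArg (fun L : ℝ × (ℝ × ℝ) →L[ℝ] R3 => L u) (h4.trans h5)

/-- Factoring the pullback through a chart turns statements about forms on `M` into statements about
forms on vector spaces. -/
theorem pullForm_eq_chart [IsManifold (𝓡 3) ∞ M] {k : ℕ} (hJ : IsOpen J)
    (hF : ContMDiffOn 𝓘(ℝ, ℝ × (ℝ × ℝ)) (𝓡 3) ∞ F (J ×ˢ univ)) {p : ℝ × (ℝ × ℝ)} (hp : p.1 ∈ J)
    {c : M} (hc : F p ∈ (extChartAt (𝓡 3) c).source)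
    (η : ∀ x : M, (TangentSpace (𝓡 3) x) [⋀^Fin k]→L[ℝ] ℝ) :
    pullForm F η p = (formInChart η c (extChartAt (𝓡 3) c (F p))).compContinuousLinearMap
      (fderiv ℝ (fun q => extChartAt (𝓡 3) c (F q)) p) := by
  have hx : ∀ x y : M, x = y → ∀ w : Fin k → R3, η x w = η y w := by rintro x _ rfl w; rfl
  ext u
  refine Eq.trans ?_ (hx _ _ ((extChartAt (𝓡 3) c).left_inv hc).symm _)
  rw [pullForm_apply]
  exact congrArg (η (F p)) (funext fun i => mfderiv_eq_chart_comp hJ hF hp hc (u i))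

theorem ContDiffAt.continuousAlternatingMap_comp_apply {E G : Type*} [NormedAddCommGroup E]
    [NormedSpace ℝ E] [NormedAddCommGroup G] [NormedSpace ℝ G] {k : ℕ} {n : WithTop ℕ∞}
    {η : E → G [⋀^Fin k]→L[ℝ] ℝ} {A : E → E →L[ℝ] G} {p : E} (hη : ContDiffAt ℝ n η p)
    (hA : ContDiffAt ℝ n A p) (u : Fin k → E) :
    ContDiffAt ℝ n (fun q => η q fun i => A q (u i)) p := by
  have h1 : ContDiffAt ℝ n (fun q => ContinuousMultilinearMap.compContinuousLinearMapContinuousMultilinear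
      ℝ (fun _ : Fin k => E) (fun _ : Fin k => G) ℝ (fun _ => A q)) p :=
    (ContinuousMultilinearMap.contDiff _).contDiffAt.comp p (contDiffAt_pi.2 fun _ => hA)
  have h2 : ContDiffAt ℝ n (fun q => (η q).toContinuousMultilinearMap) p :=
    (ContinuousAlternatingMap.toContinuousMultilinearMapCLM (𝕜 := ℝ) (E := G) (F := ℝ)
      (ι := Fin k) ℝ).contDiff.contDiffAt.comp p hη
  exact (ContinuousMultilinearMap.apply ℝ (fun _ : Fin k => E) ℝ u).contDiff.contDiffAt.comp p
    (h1.clm_apply h2)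

theorem eventually_mem_chart [IsManifold (𝓡 3) ∞ M] (hJ : IsOpen J)
    (hF : ContMDiffOn 𝓘(ℝ, ℝ × (ℝ × ℝ)) (𝓡 3) ∞ F (J ×ˢ univ)) {p : ℝ × (ℝ × ℝ)} (hp : p.1 ∈ J)
    {c : M} (hc : F p ∈ (extChartAt (𝓡 3) c).source) :
    ∀ᶠ q in 𝓝 p, q.1 ∈ J ∧ F q ∈ (extChartAt (𝓡 3) c).source := by
  have hU := (hJ.prod isOpen_univ).mem_nhds (⟨hp, trivial⟩ : p ∈ J ×ˢ (univ : Set (ℝ × ℝ)))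
  filter_upwards [hU, (hF.continuousOn.continuousAt hU)
    ((isOpen_extChartAt_source (I := 𝓡 3) c).mem_nhds hc)] with q h1 h2 using ⟨h1.1, h2⟩

theorem contDiffAt_formInChart_comp [IsManifold (𝓡 3) ∞ M] {k : ℕ}
    {η : ∀ x : M, (TangentSpace (𝓡 3) x) [⋀^Fin k]→L[ℝ] ℝ} (hη : IsSmoothForm η) {c x : M}
    (hc : x ∈ (extChartAt (𝓡 3) c).source) :
    ContDiffAt ℝ ∞ (formInChart η c) (extChartAt (𝓡 3) c x) :=
  (hη c).contDiffAt ((isOpen_extChartAt_target c).mem_nhds ((extChartAt (𝓡 3) c).map_source hc))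

theorem contDiffAt_pullForm_apply [IsManifold (𝓡 3) ∞ M] {k : ℕ} (hJ : IsOpen J)
    (hF : ContMDiffOn 𝓘(ℝ, ℝ × (ℝ × ℝ)) (𝓡 3) ∞ F (J ×ˢ univ)) {p : ℝ × (ℝ × ℝ)} (hp : p.1 ∈ J)
    {η : ∀ x : M, (TangentSpace (𝓡 3) x) [⋀^Fin k]→L[ℝ] ℝ} (hη : IsSmoothForm η)
    (u : Fin k → ℝ × (ℝ × ℝ)) :
    ContDiffAt ℝ ∞ (fun q => pullForm F η q u) p := by
  have hc := mem_extChartAt_source (I := 𝓡 3) (F p)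
  have hG := contDiffAt_chart_comp hJ hF hp hc
  have h1 : ContDiffAt ℝ ∞ (fun q => formInChart η (F p) (extChartAt (𝓡 3) (F p) (F q))) p :=
    ContDiffAt.comp (g := formInChart η (F p)) (f := fun q => extChartAt (𝓡 3) (F p) (F q)) p
      (contDiffAt_formInChart_comp hη hc) hG
  have h2 : ContDiffAt ℝ ∞ (fderiv ℝ fun q => extChartAt (𝓡 3) (F p) (F q)) p :=
    hG.fderiv_right (by simp)
  refine (h1.continuousAlternatingMap_comp_apply h2 u).congr_of_eventuallyEq ?_
  filter_upwards [eventually_mem_chart hJ hF hp hc] with q hq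
  rw [pullForm_eq_chart hJ hF hq.1 hq.2]
  rfl

/-- Naturality of the exterior derivative, read in the chart around the image point. -/
theorem extDeriv_pullForm [IsManifold (𝓡 3) ∞ M] {k : ℕ} (hJ : IsOpen J)
    (hF : ContMDiffOn 𝓘(ℝ, ℝ × (ℝ × ℝ)) (𝓡 3) ∞ F (J ×ˢ univ)) {p : ℝ × (ℝ × ℝ)} (hp : p.1 ∈ J)
    {α : ∀ x : M, (TangentSpace (𝓡 3) x) [⋀^Fin k]→L[ℝ] ℝ} (hα : IsSmoothForm α)
    {β : ∀ x : M, (TangentSpace (𝓡 3) x) [⋀^Fin (k + 1)]→L[ℝ] ℝ} (h : IsExteriorDerivative α β) :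
    DifferentiableAt ℝ (pullForm F α) p ∧ extDeriv (pullForm F α) p = pullForm F β p := by
  have hc := mem_extChartAt_source (I := 𝓡 3) (F p)
  have hG := contDiffAt_chart_comp hJ hF hp hc
  have hα' := (contDiffAt_formInChart_comp hα hc).differentiableAt (by simp)
  have heq : pullForm F α =ᶠ[𝓝 p] fun q =>
      (formInChart α (F p) (extChartAt (𝓡 3) (F p) (F q))).compContinuousLinearMap
        (fderiv ℝ (fun q => extChartAt (𝓡 3) (F p) (F q)) q) := by
    filter_upwards [eventually_mem_chart hJ hF hp hc] with q hq
    exact pullForm_eq_chart hJ hF hq.1 hq.2 α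
  have h2 : ContDiffAt ℝ ∞ (fderiv ℝ fun q => extChartAt (𝓡 3) (F p) (F q)) p :=
    hG.fderiv_right (by simp)
  constructor
  · exact ((hα'.comp p (hG.differentiableAt (by simp))).continuousAlternatingMapCompContinuousLinearMap
      (h2.differentiableAt (by simp))).congr_of_eventuallyEq heq
  · rw [heq.extDeriv_eq, extDeriv_pullback (f := fun q => extChartAt (𝓡 3) (F p) (F q)) hα' hG
      (by rw [minSmoothness_of_isRCLikeNormedField]; exact ENat.LEInfty.out), pullForm_eq_chart hJ hF hp hc,
      h _ _ ((extChartAt (𝓡 3) (F p)).map_source hc)]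

end Pullback

/-! ### The flux form and the potential in torus coordinates -/

noncomputable section TorusCoordinates

/-- The Poincaré lemma for `P dx + Q dy` on the convex set `ℝ²`. -/
theorem exists_primitive_of_closed {P Q : ℝ × ℝ → ℝ} (hP : Differentiable ℝ P)
    (hQ : Differentiable ℝ Q) (h : ∀ x, fderiv ℝ P x (0, 1) = fderiv ℝ Q x (1, 0)) :
    ∃ H : ℝ × ℝ → ℝ, ∀ x, HasFDerivAt H
      (P x • ContinuousLinearMap.fst ℝ ℝ ℝ + Q x • ContinuousLinearMap.snd ℝ ℝ ℝ) x := by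
  have hd : ∀ x, HasFDerivAt (fun x => P x • ContinuousLinearMap.fst ℝ ℝ ℝ
      + Q x • ContinuousLinearMap.snd ℝ ℝ ℝ)
      ((fderiv ℝ P x).smulRight (ContinuousLinearMap.fst ℝ ℝ ℝ)
        + (fderiv ℝ Q x).smulRight (ContinuousLinearMap.snd ℝ ℝ ℝ)) x := fun x =>
    ((hP x).hasFDerivAt.smul_const (ContinuousLinearMap.fst ℝ ℝ ℝ)).add
      ((hQ x).hasFDerivAt.smul_const (ContinuousLinearMap.snd ℝ ℝ ℝ))
  have hdiff : DifferentiableOn ℝ (fun x => P x • ContinuousLinearMap.fst ℝ ℝ ℝ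
      + Q x • ContinuousLinearMap.snd ℝ ℝ ℝ) univ :=
    fun x _ => (hd x).differentiableAt.differentiableWithinAt
  obtain ⟨H, hH⟩ := convex_univ.exists_forall_hasFDerivAt_of_fderiv_symmetric isOpen_univ
    hdiff (fun x _ y z => by
      rw [(hd x).fderiv]
      have e : ∀ (A : ℝ × ℝ →L[ℝ] ℝ) (y : ℝ × ℝ), A y = y.1 * A (1, 0) + y.2 * A (0, 1) := by
        intro A y
        have : y = y.1 • ((1 : ℝ), (0 : ℝ)) + y.2 • ((0 : ℝ), (1 : ℝ)) := by ext <;> simp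
        conv_lhs => rw [this, map_add, map_smul, map_smul, smul_eq_mul, smul_eq_mul]
      simp only [add_apply, ContinuousLinearMap.smulRight_apply,
        smul_apply, ContinuousLinearMap.coe_fst', ContinuousLinearMap.coe_snd',
        smul_eq_mul]
      rw [e (fderiv ℝ P x) y, e (fderiv ℝ P x) z, e (fderiv ℝ Q x) y, e (fderiv ℝ Q x) z, h x]
      ring)
  exact ⟨H, fun x => hH x trivial⟩

/-- The unit vectors of the parameter space `ℝ × ℝ²`. -/
def paramVec : Fin 3 → ℝ × (ℝ × ℝ) := ![(1, (0, 0)), (0, (1, 0)), (0, (0, 1))]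

/-- Coordinate description, on `J × (ℝ/ℤ)²`, of the volume form `f ds ∧ dθ₁ ∧ dθ₂`, of a vector
field `v` tangent to the tori, and of a potential `a₀ ds + a₁ dθ₁ + a₂ dθ₂` of its flux form. -/
structure IsTorusField (J : Set ℝ) (f : ℝ × (ℝ × ℝ) → ℝ) (v : ℝ × (ℝ × ℝ) → ℝ × ℝ)
    (a : Fin 3 → ℝ × (ℝ × ℝ) → ℝ) : Prop where
  isOpen : IsOpen J
  contDiffAt_density : ∀ p, p.1 ∈ J → ContDiffAt ℝ 2 f p
  contDiffAt_field : ∀ p, p.1 ∈ J → ContDiffAt ℝ 1 v p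
  contDiffAt_potential : ∀ i p, p.1 ∈ J → ContDiffAt ℝ 2 (a i) p
  density_ne : ∀ p, p.1 ∈ J → f p ≠ 0
  field_ne : ∀ p, p.1 ∈ J → v p ≠ 0
  density_periodic : ∀ s ∈ J, ∀ m θ, f (s, θ + latticeVec m) = f (s, θ)
  field_periodic : ∀ s ∈ J, ∀ m θ, v (s, θ + latticeVec m) = v (s, θ)
  potential_periodic : ∀ i, ∀ s ∈ J, ∀ m θ, a i (s, θ + latticeVec m) = a i (s, θ)
  flux_fst : ∀ p, p.1 ∈ J → f p * (v p).2
    = fderiv ℝ (a 1) p (paramVec 0) - fderiv ℝ (a 0) p (paramVec 1)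
  flux_snd : ∀ p, p.1 ∈ J → -(f p * (v p).1)
    = fderiv ℝ (a 2) p (paramVec 0) - fderiv ℝ (a 0) p (paramVec 2)
  closed : ∀ p, p.1 ∈ J →
    fderiv ℝ (a 2) p (paramVec 1) = fderiv ℝ (a 1) p (paramVec 2)

namespace IsTorusField

variable {J : Set ℝ} {f : ℝ × (ℝ × ℝ) → ℝ} {v : ℝ × (ℝ × ℝ) → ℝ × ℝ}
  {a : Fin 3 → ℝ × (ℝ × ℝ) → ℝ} {s : ℝ}

theorem mem_nhds (h : IsTorusField J f v a) {p : ℝ × (ℝ × ℝ)} (hp : p.1 ∈ J) :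
    {q : ℝ × (ℝ × ℝ) | q.1 ∈ J} ∈ 𝓝 p :=
  (h.isOpen.preimage continuous_fst).mem_nhds hp

theorem fderiv_slice {F : Type*} [NormedAddCommGroup F] [NormedSpace ℝ F] {b : ℝ × (ℝ × ℝ) → F}
    {θ : ℝ × ℝ} (hb : DifferentiableAt ℝ b (s, θ)) :
    HasFDerivAt (fun θ => b (s, θ)) ((fderiv ℝ b (s, θ)).comp
      (ContinuousLinearMap.inr ℝ ℝ (ℝ × ℝ))) θ :=
  hb.hasFDerivAt.comp θ (hasFDerivAt_prodMk_right s θ)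

theorem contDiff_slice {F : Type*} [NormedAddCommGroup F] [NormedSpace ℝ F] {n : WithTop ℕ∞}
    {b : ℝ × (ℝ × ℝ) → F} (hb : ∀ p : ℝ × (ℝ × ℝ), p.1 ∈ J → ContDiffAt ℝ n b p) (hs : s ∈ J) :
    ContDiff ℝ n fun θ => b (s, θ) :=
  contDiff_iff_contDiffAt.2 fun θ => (hb (s, θ) hs).comp θ
    (contDiff_const.prodMk contDiff_id).contDiffAt

theorem exists_primitive (h : IsTorusField J f v a) (hs : s ∈ J) :
    ∃ A : ℝ × ℝ → ℝ, ∀ θ, HasFDerivAt A (a 1 (s, θ) • ContinuousLinearMap.fst ℝ ℝ ℝ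
      + a 2 (s, θ) • ContinuousLinearMap.snd ℝ ℝ ℝ) θ := by
  have hd : ∀ i θ, DifferentiableAt ℝ (a i) (s, θ) := fun i θ =>
    (h.contDiffAt_potential i _ hs).differentiableAt (by simp)
  refine exists_primitive_of_closed (fun θ => (fderiv_slice (hd 1 θ)).differentiableAt)
    (fun θ => (fderiv_slice (hd 2 θ)).differentiableAt) fun θ => ?_
  rw [(fderiv_slice (hd 1 θ)).fderiv, (fderiv_slice (hd 2 θ)).fderiv]
  simpa [paramVec] using (h.closed (s, θ) hs).symm

theorem hasFDerivAt_fderiv (h : IsTorusField J f v a) (i : Fin 3) {p : ℝ × (ℝ × ℝ)} (hp : p.1 ∈ J)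
    (u : ℝ × (ℝ × ℝ)) : HasFDerivAt (fun q => fderiv ℝ (a i) q u)
      ((fderiv ℝ (fderiv ℝ (a i)) p).flip u) p := by
  have h1 : DifferentiableAt ℝ (fderiv ℝ (a i)) p :=
    ((h.contDiffAt_potential i p hp).fderiv_right (m := 1) (by norm_num)).differentiableAt (by simp)
  have := h1.hasFDerivAt.clm_apply (hasFDerivAt_const u p)
  simpa using this

theorem second_symm (h : IsTorusField J f v a) (i : Fin 3) {p : ℝ × (ℝ × ℝ)} (hp : p.1 ∈ J)
    (u w : ℝ × (ℝ × ℝ)) : fderiv ℝ (fderiv ℝ (a i)) p u w = fderiv ℝ (fderiv ℝ (a i)) p w u :=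
  ((h.contDiffAt_potential i p hp).isSymmSndFDerivAt (by simp)) u w

/-- By the flux equations the flux form is `∂ₛ(a₁ dθ₁ + a₂ dθ₂) - d a₀` on the torus. The potential
is closed on every torus, so its `s`-derivative is closed as well. -/
theorem exists_isStreamFunction (h : IsTorusField J f v a) (hs : s ∈ J) :
    ∃ H, IsStreamFunction (fun θ => f (s, θ)) (fun θ => v (s, θ)) H := by
  set P : ℝ × (ℝ × ℝ) → ℝ := fun q => fderiv ℝ (a 1) q (paramVec 0) - fderiv ℝ (a 0) q (paramVec 1)
  set Q : ℝ × (ℝ × ℝ) → ℝ := fun q => fderiv ℝ (a 2) q (paramVec 0) - fderiv ℝ (a 0) q (paramVec 2)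
  have hP : ∀ θ, HasFDerivAt P _ (s, θ) := fun θ =>
    (h.hasFDerivAt_fderiv 1 (p := (s, θ)) hs (paramVec 0)).sub
      (h.hasFDerivAt_fderiv 0 (p := (s, θ)) hs (paramVec 1))
  have hQ : ∀ θ, HasFDerivAt Q _ (s, θ) := fun θ =>
    (h.hasFDerivAt_fderiv 2 (p := (s, θ)) hs (paramVec 0)).sub
      (h.hasFDerivAt_fderiv 0 (p := (s, θ)) hs (paramVec 2))
  obtain ⟨H, hH⟩ := exists_primitive_of_closed (P := fun θ => P (s, θ)) (Q := fun θ => Q (s, θ))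
    (fun θ => (fderiv_slice (hP θ).differentiableAt).differentiableAt)
    (fun θ => (fderiv_slice (hQ θ).differentiableAt).differentiableAt) (fun θ => by
      rw [(fderiv_slice (hP θ).differentiableAt).fderiv,
        (fderiv_slice (hQ θ).differentiableAt).fderiv, (hP θ).fderiv, (hQ θ).fderiv]
      have e1 : ((0 : ℝ), ((1 : ℝ), (0 : ℝ))) = paramVec 1 := rfl
      have e2 : ((0 : ℝ), ((0 : ℝ), (1 : ℝ))) = paramVec 2 := rfl
      simp only [ContinuousLinearMap.comp_apply, ContinuousLinearMap.inr_apply, e1, e2,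
        sub_apply, ContinuousLinearMap.flip_apply]
      have hs' : ((s, θ) : ℝ × (ℝ × ℝ)).1 ∈ J := hs
      -- Closedness holds for all labels near `s`, so it can be differentiated in the label.
      have hcl : (fun q => fderiv ℝ (a 2) q (paramVec 1)) =ᶠ[𝓝 (s, θ)]
          fun q => fderiv ℝ (a 1) q (paramVec 2) := by
        filter_upwards [h.mem_nhds hs'] with q hq using h.closed q hq
      have h1 := hcl.fderiv_eq (𝕜 := ℝ)
      rw [(h.hasFDerivAt_fderiv 2 hs' (paramVec 1)).fderiv,
        (h.hasFDerivAt_fderiv 1 hs' (paramVec 2)).fderiv] at h1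
      have h2 := congrArg (fun L : ℝ × (ℝ × ℝ) →L[ℝ] ℝ => L (paramVec 0)) h1
      simp only [ContinuousLinearMap.flip_apply] at h2
      rw [h.second_symm 1 hs' (paramVec 2), ← h2, h.second_symm 2 hs' (paramVec 0),
        h.second_symm 0 hs' (paramVec 2)])
  refine ⟨H, ⟨contDiff_slice h.contDiffAt_field hs,
    (contDiff_slice h.contDiffAt_density hs).of_le (by norm_num),
    fun θ => h.density_ne _ hs, fun θ => h.field_ne _ hs, fun m θ => h.field_periodic s hs m θ,
    fun m θ => h.density_periodic s hs m θ, fun θ => ?_⟩⟩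
  have e : (f (s, θ) * (v (s, θ)).2) • ContinuousLinearMap.fst ℝ ℝ ℝ
      - (f (s, θ) * (v (s, θ)).1) • ContinuousLinearMap.snd ℝ ℝ ℝ
      = P (s, θ) • ContinuousLinearMap.fst ℝ ℝ ℝ + Q (s, θ) • ContinuousLinearMap.snd ℝ ℝ ℝ := by
    rw [show P (s, θ) = f (s, θ) * (v (s, θ)).2 from (h.flux_fst (s, θ) hs).symm,
      show Q (s, θ) = -(f (s, θ) * (v (s, θ)).1) from (h.flux_snd (s, θ) hs).symm]
    refine ContinuousLinearMap.ext fun y => ?_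
    simp only [sub_apply, add_apply, smul_apply, smul_eq_mul]
    ring
  exact e ▸ hH θ

/-- The integral of the potential over the closed curves in the class `m` has the derivative
`holonomy H m` with respect to the label. -/
theorem hasDerivAt_period (h : IsTorusField J f v a) (hs : s ∈ J) {H : ℝ × ℝ → ℝ}
    (hH : IsStreamFunction (fun θ => f (s, θ)) (fun θ => v (s, θ)) H) (m : ℤ × ℤ) :
    HasDerivAt (fun r => ∫ t in (0 : ℝ)..1, (a 1 (r, t • latticeVec m) * m.1
      + a 2 (r, t • latticeVec m) * m.2)) (holonomy H m) s := by
  set G : ℝ → ℝ → ℝ := fun r t => a 1 (r, t • latticeVec m) * m.1 + a 2 (r, t • latticeVec m) * m.2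
  set G' : ℝ → ℝ → ℝ := fun r t => fderiv ℝ (a 1) (r, t • latticeVec m) (paramVec 0) * m.1
    + fderiv ℝ (a 2) (r, t • latticeVec m) (paramVec 0) * m.2
  have hGd : ∀ r ∈ J, ∀ t, HasDerivAt (fun r => G r t) (G' r t) r := by
    intro r hr t
    have hc : HasDerivAt (fun r : ℝ => (r, t • latticeVec m)) (paramVec 0) r :=
      (hasDerivAt_id r).prodMk (hasDerivAt_const r (t • latticeVec m))
    have hi : ∀ i, HasDerivAt (fun r => a i (r, t • latticeVec m))
        (fderiv ℝ (a i) (r, t • latticeVec m) (paramVec 0)) r := fun i =>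
      ((h.contDiffAt_potential i _ hr).differentiableAt (by simp)).hasFDerivAt.comp_hasDerivAt r hc
    exact ((hi 1).mul_const _).add ((hi 2).mul_const _)
  have hcont : ∀ i, ContinuousOn (fun p : ℝ × ℝ => fderiv ℝ (a i) (p.1, p.2 • latticeVec m)
      (paramVec 0)) (J ×ˢ univ) := by
    intro i p hp
    have h1 : ContinuousAt (fun q => fderiv ℝ (a i) q (paramVec 0)) (p.1, p.2 • latticeVec m) :=
      (h.hasFDerivAt_fderiv i hp.1 (paramVec 0)).continuousAt
    exact (ContinuousAt.comp (f := fun p : ℝ × ℝ => (p.1, p.2 • latticeVec m)) h1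
      (by fun_prop)).continuousWithinAt
  have hG'c : ContinuousOn (fun p : ℝ × ℝ => G' p.1 p.2) (J ×ˢ univ) :=
    ((hcont 1).mul continuousOn_const).add ((hcont 2).mul continuousOn_const)
  have hac : ∀ i, ∀ r ∈ J, Continuous fun t : ℝ => a i (r, t • latticeVec m) := fun i r hr =>
    (contDiff_slice (h.contDiffAt_potential i) hr).continuous.comp (by fun_prop)
  have hGc : ∀ r ∈ J, Continuous (G r) := fun r hr =>
    ((hac 1 r hr).mul continuous_const).add ((hac 2 r hr).mul continuous_const)
  obtain ⟨ε, hε, hball⟩ := Metric.nhds_basis_closedBall.mem_iff.1 (h.isOpen.mem_nhds hs)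
  obtain ⟨C, hC⟩ := ((isCompact_closedBall s ε).prod (isCompact_Icc (a := (0 : ℝ)) (b := 1))
    ).exists_bound_of_continuousOn (hG'c.mono (prod_mono hball (subset_univ _)))
  have hG's : Continuous (G' s) := by
    have := hG'c.comp_continuous (f := fun t : ℝ => (s, t)) (by fun_prop) (fun t => ⟨hs, trivial⟩)
    exact this
  have key := (intervalIntegral.hasDerivAt_integral_of_dominated_loc_of_deriv_le (μ := volume)
    (a := 0) (b := 1) (F := G) (F' := G') (x₀ := s) (s := Metric.closedBall s ε)
    (bound := fun _ => C)
    (Metric.closedBall_mem_nhds s hε)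
    (by
      filter_upwards [h.isOpen.mem_nhds hs] with r hr
      exact (hGc r hr).aestronglyMeasurable)
    ((hGc s hs).intervalIntegrable _ _) hG's.aestronglyMeasurable
    (Eventually.of_forall fun t ht r hr => hC (r, t) ⟨hr, by
      rw [uIoc_of_le zero_le_one] at ht; exact Ioc_subset_Icc_self ht⟩)
    intervalIntegrable_const
    (Eventually.of_forall fun t _ r hr => hGd r (hball hr) t)).2
  refine key.congr_deriv ?_
  have hline : ∀ t : ℝ, HasDerivAt (fun t : ℝ => t • latticeVec m) (latticeVec m) t := fun t => by
    simpa using (hasDerivAt_id t).smul_const (latticeVec m)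
  -- By the flux equations the derivative of the integrand is `d(H + a₀)` along the segment; the
  -- periodic `a₀` has the same value at both ends.
  have hprim : ∀ t, HasDerivAt (fun t : ℝ => H (t • latticeVec m) + a 0 (s, t • latticeVec m))
      (G' s t) t := by
    intro t
    have h1 := hH.hasDerivAt_comp (hline t)
    have h2 := (fderiv_slice (((h.contDiffAt_potential 0 (s, t • latticeVec m) hs)).differentiableAt
      (by simp))).comp_hasDerivAt t (hline t)
    refine (h1.add h2).congr_deriv ?_
    have f1 := h.flux_fst (s, t • latticeVec m) hs
    have f2 := h.flux_snd (s, t • latticeVec m) hs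
    have e : ((0 : ℝ), latticeVec m) = (m.1 : ℝ) • paramVec 1 + (m.2 : ℝ) • paramVec 2 := by
      simp [paramVec, latticeVec]
    simp only [ContinuousLinearMap.comp_apply, ContinuousLinearMap.inr_apply, e, map_add, map_smul,
      smul_eq_mul, latticeVec_fst, latticeVec_snd, G']
    linear_combination (m.1 : ℝ) * f1 + (m.2 : ℝ) * f2
  rw [intervalIntegral.integral_eq_sub_of_hasDerivAt (fun t _ => hprim t)
    (hG's.intervalIntegrable _ _)]
  have hper := h.potential_periodic 0 s hs m 0
  simp only [zero_add] at hper
  simp [holonomy, hper]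

end IsTorusField

end TorusCoordinates

/-! ### The given field and forms as coordinate data -/

noncomputable section TorusRegion

/-- The basis of the parameter space formed by the vectors `paramVec`. -/
def paramBasis : Module.Basis (Fin 3) ℝ (ℝ × (ℝ × ℝ)) :=
  Module.Basis.ofEquivFun
    { toFun := fun p => ![p.1, p.2.1, p.2.2]
      invFun := fun w => (w 0, (w 1, w 2))
      map_add' := fun p q => by ext i; fin_cases i <;> rfl
      map_smul' := fun c p => by ext i; fin_cases i <;> rfl
      left_inv := fun p => rfl
      right_inv := fun w => by ext i; fin_cases i <;> rfl }

theorem coe_paramBasis : ⇑paramBasis = paramVec := by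
  funext i
  rw [paramBasis, Module.Basis.coe_ofEquivFun]
  fin_cases i <;> simp [paramVec] <;> rfl

theorem paramBasis_repr (p : ℝ × (ℝ × ℝ)) (i : Fin 3) :
    paramBasis.repr p i = ![p.1, p.2.1, p.2.2] i := rfl

theorem alternating_apply_three (η : (ℝ × (ℝ × ℝ)) [⋀^Fin 3]→L[ℝ] ℝ) (x y z : ℝ × (ℝ × ℝ)) :
    η ![x, y, z] = (x.1 * (y.2.1 * z.2.2 - y.2.2 * z.2.1) - y.1 * (x.2.1 * z.2.2 - x.2.2 * z.2.1)
      + z.1 * (x.2.1 * y.2.2 - x.2.2 * y.2.1)) * η paramVec := by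
  have h := congrArg (fun g => g ![x, y, z]) (η.toAlternatingMap.eq_smul_basis_det paramBasis)
  simp only [AlternatingMap.smul_apply, Module.Basis.det_apply, Matrix.det_fin_three,
    Module.Basis.toMatrix_apply, paramBasis_repr, coe_paramBasis, smul_eq_mul] at h
  refine h.trans ?_
  simp
  ring

theorem alternating_eq_zero {η : (ℝ × (ℝ × ℝ)) [⋀^Fin 3]→L[ℝ] ℝ} (h : η paramVec = 0)
    (u : Fin 3 → ℝ × (ℝ × ℝ)) : η u = 0 := by
  have e : u = ![u 0, u 1, u 2] := by ext i <;> fin_cases i <;> rfl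
  rw [e, alternating_apply_three, h, mul_zero]

variable {M : Type*} [TopologicalSpace M] [ChartedSpace R3 M]

/-- The density of `F^* Ω` with respect to the standard volume form of the parameter space. -/
def torusDensity (F : ℝ × (ℝ × ℝ) → M) (Ω : ∀ x : M, (TangentSpace (𝓡 3) x) [⋀^Fin 3]→L[ℝ] ℝ)
    (p : ℝ × (ℝ × ℝ)) : ℝ := pullForm F Ω p paramVec

/-- The coefficients of `F^* α`. -/
def torusPotential (F : ℝ × (ℝ × ℝ) → M) (α : ∀ x : M, (TangentSpace (𝓡 3) x) [⋀^Fin 1]→L[ℝ] ℝ)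
    (i : Fin 3) (p : ℝ × (ℝ × ℝ)) : ℝ := pullForm F α p ![paramVec i]

/-- The components, in the angular coordinates, of a field `B` tangent to the tori. -/
def torusField (F : ℝ × (ℝ × ℝ) → M) (B : ∀ x : M, TangentSpace (𝓡 3) x)
    (p : ℝ × (ℝ × ℝ)) : ℝ × ℝ :=
  Classical.epsilon fun v : ℝ × ℝ =>
    B (F p) = mfderiv 𝓘(ℝ, ℝ × (ℝ × ℝ)) (𝓡 3) F p ((0 : ℝ), v)

variable {J : Set ℝ} {F : ℝ × (ℝ × ℝ) → M} {ψ : M → ℝ}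

namespace IsTorusFoliation

theorem injective_mfderiv (hF : IsTorusFoliation J F ψ) {p : ℝ × (ℝ × ℝ)} (hp : p.1 ∈ J) :
    Function.Injective (mfderiv 𝓘(ℝ, ℝ × (ℝ × ℝ)) (𝓡 3) F p : ℝ × (ℝ × ℝ) → R3) :=
  hF.immersion p.1 hp p.2

theorem surjective_mfderiv (hF : IsTorusFoliation J F ψ) {p : ℝ × (ℝ × ℝ)} (hp : p.1 ∈ J) :
    Function.Surjective (mfderiv 𝓘(ℝ, ℝ × (ℝ × ℝ)) (𝓡 3) F p : ℝ × (ℝ × ℝ) → R3) := by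
  let L : ℝ × (ℝ × ℝ) →L[ℝ] R3 := mfderiv 𝓘(ℝ, ℝ × (ℝ × ℝ)) (𝓡 3) F p
  have hd : Module.finrank ℝ (ℝ × (ℝ × ℝ)) = Module.finrank ℝ R3 := by simp
  exact (LinearMap.injective_iff_surjective_of_finrank_eq_finrank (f := L.toLinearMap) hd).1
    (hF.injective_mfderiv hp)

theorem apply_add_latticeVec (hF : IsTorusFoliation J F ψ) {s : ℝ} (hs : s ∈ J) (m : ℤ × ℤ)
    (θ : ℝ × ℝ) : F (s, θ + latticeVec m) = F (s, θ) :=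
  ((hF.eq_iff s hs s hs θ _).2 ⟨rfl, m.1, m.2, rfl⟩).symm

theorem apply_eq_iff (hF : IsTorusFoliation J F ψ) {s : ℝ} (hs : s ∈ J) {θ θ' : ℝ × ℝ} :
    F (s, θ) = F (s, θ') ↔ ∃ m : ℤ × ℤ, θ' = θ + latticeVec m := by
  rw [hF.eq_iff s hs s hs]
  exact ⟨fun ⟨_, m, n, h⟩ => ⟨(m, n), h⟩, fun ⟨m, h⟩ => ⟨rfl, m.1, m.2, h⟩⟩

variable [IsManifold (𝓡 3) ∞ M]

theorem mfderiv_add_latticeVec (hF : IsTorusFoliation J F ψ) (hJ : IsOpen J) {s : ℝ} (hs : s ∈ J)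
    (m : ℤ × ℤ) (θ : ℝ × ℝ) (u : ℝ × (ℝ × ℝ)) :
    (mfderiv 𝓘(ℝ, ℝ × (ℝ × ℝ)) (𝓡 3) F (s, θ + latticeVec m) u : R3)
      = mfderiv 𝓘(ℝ, ℝ × (ℝ × ℝ)) (𝓡 3) F (s, θ) u := by
  have hper := hF.apply_add_latticeVec hs m θ
  have hc := mem_extChartAt_source (I := 𝓡 3) (F (s, θ))
  have hc' : F (s, θ + latticeVec m) ∈ (extChartAt (𝓡 3) (F (s, θ))).source := by rwa [hper]
  have e1 := mfderiv_eq_chart_comp hJ hF.smooth (p := (s, θ + latticeVec m)) hs hc' u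
  have e2 := mfderiv_eq_chart_comp hJ hF.smooth (p := (s, θ)) hs hc u
  -- Periodicity of `F` holds for all labels near `s`, so it passes to the full derivative,
  -- including the direction across the tori.
  have hsh : (fun q => extChartAt (𝓡 3) (F (s, θ)) (F (q + ((0 : ℝ), latticeVec m))))
      =ᶠ[𝓝 (s, θ)] fun q => extChartAt (𝓡 3) (F (s, θ)) (F q) := by
    filter_upwards [(hJ.preimage continuous_fst).mem_nhds (show ((s, θ) : ℝ × (ℝ × ℝ)).1 ∈ J from hs)]
      with q hq
    have : q + ((0 : ℝ), latticeVec m) = (q.1, q.2 + latticeVec m) := by ext <;> simp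
    rw [this, hF.apply_add_latticeVec hq]
  have e3 := hsh.fderiv_eq (𝕜 := ℝ)
  rw [fderiv_comp_add_right (f := fun q => extChartAt (𝓡 3) (F (s, θ)) (F q))] at e3
  have e4 : ((s, θ) : ℝ × (ℝ × ℝ)) + ((0 : ℝ), latticeVec m) = (s, θ + latticeVec m) := by
    ext <;> simp
  rw [e4] at e3
  rw [e3] at e1
  refine e1.trans (Eq.trans ?_ e2.symm)
  have hx : ∀ x y : M, x = y → ∀ w : R3,
      (mfderiv 𝓘(ℝ, R3) (𝓡 3) (extChartAt (𝓡 3) (F (s, θ))).symm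
        (extChartAt (𝓡 3) (F (s, θ)) x) w : R3)
      = mfderiv 𝓘(ℝ, R3) (𝓡 3) (extChartAt (𝓡 3) (F (s, θ))).symm
        (extChartAt (𝓡 3) (F (s, θ)) y) w := by rintro x _ rfl w; rfl
  exact hx _ _ hper _

theorem pullForm_add_latticeVec {k : ℕ} (hF : IsTorusFoliation J F ψ) (hJ : IsOpen J) {s : ℝ}
    (hs : s ∈ J) (η : ∀ x : M, (TangentSpace (𝓡 3) x) [⋀^Fin k]→L[ℝ] ℝ) (m : ℤ × ℤ) (θ : ℝ × ℝ) :
    pullForm F η (s, θ + latticeVec m) = pullForm F η (s, θ) := by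
  have hx : ∀ x y : M, x = y → ∀ w : Fin k → R3, η x w = η y w := by rintro x _ rfl w; rfl
  ext u
  refine Eq.trans ?_ (hx _ _ (hF.apply_add_latticeVec hs m θ) _)
  exact congrArg (η (F (s, θ + latticeVec m)))
    (funext fun i => hF.mfderiv_add_latticeVec hJ hs m θ (u i))

end IsTorusFoliation

theorem IsTangentToTori.torusField_spec {B : ∀ x : M, TangentSpace (𝓡 3) x}
    (hBF : IsTangentToTori J F B) {p : ℝ × (ℝ × ℝ)} (hp : p.1 ∈ J) :
    B (F p) = mfderiv 𝓘(ℝ, ℝ × (ℝ × ℝ)) (𝓡 3) F p ((0 : ℝ), torusField F B p) :=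
  Classical.epsilon_spec (hBF p.1 hp p.2)

theorem IsTorusFoliation.hasMFDerivAt_comp (hF : IsTorusFoliation J F ψ) (hJ : IsOpen J) {s : ℝ}
    (hs : s ∈ J) {θ : ℝ → ℝ × ℝ} {t : ℝ} {w : ℝ × ℝ} (hθ : HasDerivAt θ w t) :
    HasMFDerivAt 𝓘(ℝ, ℝ) (𝓡 3) (fun t => F (s, θ t)) t
      ((1 : ℝ →L[ℝ] ℝ).smulRight
        (mfderiv 𝓘(ℝ, ℝ × (ℝ × ℝ)) (𝓡 3) F (s, θ t) ((0 : ℝ), w) : R3)) := by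
  have h1 : HasMFDerivAt 𝓘(ℝ, ℝ) 𝓘(ℝ, ℝ × (ℝ × ℝ)) (fun t => (s, θ t)) t
      ((1 : ℝ →L[ℝ] ℝ).smulRight ((0 : ℝ), w)) :=
    ((hasDerivAt_const t s).prodMk hθ).hasFDerivAt.hasMFDerivAt
  have h2 : MDifferentiableAt 𝓘(ℝ, ℝ × (ℝ × ℝ)) (𝓡 3) F (s, θ t) :=
    (hF.smooth.contMDiffAt ((hJ.prod isOpen_univ).mem_nhds ⟨hs, trivial⟩)).mdifferentiableAt
      (by simp)
  have h3 := h2.hasMFDerivAt.comp t h1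
  refine h3.congr_mfderiv ?_
  exact ContinuousLinearMap.ext fun r : ℝ =>
    map_smul (mfderiv 𝓘(ℝ, ℝ × (ℝ × ℝ)) (𝓡 3) F (s, θ t)) r ((0 : ℝ), w)

theorem isMIntegralCurve_comp {B : ∀ x : M, TangentSpace (𝓡 3) x} (hF : IsTorusFoliation J F ψ)
    (hJ : IsOpen J) (hBF : IsTangentToTori J F B) {s : ℝ} (hs : s ∈ J) {θ : ℝ → ℝ × ℝ}
    (hθ : ∀ t, HasDerivAt θ (torusField F B (s, θ t)) t) :
    IsMIntegralCurve (I := 𝓡 3) (fun t => F (s, θ t)) B := by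
  intro t
  rw [hBF.torusField_spec (p := (s, θ t)) hs]
  exact hF.hasMFDerivAt_comp hJ hs (hθ t)

variable [IsManifold (𝓡 3) ∞ M]

/-- The flux equations and the closedness are the components of `F^*(i_B Ω) = d(F^* α)` on pairs of
coordinate vectors. -/
theorem isTorusField {Ω : ∀ x : M, (TangentSpace (𝓡 3) x) [⋀^Fin 3]→L[ℝ] ℝ}
    {B : ∀ x : M, TangentSpace (𝓡 3) x}
    {α : ∀ x : M, (TangentSpace (𝓡 3) x) [⋀^Fin 1]→L[ℝ] ℝ} (hΩ : IsVolumeForm Ω)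
    (hB : IsMagneticField Ω B α) (hJ : IsOpen J) (hF : IsTorusFoliation J F ψ)
    (hBF : IsTangentToTori J F B) (hB0 : ∀ s ∈ J, ∀ x ∈ torus F s, B x ≠ 0) :
    IsTorusField J (torusDensity F Ω) (torusField F B) (torusPotential F α) := by
  have hf : ∀ p, p.1 ∈ J → ContDiffAt ℝ ∞ (torusDensity F Ω) p := fun p hp =>
    contDiffAt_pullForm_apply hJ hF.smooth hp hΩ.smooth _
  have ha : ∀ i p, p.1 ∈ J → ContDiffAt ℝ ∞ (torusPotential F α i) p := fun i p hp =>
    contDiffAt_pullForm_apply hJ hF.smooth hp hB.smooth_potential _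
  have hf0 : ∀ p, p.1 ∈ J → torusDensity F Ω p ≠ 0 := by
    intro p hp h0
    refine hΩ.ne_zero (F p) (ContinuousAlternatingMap.ext fun w => ?_)
    choose u hu using fun i => hF.surjective_mfderiv hp (w i)
    exact (congrArg (Ω (F p)) (funext fun i => hu i)).symm.trans (alternating_eq_zero h0 u)
  have hflux : ∀ p, p.1 ∈ J → ∀ i j,
      pullForm F Ω p ![((0 : ℝ), torusField F B p), paramVec i, paramVec j]
        = fderiv ℝ (torusPotential F α j) p (paramVec i)
          - fderiv ℝ (torusPotential F α i) p (paramVec j) := by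
    intro p hp i j
    obtain ⟨hd, he⟩ := extDeriv_pullForm hJ hF.smooth hp hB.smooth_potential hB.exact
    have h1 := congrArg (fun η => η ![paramVec i, paramVec j]) he
    simp only [extDeriv_apply hd] at h1
    replace h1 := (Fin.sum_univ_two _).symm.trans h1
    have r0 : (0 : Fin 2).removeNth ![paramVec i, paramVec j] = ![paramVec j] := by
      ext k <;> fin_cases k <;> rfl
    have r1 : (1 : Fin 2).removeNth ![paramVec i, paramVec j] = ![paramVec i] := by
      ext k <;> fin_cases k <;> rfl
    rw [r0, r1] at h1
    have h2 : pullForm F Ω p ![((0 : ℝ), torusField F B p), paramVec i, paramVec j]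
        = pullForm F (interiorProduct B Ω) p ![paramVec i, paramVec j] := by
      rw [pullForm_apply, pullForm_apply]
      refine congrArg (Ω (F p)) (funext fun k => ?_)
      fin_cases k
      · exact (hBF.torusField_spec hp).symm
      · rfl
      · rfl
    rw [h2, ← h1]
    simp [sub_eq_add_neg]
    rfl
  have h01 : ∀ p, p.1 ∈ J → torusDensity F Ω p * (torusField F B p).2
      = fderiv ℝ (torusPotential F α 1) p (paramVec 0)
        - fderiv ℝ (torusPotential F α 0) p (paramVec 1) := by
    intro p hp
    rw [← hflux p hp 0 1, alternating_apply_three]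
    simp [paramVec, torusDensity, mul_comm]
  have h02 : ∀ p, p.1 ∈ J → -(torusDensity F Ω p * (torusField F B p).1)
      = fderiv ℝ (torusPotential F α 2) p (paramVec 0)
        - fderiv ℝ (torusPotential F α 0) p (paramVec 2) := by
    intro p hp
    rw [← hflux p hp 0 2, alternating_apply_three]
    simp [paramVec, torusDensity, mul_comm]
  have h1 : (1 : WithTop ℕ∞) ≤ ∞ := ENat.LEInfty.out
  have hda : ∀ i p, p.1 ∈ J → ∀ u, ContDiffAt ℝ 1 (fun q => fderiv ℝ (torusPotential F α i) q u) p :=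
    fun i p hp u => (((ha i p hp).fderiv_right (m := ∞) (by simp)).of_le h1).clm_apply
      contDiffAt_const
  have h2 : (2 : WithTop ℕ∞) ≤ ∞ := ENat.LEInfty.out
  refine ⟨hJ, fun p hp => (hf p hp).of_le h2, fun p hp => ?_, fun i p hp => (ha i p hp).of_le h2,
    hf0, fun p hp h0 => ?_, fun s hs m θ => ?_, fun s hs m θ => ?_, fun i s hs m θ => ?_,
    h01, h02, fun p hp => ?_⟩
  -- The angular components come from a choice at each point; their regularity follows by solving
  -- the flux equations for them, `f` being nonzero.
  · have hf1 : ContDiffAt ℝ 1 (torusDensity F Ω) p := (hf p hp).of_le h1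
    refine ((((hda 2 p hp (paramVec 0)).sub (hda 0 p hp (paramVec 2))).neg.div hf1
      (hf0 p hp)).prodMk (((hda 1 p hp (paramVec 0)).sub (hda 0 p hp (paramVec 1))).div hf1
      (hf0 p hp))).congr_of_eventuallyEq ?_
    filter_upwards [(hJ.preimage continuous_fst).mem_nhds hp] with q hq
    exact Prod.ext ((eq_div_iff (hf0 q hq)).2 ((mul_comm _ _).trans
      (neg_eq_iff_eq_neg.1 (h02 q hq)))) ((eq_div_iff (hf0 q hq)).2 ((mul_comm _ _).trans
      (h01 q hq)))
  · refine hB0 p.1 hp (F p) ⟨p.2, rfl⟩ ?_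
    rw [hBF.torusField_spec hp, h0]
    exact map_zero (mfderiv 𝓘(ℝ, ℝ × (ℝ × ℝ)) (𝓡 3) F p)
  · exact congrArg (fun η => η paramVec) (hF.pullForm_add_latticeVec hJ hs Ω m θ)
  · have e1 : (B (F (s, θ + latticeVec m)) : R3) = _ :=
      hBF.torusField_spec (p := (s, θ + latticeVec m)) hs
    have e2 : (B (F (s, θ)) : R3) = _ := hBF.torusField_spec (p := (s, θ)) hs
    have hx : ∀ x y : M, x = y → (B x : R3) = B y := by rintro x _ rfl; rfl
    have e3 := (e1.symm.trans (hx _ (F (s, θ)) (hF.apply_add_latticeVec hs m θ))).trans e2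
    have e4 := (hF.mfderiv_add_latticeVec hJ hs m θ _).symm.trans e3
    exact (Prod.mk.inj (hF.injective_mfderiv (p := (s, θ)) hs e4)).2
  · exact congrArg (fun η => η ![paramVec i]) (hF.pullForm_add_latticeVec hJ hs α m θ)
  -- All three arguments are tangent to the torus, so the volume form vanishes on them.
  · have := hflux p hp 1 2
    rw [alternating_apply_three] at this
    simp [paramVec] at this
    exact sub_eq_zero.1 this.symm

end TorusRegion

/-! ### The volume measure on the foliated region -/

noncomputable section TorusVolume

/-- The standard coordinates, as an isomorphism onto the parameter space. -/
def paramEquiv : R3 ≃L[ℝ] ℝ × (ℝ × ℝ) :=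
  LinearEquiv.toContinuousLinearEquiv
    { toFun := fun y => (y 0, (y 1, y 2))
      invFun := fun p => !₂[p.1, p.2.1, p.2.2]
      map_add' := fun p q => rfl
      map_smul' := fun c p => rfl
      left_inv := fun y => by ext i; fin_cases i <;> rfl
      right_inv := fun p => rfl }

theorem paramEquiv_single (i : Fin 3) :
    paramEquiv (EuclideanSpace.single i (1 : ℝ)) = paramVec i := by
  have h : ∀ y : R3, paramEquiv y = (y 0, (y 1, y 2)) := fun _ => rfl
  fin_cases i <;> simp [h, paramVec]

theorem measurePreserving_paramEquiv : MeasurePreserving paramEquiv := by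
  have h1 := PiLp.volume_preserving_ofLp (Fin 3)
  have h2 := volume_preserving_piFinSuccAbove (fun _ : Fin 3 => ℝ) 0
  have h3 := (MeasurePreserving.id (volume : Measure ℝ)).prod (volume_preserving_finTwoArrow ℝ)
  exact (h3.comp h2).comp h1

/-- A top-degree form pulls back by the determinant; this is the Jacobian relating the chart density
to the torus density. -/
theorem alternating_comp_paramVec (η : R3 [⋀^Fin 3]→L[ℝ] ℝ) (L : ℝ × (ℝ × ℝ) →L[ℝ] R3) :
    η.compContinuousLinearMap L paramVec
      = ((paramEquiv : R3 →L[ℝ] ℝ × (ℝ × ℝ)).comp L).det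
        * η fun i => EuclideanSpace.single i (1 : ℝ) := by
  set L' := (paramEquiv : R3 →L[ℝ] ℝ × (ℝ × ℝ)).comp L
  set η' := η.compContinuousLinearMap (paramEquiv.symm : ℝ × (ℝ × ℝ) →L[ℝ] R3)
  have h := congrArg (fun g => g (L' ∘ paramVec))
    (η'.toAlternatingMap.eq_smul_basis_det paramBasis)
  have h' := paramBasis.det_comp (L' : ℝ × (ℝ × ℝ) →ₗ[ℝ] ℝ × (ℝ × ℝ)) paramBasis
  rw [Module.Basis.det_self, mul_one, coe_paramBasis] at h'
  simp only [AlternatingMap.smul_apply, smul_eq_mul, coe_paramBasis] at h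
  have e1 : η' (L' ∘ paramVec) = η.compContinuousLinearMap L paramVec := by
    refine congrArg η (funext fun i => ?_)
    exact paramEquiv.symm_apply_apply _
  have e2 : η' paramVec = η fun i => EuclideanSpace.single i (1 : ℝ) := by
    refine congrArg η (funext fun i => ?_)
    exact (paramEquiv.symm_apply_eq).2 (paramEquiv_single i).symm
  rw [← e1, ← e2, mul_comm]
  exact h.trans (congrArg (fun z => η' paramVec * z) h')

theorem ContinuousOn.measurableSet_preimage_inter {X Y : Type*} [TopologicalSpace X]
    [MeasurableSpace X] [BorelSpace X] [TopologicalSpace Y] [MeasurableSpace Y] [BorelSpace Y]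
    {f : X → Y} {s : Set X} (hf : ContinuousOn f s) (hs : MeasurableSet s) {t : Set Y}
    (ht : MeasurableSet t) : MeasurableSet (f ⁻¹' t ∩ s) := by
  have h := hs.subtype_image ((continuousOn_iff_continuous_domRestrict.1 hf).measurable ht)
  convert h using 1
  ext x
  simp

variable {M : Type*} [TopologicalSpace M] [ChartedSpace R3 M]

/-- A fundamental domain of the parametrization. -/
def fundamentalDomain (J : Set ℝ) : Set (ℝ × (ℝ × ℝ)) := J ×ˢ (Ico 0 1 ×ˢ Ico 0 1)

variable {J : Set ℝ} {F : ℝ × (ℝ × ℝ) → M} {ψ : M → ℝ}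

theorem measurableSet_fundamentalDomain (hJ : MeasurableSet J) :
    MeasurableSet (fundamentalDomain J) :=
  hJ.prod (measurableSet_Ico.prod measurableSet_Ico)

namespace IsTorusFoliation

theorem injOn (hF : IsTorusFoliation J F ψ) : InjOn F (fundamentalDomain J) := by
  rintro ⟨s, θ⟩ ⟨hs, ⟨h1, h2⟩, h3, h4⟩ ⟨s', θ'⟩ ⟨hs', ⟨h1', h2'⟩, h3', h4'⟩ h
  obtain ⟨rfl, m, n, rfl⟩ := (hF.eq_iff s hs s' hs' θ θ').1 h
  simp only [Prod.fst_add, Prod.snd_add] at *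
  have hm : m = 0 := by
    have a1 : (m : ℝ) < 1 := by linarith
    have a2 : (-1 : ℝ) < m := by linarith
    have b1 : m < 1 := by exact_mod_cast a1
    have b2 : -1 < m := by exact_mod_cast a2
    omega
  have hn : n = 0 := by
    have a1 : (n : ℝ) < 1 := by linarith
    have a2 : (-1 : ℝ) < n := by linarith
    have b1 : n < 1 := by exact_mod_cast a1
    have b2 : -1 < n := by exact_mod_cast a2
    omega
  simp [hm, hn]

theorem continuousOn_fundamentalDomain (hF : IsTorusFoliation J F ψ) :
    ContinuousOn F (fundamentalDomain J) :=
  hF.smooth.continuousOn.mono (prod_mono_right (subset_univ _))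

theorem torus_subset_image (hF : IsTorusFoliation J F ψ) {s : ℝ} (hs : s ∈ J) :
    torus F s ⊆ F '' fundamentalDomain J := by
  rintro _ ⟨θ, rfl⟩
  obtain ⟨m, hm, -⟩ := exists_lattice_add_mem_unitSquare θ
  exact ⟨(s, θ + latticeVec m), ⟨hs, hm⟩, hF.apply_add_latticeVec hs m θ⟩

end IsTorusFoliation

variable [MeasurableSpace M] [BorelSpace M]

/-- The measure `|Ω|` in the chart around `c`. -/
def chartVolume (Ω : ∀ x : M, (TangentSpace (𝓡 3) x) [⋀^Fin 3]→L[ℝ] ℝ) (c : M) : Measure M :=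
  Measure.map (extChartAt (𝓡 3) c).symm
    ((volume.restrict (extChartAt (𝓡 3) c).target).withDensity fun y =>
      ENNReal.ofReal |formInChart Ω c y fun i => EuclideanSpace.single i (1 : ℝ)|)

theorem chartVolume_apply (Ω : ∀ x : M, (TangentSpace (𝓡 3) x) [⋀^Fin 3]→L[ℝ] ℝ) (c : M)
    {A : Set M} (hA : MeasurableSet A) :
    chartVolume Ω c A = ∫⁻ y in (extChartAt (𝓡 3) c).symm ⁻¹' A ∩ (extChartAt (𝓡 3) c).target,
      ENNReal.ofReal |formInChart Ω c y fun i => EuclideanSpace.single i (1 : ℝ)| := by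
  have ht := (isOpen_extChartAt_target (I := 𝓡 3) c).measurableSet
  rw [chartVolume, Measure.map_apply_of_aemeasurable _ hA, withDensity_apply',
    Measure.restrict_restrict' ht]
  exact ((continuousOn_extChartAt_symm c).aemeasurable ht).mono_ac
    (withDensity_absolutelyContinuous _ _)

/-- The measure `|F^* Ω|` on the region, transported to `M`. -/
def torusVolume (J : Set ℝ) (F : ℝ × (ℝ × ℝ) → M)
    (Ω : ∀ x : M, (TangentSpace (𝓡 3) x) [⋀^Fin 3]→L[ℝ] ℝ) : Measure M :=
  Measure.map F ((volume.restrict (fundamentalDomain J)).withDensity fun p =>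
    ENNReal.ofReal |torusDensity F Ω p|)

namespace IsTorusFoliation

theorem torusVolume_apply (hF : IsTorusFoliation J F ψ) (hJ : IsOpen J)
    (Ω : ∀ x : M, (TangentSpace (𝓡 3) x) [⋀^Fin 3]→L[ℝ] ℝ) {A : Set M} (hA : MeasurableSet A) :
    torusVolume J F Ω A = ∫⁻ p in F ⁻¹' A ∩ fundamentalDomain J,
      ENNReal.ofReal |torusDensity F Ω p| := by
  have ht := measurableSet_fundamentalDomain hJ.measurableSet
  rw [torusVolume, Measure.map_apply_of_aemeasurable _ hA, withDensity_apply',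
    Measure.restrict_restrict' ht]
  exact (hF.continuousOn_fundamentalDomain.aemeasurable ht).mono_ac
    (withDensity_absolutelyContinuous _ _)

variable [IsManifold (𝓡 3) ∞ M]

/-- Change of variables for `F` read in the chart, which is injective on the fundamental domain. A
chart measure only sees the part of a set inside its chart. -/
theorem chartVolume_eq (hF : IsTorusFoliation J F ψ) (hJ : IsOpen J)
    (Ω : ∀ x : M, (TangentSpace (𝓡 3) x) [⋀^Fin 3]→L[ℝ] ℝ) (c : M) {A : Set M}
    (hA : MeasurableSet A) (hAF : A ⊆ F '' fundamentalDomain J) :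
    chartVolume Ω c A = torusVolume J F Ω (A ∩ (extChartAt (𝓡 3) c).source) := by
  have hsrc := (isOpen_extChartAt_source (I := 𝓡 3) c).measurableSet
  rw [chartVolume_apply Ω c hA, hF.torusVolume_apply hJ Ω (hA.inter hsrc)]
  set P := F ⁻¹' (A ∩ (extChartAt (𝓡 3) c).source) ∩ fundamentalDomain J
  set G : ℝ × (ℝ × ℝ) → R3 := fun q => extChartAt (𝓡 3) c (F q)
  have hP : MeasurableSet P := hF.continuousOn_fundamentalDomain.measurableSet_preimage_inter
    (measurableSet_fundamentalDomain hJ.measurableSet) (hA.inter hsrc)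
  have hS : (extChartAt (𝓡 3) c).symm ⁻¹' A ∩ (extChartAt (𝓡 3) c).target = G '' P := by
    ext y
    constructor
    · rintro ⟨hyA, hyt⟩
      obtain ⟨p, hp, hpy⟩ := hAF hyA
      have hs := (extChartAt (𝓡 3) c).map_target hyt
      exact ⟨p, ⟨⟨by rw [hpy]; exact hyA, by rw [hpy]; exact hs⟩, hp⟩, by
        simp only [G, hpy]; exact (extChartAt (𝓡 3) c).right_inv hyt⟩
    · rintro ⟨p, ⟨⟨hpA, hps⟩, hp⟩, rfl⟩
      exact ⟨by simp only [G, mem_preimage, (extChartAt (𝓡 3) c).left_inv hps]; exact hpA,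
        (extChartAt (𝓡 3) c).map_source hps⟩
  have hd : ∀ p ∈ P, HasFDerivWithinAt (paramEquiv ∘ G)
      ((paramEquiv : R3 →L[ℝ] ℝ × (ℝ × ℝ)).comp (fderiv ℝ G p)) P p := fun p hp =>
    (paramEquiv.hasFDerivAt.comp p ((contDiffAt_chart_comp hJ hF.smooth hp.2.1
      hp.1.2).differentiableAt (by simp)).hasFDerivAt).hasFDerivWithinAt
  have hinj : InjOn (paramEquiv ∘ G) P := by
    intro p hp q hq h
    exact hF.injOn hp.2 hq.2 ((extChartAt (𝓡 3) c).injOn hp.1.2 hq.1.2 (paramEquiv.injective h))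
  -- The measure-preserving identification with the parameter space makes the derivative an
  -- endomorphism, so that its determinant is defined.
  have h1 := measurePreserving_paramEquiv.setLIntegral_comp_emb
    paramEquiv.toHomeomorph.measurableEmbedding (fun z => ENNReal.ofReal
      |formInChart Ω c (paramEquiv.symm z) fun i => EuclideanSpace.single i (1 : ℝ)|) (G '' P)
  simp only [ContinuousLinearEquiv.symm_apply_apply] at h1
  have : (volume : Measure (ℝ × (ℝ × ℝ))).IsAddHaarMeasure :=
    Measure.prod.instIsAddHaarMeasure volume volume
  rw [hS, h1, ← image_comp, lintegral_image_eq_lintegral_abs_det_fderiv_mul volume hP hd hinj]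
  refine setLIntegral_congr_fun hP fun p hp => ?_
  simp only [Function.comp_apply, ContinuousLinearEquiv.symm_apply_apply, torusDensity]
  rw [← ENNReal.ofReal_mul (abs_nonneg _), ← abs_mul, ← alternating_comp_paramVec,
    pullForm_eq_chart hJ hF.smooth hp.2.1 hp.1.2]

theorem volumeMeasure_eq (hF : IsTorusFoliation J F ψ) (hJ : IsOpen J)
    (Ω : ∀ x : M, (TangentSpace (𝓡 3) x) [⋀^Fin 3]→L[ℝ] ℝ) {A : Set M}
    (hA : MeasurableSet A) (hAF : A ⊆ F '' fundamentalDomain J) :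
    volumeMeasure Ω A = torusVolume J F Ω A := by
  have hv : volumeMeasure Ω = ⨆ c : M, chartVolume Ω c := rfl
  have hle : ∀ c, chartVolume Ω c ≤ volumeMeasure Ω := fun c => hv ▸ le_iSup (chartVolume Ω) c
  have hub : ∀ E, MeasurableSet E → E ⊆ F '' fundamentalDomain J →
      volumeMeasure Ω E ≤ torusVolume J F Ω E := by
    intro E hE hEF
    -- An upper bound for every chart measure bounds their supremum; the restriction to `Eᶜ`
    -- dominates whatever lies outside `E`.
    have hsup : volumeMeasure Ω ≤ torusVolume J F Ω + (volumeMeasure Ω).restrict Eᶜ := by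
      conv_lhs => rw [hv]
      refine iSup_le fun c => Measure.le_iff.2 fun S hS => ?_
      rw [Measure.add_apply, Measure.restrict_apply hS,
        ← measure_inter_add_sdiff (μ := chartVolume Ω c) S hE]
      refine add_le_add ?_ (hle c _)
      · rw [hF.chartVolume_eq hJ Ω c (hS.inter hE) (inter_subset_right.trans hEF)]
        exact measure_mono fun x hx => hx.1.1
    have := hsup E
    simpa [Measure.restrict_apply hE] using this
  -- The region, as the image of a Lindelöf set, is covered by countably many charts even if `M` is
  -- not. Inside each of them its chart measure attains the upper bound.
  obtain ⟨r, hr, hcov⟩ := (((HereditarilyLindelofSpace.isLindelof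
    (fundamentalDomain J)).image_of_continuousOn hF.continuousOn_fundamentalDomain
    ).elim_countable_subcover (fun c : M => (extChartAt (𝓡 3) c).source)
    (fun c => isOpen_extChartAt_source c)
    (fun x _ => mem_iUnion.2 ⟨x, mem_extChartAt_source x⟩))
  have key := (Measure.restrict_biUnion_congr (μ := volumeMeasure Ω) (ν := torusVolume J F Ω)
    (t := fun c : M => A ∩ (extChartAt (𝓡 3) c).source) hr).2 (fun c _ => by
      have hAc : MeasurableSet (A ∩ (extChartAt (𝓡 3) c).source) :=
        hA.inter (isOpen_extChartAt_source c).measurableSet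
      ext S hS
      rw [Measure.restrict_apply hS, Measure.restrict_apply hS]
      have hE := hS.inter hAc
      have hEF : S ∩ (A ∩ (extChartAt (𝓡 3) c).source) ⊆ F '' fundamentalDomain J :=
        fun x hx => hAF hx.2.1
      refine le_antisymm (hub _ hE hEF) (le_trans (le_of_eq ?_) (hle c _))
      rw [hF.chartVolume_eq hJ Ω c hE hEF]
      congr 1
      ext x
      simp +contextual)
  have hAU : A ⊆ ⋃ c ∈ r, A ∩ (extChartAt (𝓡 3) c).source := by
    intro x hx
    obtain ⟨c, hc, hxc⟩ := mem_iUnion₂.1 (hcov (hAF hx))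
    exact mem_iUnion₂.2 ⟨c, hc, hx, hxc⟩
  have := congrArg (fun μ : Measure M => μ A) key
  simpa only [Measure.restrict_apply hA, inter_eq_left.2 hAU] using this

end IsTorusFoliation

end TorusVolume

/-! ### The derivative of the enclosed volume -/

noncomputable section EnclosedVolume

theorem continuousOn_integral_unitSquare {J : Set ℝ} (hJ : IsOpen J) {g : ℝ × (ℝ × ℝ) → ℝ}
    (hg : ContinuousOn g (J ×ˢ univ)) :
    ContinuousOn (fun r => ∫ θ in Ico (0 : ℝ) 1 ×ˢ Ico (0 : ℝ) 1, g (r, θ)) J := by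
  -- Up to a null set the square is compact, which the continuity of parametric integrals requires.
  have hae : (Ico (0 : ℝ) 1 ×ˢ Ico (0 : ℝ) 1 : Set (ℝ × ℝ)) =ᵐ[volume] Icc 0 1 ×ˢ Icc 0 1 :=
    Measure.set_prod_ae_eq Ico_ae_eq_Icc Ico_ae_eq_Icc
  simp only [setIntegral_congr_set hae]
  rw [continuousOn_iff_continuous_domRestrict]
  have : LocallyCompactSpace J := hJ.locallyCompactSpace
  have h : Continuous (Function.uncurry fun (r : J) (θ : ℝ × ℝ) => g (r, θ)) :=
    hg.comp_continuous (by fun_prop) fun x => ⟨x.1.2, trivial⟩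
  exact continuous_parametric_integral_of_continuous h (isCompact_Icc.prod isCompact_Icc)

variable {M : Type*} [TopologicalSpace M] [ChartedSpace R3 M]
  {J : Set ℝ} {F : ℝ × (ℝ × ℝ) → M} {ψ : M → ℝ}

namespace IsTorusFoliation

theorem biUnion_torus_eq (hF : IsTorusFoliation J F ψ) {K : Set ℝ} (hK : K ⊆ J) :
    ⋃ r ∈ K, torus F r = F '' (K ×ˢ (Icc 0 1 ×ˢ Icc 0 1)) := by
  ext x
  simp only [mem_iUnion, exists_prop]
  constructor
  · rintro ⟨r, hr, hx⟩
    obtain ⟨⟨r', θ⟩, ⟨hr', h1, h2⟩, rfl⟩ := hF.torus_subset_image (hK hr) hx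
    obtain ⟨θ', h⟩ := hx
    obtain ⟨rfl, -⟩ := (hF.eq_iff r (hK hr) r' hr' θ' θ).1 h
    exact ⟨(r, θ), ⟨hr, Ico_subset_Icc_self h1, Ico_subset_Icc_self h2⟩, rfl⟩
  · rintro ⟨⟨r, θ⟩, ⟨hr, -⟩, rfl⟩
    exact ⟨r, hr, θ, rfl⟩

theorem isClosed_biUnion_torus [T2Space M] (hF : IsTorusFoliation J F ψ) {K : Set ℝ} (hK : K ⊆ J)
    (hc : IsCompact K) : IsClosed (⋃ r ∈ K, torus F r) := by
  rw [hF.biUnion_torus_eq hK]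
  exact ((hc.prod (isCompact_Icc.prod isCompact_Icc)).image_of_continuousOn
    (hF.smooth.continuousOn.mono (prod_mono hK (subset_univ _)))).isClosed

theorem disjoint_torus (hF : IsTorusFoliation J F ψ) {r s : ℝ} (hr : r ∈ J) (hs : s ∈ J) {x : M}
    (hxr : x ∈ torus F r) (hxs : x ∈ torus F s) : r = s := by
  obtain ⟨θ, rfl⟩ := hxr
  obtain ⟨θ', h⟩ := hxs
  exact (((hF.eq_iff s hs r hr θ' θ).1 h).1).symm

/-- The region over `Icc s t` and the torus at `s` are compact, hence closed in the Hausdorff space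
`M`; the half-open region is their difference. -/
theorem measurableSet_biUnion_torus_Ioc [T2Space M] [MeasurableSpace M] [BorelSpace M]
    (hF : IsTorusFoliation J F ψ) {s t : ℝ} (hst : Icc s t ⊆ J) :
    MeasurableSet (⋃ r ∈ Ioc s t, torus F r) := by
  rcases lt_or_ge t s with h | h
  · simp [Ioc_eq_empty (not_lt.2 h.le)]
  have hsJ : s ∈ J := hst ⟨le_rfl, h⟩
  have : ⋃ r ∈ Ioc s t, torus F r = (⋃ r ∈ Icc s t, torus F r) \ ⋃ r ∈ ({s} : Set ℝ), torus F r := by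
    ext x
    simp only [mem_iUnion, exists_prop, Set.mem_sdiff, mem_singleton_iff, not_exists, not_and]
    constructor
    · rintro ⟨r, hr, hx⟩
      refine ⟨⟨r, Ioc_subset_Icc_self hr, hx⟩, ?_⟩
      rintro _ rfl hx'
      exact hr.1.ne' (hF.disjoint_torus (hst (Ioc_subset_Icc_self hr)) hsJ hx hx')
    · rintro ⟨⟨r, hr, hx⟩, hn⟩
      exact ⟨r, ⟨lt_of_le_of_ne hr.1 fun h => hn r h.symm hx, hr.2⟩, hx⟩
  rw [this]
  exact (hF.isClosed_biUnion_torus hst isCompact_Icc).measurableSet.diff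
    (hF.isClosed_biUnion_torus (by simpa using hsJ) isCompact_singleton).measurableSet

theorem continuousOn_torusDensity [IsManifold (𝓡 3) ∞ M] (hF : IsTorusFoliation J F ψ)
    (hJ : IsOpen J) {Ω : ∀ x : M, (TangentSpace (𝓡 3) x) [⋀^Fin 3]→L[ℝ] ℝ}
    (hΩ : IsVolumeForm Ω) : ContinuousOn (torusDensity F Ω) (J ×ˢ univ) := fun _ hp =>
  (contDiffAt_pullForm_apply hJ hF.smooth hp.1 hΩ.smooth
    paramVec).continuousAt.continuousWithinAt

variable [T2Space M] [IsManifold (𝓡 3) ∞ M] [MeasurableSpace M] [BorelSpace M]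

theorem volumeMeasure_biUnion_torus (hF : IsTorusFoliation J F ψ) (hJ : IsOpen J)
    {Ω : ∀ x : M, (TangentSpace (𝓡 3) x) [⋀^Fin 3]→L[ℝ] ℝ} (hΩ : IsVolumeForm Ω) {s t : ℝ}
    (hst : Icc s t ⊆ J) :
    (volumeMeasure Ω (⋃ r ∈ Ioc s t, torus F r)).toReal
      = ∫ r in Ioc s t, ∫ θ in Ico (0 : ℝ) 1 ×ˢ Ico (0 : ℝ) 1, |torusDensity F Ω (r, θ)| := by
  have hIoc : Ioc s t ⊆ J := Ioc_subset_Icc_self.trans hst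
  have hA := hF.measurableSet_biUnion_torus_Ioc hst
  rw [hF.volumeMeasure_eq hJ Ω hA
    (iUnion₂_subset fun r hr => hF.torus_subset_image (hIoc hr)), hF.torusVolume_apply hJ Ω hA]
  have hset : F ⁻¹' (⋃ r ∈ Ioc s t, torus F r) ∩ fundamentalDomain J
      = Ioc s t ×ˢ (Ico 0 1 ×ˢ Ico 0 1) := by
    ext ⟨r, θ⟩
    simp only [mem_inter_iff, mem_preimage, mem_iUnion, exists_prop, fundamentalDomain]
    constructor
    · rintro ⟨⟨r', hr', hx⟩, hr, hθ⟩
      obtain rfl := hF.disjoint_torus (hIoc hr') hr hx ⟨θ, rfl⟩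
      exact ⟨hr', hθ⟩
    · rintro ⟨hr, hθ⟩
      exact ⟨⟨r, hr, θ, rfl⟩, hIoc hr, hθ⟩
  have hint : IntegrableOn (fun p => |torusDensity F Ω p|) (Ioc s t ×ˢ (Ico 0 1 ×ˢ Ico 0 1))
      (volume.prod volume) :=
    (((hF.continuousOn_torusDensity hJ hΩ).abs.mono (prod_mono hst (subset_univ _))
      ).integrableOn_compact (μ := volume) (isCompact_Icc.prod (isCompact_Icc.prod isCompact_Icc))
      ).mono_set (prod_mono Ioc_subset_Icc_self (prod_mono Ico_subset_Icc_self Ico_subset_Icc_self))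
  rw [hset, ← setIntegral_prod (fun p => |torusDensity F Ω p|) hint,
    integral_eq_lintegral_of_nonneg_ae (Eventually.of_forall fun p => abs_nonneg _)
      hint.aestronglyMeasurable]
  rfl

/-- By Fubini `V` is an integral over the label of the continuous function `∫ |f|`; apply the
fundamental theorem of calculus. -/
theorem hasDerivAt_enclosedVolume (hF : IsTorusFoliation J F ψ) (hJ : IsOpen J)
    (hJ' : J.OrdConnected) {Ω : ∀ x : M, (TangentSpace (𝓡 3) x) [⋀^Fin 3]→L[ℝ] ℝ}
    (hΩ : IsVolumeForm Ω) {V : ℝ → ℝ} (hV : IsEnclosedVolume Ω J F V) {s : ℝ} (hs : s ∈ J) :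
    HasDerivAt V (∫ θ in Ico (0 : ℝ) 1 ×ˢ Ico (0 : ℝ) 1, |torusDensity F Ω (s, θ)|) s := by
  set k : ℝ → ℝ := fun r => ∫ θ in Ico (0 : ℝ) 1 ×ˢ Ico (0 : ℝ) 1, |torusDensity F Ω (r, θ)|
  have hk : ContinuousOn k J :=
    continuousOn_integral_unitSquare hJ (hF.continuousOn_torusDensity hJ hΩ).abs
  have hle : ∀ a ∈ J, ∀ b ∈ J, a ≤ b → V b - V a = ∫ r in a..b, k r := by
    intro a ha b hb hab
    rw [hV a ha b hb hab, hF.volumeMeasure_biUnion_torus hJ hΩ (hJ'.out ha hb),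
      intervalIntegral.integral_of_le hab]
  have hV' : V =ᶠ[𝓝 s] fun t => V s + ∫ r in s..t, k r := by
    filter_upwards [hJ.mem_nhds hs] with t ht
    rcases le_total s t with h | h
    · rw [← hle s hs t ht h]; ring
    · rw [intervalIntegral.integral_symm, ← hle t ht s hs h]; ring
  refine ((intervalIntegral.integral_hasDerivAt_right (by simp)
    (hk.stronglyMeasurableAtFilter hJ s hs) (hk.continuousAt (hJ.mem_nhds hs))).const_add
    (V s)).congr_of_eventuallyEq hV'

end IsTorusFoliation

end EnclosedVolume

/-! ### Lifting the curves to the universal cover -/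

noncomputable section Lifts

theorem exists_lift_addCircle {X : Type*} [TopologicalSpace X] [SimplyConnectedSpace X]
    [LocallyPathConnectedSpace X] {f : X → AddCircle (1 : ℝ)} (hf : Continuous f) :
    ∃ g : X → ℝ, Continuous g ∧ ∀ x, (g x : AddCircle (1 : ℝ)) = f x := by
  obtain ⟨x₀⟩ : Nonempty X := inferInstance
  obtain ⟨y₀, hy₀⟩ := QuotientAddGroup.mk_surjective (f x₀)
  obtain ⟨g, ⟨-, hg⟩, -⟩ := (AddCircle.isCoveringMap_coe (1 : ℝ)).existsUnique_continuousMap_lifts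
    ⟨f, hf⟩ x₀ y₀ hy₀
  exact ⟨g, g.continuous, fun x => congrFun hg x⟩

/-- The point of the torus `(ℝ/ℤ)²` with the angles `θ`. -/
def angleClass (θ : ℝ × ℝ) : AddCircle (1 : ℝ) × AddCircle (1 : ℝ) := (θ.1, θ.2)

theorem continuous_angleClass : Continuous angleClass :=
  ((AddCircle.continuous_mk' 1).comp continuous_fst).prodMk
    ((AddCircle.continuous_mk' 1).comp continuous_snd)

theorem coe_eq_coe_addCircle_one {x y : ℝ} :
    (x : AddCircle (1 : ℝ)) = y ↔ ∃ n : ℤ, y = x + n := by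
  rw [eq_comm, ← sub_eq_zero, ← AddCircle.coe_sub, AddCircle.coe_eq_zero_iff]
  simp only [zsmul_eq_mul, mul_one]
  exact ⟨fun ⟨n, h⟩ => ⟨n, by linarith⟩, fun ⟨n, h⟩ => ⟨n, by linarith⟩⟩

theorem angleClass_eq_iff {θ θ' : ℝ × ℝ} :
    angleClass θ = angleClass θ' ↔ ∃ m : ℤ × ℤ, θ' = θ + latticeVec m := by
  simp only [angleClass, coe_eq_coe_addCircle_one, Prod.ext_iff, Prod.fst_add,
    Prod.snd_add, latticeVec_fst, latticeVec_snd, Prod.exists]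
  exact ⟨fun ⟨⟨a, ha⟩, b, hb⟩ => ⟨a, b, ha, hb⟩, fun ⟨a, b, ha, hb⟩ => ⟨⟨a, ha⟩, b, hb⟩⟩

theorem isDiscrete_range_latticeVec : IsDiscrete (range latticeVec) :=
  (Int.isClosedEmbedding_coe_real.isEmbedding.prodMap
    Int.isClosedEmbedding_coe_real.isEmbedding).isInducing.isDiscrete_range

variable {M : Type*} [TopologicalSpace M] [ChartedSpace R3 M]
  {J : Set ℝ} {F : ℝ × (ℝ × ℝ) → M} {ψ : M → ℝ}

namespace IsTorusFoliation

/-- The increment over one period is a continuous map from the connected set `J × ℝ` to the discrete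
lattice. Continuity in the label is what keeps the homology class fixed. -/
theorem exists_lift_add_one (hF : IsTorusFoliation J F ψ) (hJ' : J.OrdConnected)
    {γ : ℝ → ℝ → M} (hper : ∀ s ∈ J, Function.Periodic (γ s) 1) {g : ℝ → ℝ → ℝ × ℝ}
    (hg : ContinuousOn (fun p : ℝ × ℝ => g p.1 p.2) (J ×ˢ univ))
    (hFg : ∀ s ∈ J, ∀ u, F (s, g s u) = γ s u) :
    ∃ m : ℤ × ℤ, ∀ s ∈ J, ∀ u, g s (u + 1) = g s u + latticeVec m := by
  have hcont : ContinuousOn (fun p : ℝ × ℝ => g p.1 (p.2 + 1) - g p.1 p.2) (J ×ˢ univ) :=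
    (hg.comp (f := fun p : ℝ × ℝ => (p.1, p.2 + 1)) (by fun_prop)
      fun p hp => ⟨hp.1, trivial⟩).sub hg
  have hmaps : MapsTo (fun p : ℝ × ℝ => g p.1 (p.2 + 1) - g p.1 p.2) (J ×ˢ univ)
      (range latticeVec) := by
    intro p hp
    have : F (p.1, g p.1 p.2) = F (p.1, g p.1 (p.2 + 1)) := by
      rw [hFg _ hp.1, hFg _ hp.1, hper _ hp.1]
    obtain ⟨m, hm⟩ := (hF.apply_eq_iff hp.1).1 this
    exact ⟨m, by simp [hm]⟩
  obtain ⟨_, ⟨m, rfl⟩, h⟩ := ((hJ'.isPreconnected).prod isPreconnected_univ).eqOn_const_of_mapsTo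
    isDiscrete_range_latticeVec hcont hmaps (range_nonempty _)
  refine ⟨m, fun s hs u => ?_⟩
  have := h (x := (s, u)) ⟨hs, trivial⟩
  simp only [Function.const_apply] at this
  rw [← this]; abel

theorem velocity_eq (hF : IsTorusFoliation J F ψ) (hJ : IsOpen J) {s : ℝ} (hs : s ∈ J)
    {γ : ℝ → M} {g : ℝ → ℝ × ℝ} (hFg : ∀ u, F (s, g u) = γ u) {u : ℝ} {w : ℝ × ℝ}
    (hg : HasDerivAt g w u) : (velocity γ u : R3)
      = mfderiv 𝓘(ℝ, ℝ × (ℝ × ℝ)) (𝓡 3) F (s, g u) ((0 : ℝ), w) := by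
  obtain rfl : (fun u => F (s, g u)) = γ := funext hFg
  rw [velocity, (hF.hasMFDerivAt_comp hJ hs hg).mfderiv]
  exact one_smul ℝ (mfderiv 𝓘(ℝ, ℝ × (ℝ × ℝ)) (𝓡 3) F (s, g u) ((0 : ℝ), w) : R3)

variable [IsManifold (𝓡 3) ∞ M]

theorem exists_equiv_fderiv_chart (hF : IsTorusFoliation J F ψ) (hJ : IsOpen J)
    {p : ℝ × (ℝ × ℝ)} (hp : p.1 ∈ J) {c : M} (hc : F p ∈ (extChartAt (𝓡 3) c).source) :
    ∃ e : (ℝ × (ℝ × ℝ)) ≃L[ℝ] R3, HasFDerivAt (fun q => extChartAt (𝓡 3) c (F q))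
      (e : ℝ × (ℝ × ℝ) →L[ℝ] R3) p := by
  set L := fderiv ℝ (fun q => extChartAt (𝓡 3) c (F q)) p
  have hinj : Function.Injective L := by
    intro u u' h
    refine hF.injective_mfderiv hp ?_
    rw [mfderiv_eq_chart_comp hJ hF.smooth hp hc u, mfderiv_eq_chart_comp hJ hF.smooth hp hc u', h]
  have hsurj := (LinearMap.injective_iff_surjective_of_finrank_eq_finrank
    (f := (L : ℝ × (ℝ × ℝ) →ₗ[ℝ] R3)) (by simp)).1 hinj
  exact ⟨ContinuousLinearEquiv.ofBijective L (LinearMap.ker_eq_bot.2 hinj)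
    (LinearMap.range_eq_top.2 hsurj), by
    rw [ContinuousLinearEquiv.coe_ofBijective]
    exact ((contDiffAt_chart_comp hJ hF.smooth hp hc).differentiableAt (by simp)).hasFDerivAt⟩

/-- `F` is an open map over `J`, by the inverse function theorem in a chart. -/
theorem nhds_le_map (hF : IsTorusFoliation J F ψ) (hJ : IsOpen J) {p : ℝ × (ℝ × ℝ)}
    (hp : p.1 ∈ J) : 𝓝 (F p) ≤ map F (𝓝 p) := by
  have hc := mem_extChartAt_source (I := 𝓡 3) (F p)
  obtain ⟨e, he⟩ := hF.exists_equiv_fderiv_chart hJ hp hc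
  have hG := contDiffAt_chart_comp hJ hF.smooth hp hc
  have h1 := (hG.hasStrictFDerivAt' he (by simp)).map_nhds_eq_of_equiv
  have h2 : F =ᶠ[𝓝 p] (extChartAt (𝓡 3) (F p)).symm ∘ fun q => extChartAt (𝓡 3) (F p) (F q) := by
    filter_upwards [eventually_mem_chart hJ hF.smooth hp hc] with q hq
    exact ((extChartAt (𝓡 3) (F p)).left_inv hq.2).symm
  have h3 := map_extChartAt_symm_nhdsWithin_range (I := 𝓡 3) (F p)
  rw [ModelWithCorners.range_eq_univ, nhdsWithin_univ] at h3
  rw [map_congr h2, ← map_map, h1, h3]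

/-- Angles chosen arbitrarily at each point have a continuous class in the torus, since `F` is open
and injective modulo the lattice. Each angle then lifts from the circle to `ℝ` because `J × ℝ` is
contractible. -/
theorem exists_continuous_lift (hF : IsTorusFoliation J F ψ) (hJ : IsOpen J)
    (hJ' : J.OrdConnected) (hne : J.Nonempty) {γ : ℝ → ℝ → M}
    (hmem : ∀ s ∈ J, ∀ u, γ s u ∈ torus F s)
    (hγc : ContinuousOn (fun p : ℝ × ℝ => γ p.1 p.2) (J ×ˢ univ)) :
    ∃ g : ℝ → ℝ → ℝ × ℝ, ContinuousOn (fun p : ℝ × ℝ => g p.1 p.2) (J ×ˢ univ) ∧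
      ∀ s ∈ J, ∀ u, F (s, g s u) = γ s u := by
  set X : Set (ℝ × ℝ) := J ×ˢ univ
  have hX : IsOpen X := hJ.prod isOpen_univ
  have : ContractibleSpace X := (hJ'.convex.prod convex_univ).contractibleSpace
    (hne.prod univ_nonempty)
  have : LocallyPathConnectedSpace X := hX.locallyPathConnectedSpace
  have hex : ∀ x : X, ∃ θ, F (x.1.1, θ) = γ x.1.1 x.1.2 := fun x => hmem x.1.1 x.2.1 x.1.2
  choose q hq using hex
  have hcont : Continuous fun x => angleClass (q x) := by
    refine continuous_iff_continuousAt.2 fun x => ?_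
    intro N hN
    have h1 : {p : ℝ × (ℝ × ℝ) | p.1 ∈ J ∧ angleClass p.2 ∈ N} ∈ 𝓝 (x.1.1, q x) :=
      inter_mem ((hJ.preimage continuous_fst).mem_nhds x.2.1)
        ((continuous_angleClass.comp continuous_snd).continuousAt hN)
    have h2 : ContinuousAt (fun y : X => γ y.1.1 y.1.2) x :=
      (continuousOn_iff_continuous_domRestrict.1 hγc).continuousAt
    have h3 : F '' {p : ℝ × (ℝ × ℝ) | p.1 ∈ J ∧ angleClass p.2 ∈ N} ∈ 𝓝 (γ x.1.1 x.1.2) := by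
      rw [← hq x]
      exact hF.nhds_le_map hJ x.2.1 (image_mem_map h1)
    have h6 : ∀ᶠ y in 𝓝 x, γ y.1.1 y.1.2 ∈ F '' {p | p.1 ∈ J ∧ angleClass p.2 ∈ N} := h2 h3
    change ∀ᶠ y in 𝓝 x, angleClass (q y) ∈ N
    filter_upwards [h6] with y hy
    obtain ⟨⟨s, θ⟩, ⟨hs, hθ⟩, h⟩ := hy
    have h4 : F (y.1.1, q y) = F (s, θ) := (hq y).trans h.symm
    obtain ⟨hst, -⟩ := (hF.eq_iff _ y.2.1 _ hs _ _).1 h4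
    obtain rfl : y.1.1 = s := hst
    have h5 := angleClass_eq_iff.2 ((hF.apply_eq_iff y.2.1).1 h4)
    rw [h5]
    exact hθ
  obtain ⟨g₁, hg₁, h₁⟩ := exists_lift_addCircle (continuous_fst.comp hcont)
  obtain ⟨g₂, hg₂, h₂⟩ := exists_lift_addCircle (continuous_snd.comp hcont)
  classical
  set G : ℝ → ℝ → ℝ × ℝ := fun s u =>
    if h : (s, u) ∈ X then (g₁ ⟨(s, u), h⟩, g₂ ⟨(s, u), h⟩) else 0
  have hG : ∀ x : X, G x.1.1 x.1.2 = (g₁ x, g₂ x) := fun x => dif_pos x.2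
  refine ⟨G, ?_, ?_⟩
  · rw [continuousOn_iff_continuous_domRestrict]
    refine (hg₁.prodMk hg₂).congr fun x => ?_
    exact (hG x).symm
  · intro s hs u
    have hsu : (s, u) ∈ X := ⟨hs, trivial⟩
    rw [hG ⟨(s, u), hsu⟩, ← hq ⟨(s, u), hsu⟩]
    exact (hF.apply_eq_iff hs).2 (angleClass_eq_iff.1 (Prod.ext (h₁ ⟨(s, u), hsu⟩)
      (h₂ ⟨(s, u), hsu⟩)))

/-- Near each parameter the continuous lift is the angular part of a local inverse of `F`, in a
chart, applied to the `C¹` curve. -/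
theorem contDiff_lift (hF : IsTorusFoliation J F ψ) (hJ : IsOpen J) {s : ℝ} (hs : s ∈ J)
    {γ : ℝ → M} (hγ : ContMDiff 𝓘(ℝ, ℝ) (𝓡 3) 1 γ) {g : ℝ → ℝ × ℝ} (hg : Continuous g)
    (hFg : ∀ u, F (s, g u) = γ u) : ContDiff ℝ 1 g := by
  refine contDiff_iff_contDiffAt.2 fun u => ?_
  have hc := mem_extChartAt_source (I := 𝓡 3) (F (s, g u))
  obtain ⟨e, he⟩ := hF.exists_equiv_fderiv_chart hJ (p := (s, g u)) hs hc
  have hG := contDiffAt_chart_comp hJ hF.smooth (p := (s, g u)) hs hc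
  have hleft := (hG.hasStrictFDerivAt' he (by simp)).eventually_left_inverse
  have hinv := (hG.of_le (m := 1) ENat.LEInfty.out).to_localInverse he (by simp)
  have hγu : ContDiffAt ℝ 1 (fun u' => extChartAt (𝓡 3) (F (s, g u)) (F (s, g u'))) u := by
    have h1 : ContMDiffAt 𝓘(ℝ, ℝ) (𝓡 3) 1 (fun u' => F (s, g u')) u := by
      rw [funext hFg]; exact hγ u
    have h2 : ContMDiffAt (𝓡 3) 𝓘(ℝ, R3) 1 (extChartAt (𝓡 3) (F (s, g u))) (F (s, g u)) :=
      (contMDiffAt_extChartAt (n := ∞)).of_le ENat.LEInfty.out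
    exact contMDiffAt_iff_contDiffAt.1 (h2.comp u h1)
  have hcg : Tendsto (fun u' => (s, g u')) (𝓝 u) (𝓝 (s, g u)) :=
    (continuous_const.prodMk hg).continuousAt
  refine ((contDiff_snd.contDiffAt.comp _ hinv).comp u hγu).congr_of_eventuallyEq ?_
  filter_upwards [hcg.eventually hleft] with u' hu'
  exact (congrArg Prod.snd hu').symm

end IsTorusFoliation

end Lifts

/-! ### Return times and line integrals on the manifold -/

noncomputable section MeanReturnTime

namespace IsTorusField

variable {J : Set ℝ} {f : ℝ × (ℝ × ℝ) → ℝ} {v : ℝ × (ℝ × ℝ) → ℝ × ℝ}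
  {a : Fin 3 → ℝ × (ℝ × ℝ) → ℝ} {s : ℝ}

/-- The integral of the potential over a closed curve depends only on its homology class. -/
theorem integral_potential_eq (h : IsTorusField J f v a) (hs : s ∈ J) {g g' : ℝ → ℝ × ℝ}
    (hg : ∀ u, HasDerivAt g (g' u) u) (hg' : Continuous g') {m : ℤ × ℤ}
    (hgm : g 1 = g 0 + latticeVec m) :
    ∫ u in (0 : ℝ)..1, (a 1 (s, g u) * (g' u).1 + a 2 (s, g u) * (g' u).2)
      = ∫ t in (0 : ℝ)..1, (a 1 (s, t • latticeVec m) * m.1 + a 2 (s, t • latticeVec m) * m.2) := by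
  obtain ⟨A, hA⟩ := h.exists_primitive hs
  -- The primitive has a periodic differential, so its increment along `m` does not depend on the
  -- starting point.
  have hconst : ∀ x, A (x + latticeVec m) - A x = A (0 + latticeVec m) - A 0 := by
    have hd : ∀ x, HasFDerivAt (fun x => A (x + latticeVec m) - A x)
        (0 : ℝ × ℝ →L[ℝ] ℝ) x := by
      intro x
      have h1 := ((hasFDerivAt_comp_add_right (latticeVec m)).2 (hA (x + latticeVec m))).sub (hA x)
      rw [h.potential_periodic 1 s hs, h.potential_periodic 2 s hs, sub_self] at h1
      exact h1
    exact fun x => is_const_of_fderiv_eq_zero (fun x => (hd x).differentiableAt)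
      (fun x => (hd x).fderiv) x 0
  have hac : ∀ i, Continuous fun θ => a i (s, θ) := fun i =>
    (contDiff_slice (h.contDiffAt_potential i) hs).continuous
  have key : ∀ c c' : ℝ → ℝ × ℝ, (∀ u, HasDerivAt c (c' u) u) → Continuous c' →
      c 1 = c 0 + latticeVec m →
      ∫ u in (0 : ℝ)..1, (a 1 (s, c u) * (c' u).1 + a 2 (s, c u) * (c' u).2)
        = A (0 + latticeVec m) - A 0 := by
    intro c c' hc hc' hcm
    have hcc : Continuous c := continuous_iff_continuousAt.2 fun u => (hc u).continuousAt
    have hcd : ∀ u, HasDerivAt (fun u => A (c u))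
        (a 1 (s, c u) * (c' u).1 + a 2 (s, c u) * (c' u).2) u :=
      fun u => (hA (c u)).comp_hasDerivAt u (hc u)
    rw [intervalIntegral.integral_eq_sub_of_hasDerivAt (fun u _ => hcd u)
      (((((hac 1).comp hcc).mul hc'.fst).add (((hac 2).comp hcc).mul hc'.snd)
        ).intervalIntegrable _ _), hcm, hconst]
  rw [key g g' hg hg' hgm]
  exact (key (fun t => t • latticeVec m) (fun _ => latticeVec m)
    (fun t => by simpa using (hasDerivAt_id t).smul_const (latticeVec m)) continuous_const
    (by simp)).symm

end IsTorusField

variable {M : Type*} [TopologicalSpace M] [ChartedSpace R3 M]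
  {J : Set ℝ} {F : ℝ × (ℝ × ℝ) → M} {ψ : M → ℝ}
  {Ω : ∀ x : M, (TangentSpace (𝓡 3) x) [⋀^Fin 3]→L[ℝ] ℝ}
  {B n : ∀ x : M, TangentSpace (𝓡 3) x}
  {α : ∀ x : M, (TangentSpace (𝓡 3) x) [⋀^Fin 1]→L[ℝ] ℝ}

theorem IsTransverseField.exists_eq_mfderiv (hF : IsTorusFoliation J F ψ) (hJ : IsOpen J)
    (hn : IsTransverseField J F ψ n) {p : ℝ × (ℝ × ℝ)} (hp : p.1 ∈ J) :
    ∃ x : ℝ × ℝ, n (F p) = mfderiv 𝓘(ℝ, ℝ × (ℝ × ℝ)) (𝓡 3) F p ((1 : ℝ), x) := by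
  obtain ⟨⟨r, x⟩, hx⟩ := hF.surjective_mfderiv hp (n (F p))
  have h1 : (mfderiv (𝓡 3) 𝓘(ℝ, ℝ) ψ (F p) (n (F p)) : ℝ) = 1 := hn p.1 hp (F p) ⟨p.2, rfl⟩
  -- The label is not assumed differentiable; this follows from `dψ(n) = 1`, since the derivative
  -- defaults to 0 otherwise.
  have hψ : MDifferentiableAt (𝓡 3) 𝓘(ℝ, ℝ) ψ (F p) := by
    by_contra hnd
    rw [mfderiv_zero_of_not_mdifferentiableAt hnd] at h1
    exact zero_ne_one (α := ℝ) h1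
  have hFd : MDifferentiableAt 𝓘(ℝ, ℝ × (ℝ × ℝ)) (𝓡 3) F p :=
    (hF.smooth.contMDiffAt ((hJ.prod isOpen_univ).mem_nhds ⟨hp, trivial⟩)).mdifferentiableAt
      (by simp)
  have hlab : ψ ∘ F =ᶠ[𝓝 p] Prod.fst := by
    filter_upwards [(hJ.preimage continuous_fst).mem_nhds hp] with q hq using hF.label q.1 hq q.2
  have h2 := mfderiv_comp p hψ hFd
  rw [hlab.mfderiv_eq, mfderiv_eq_fderiv, fderiv_fst] at h2
  have h3 := congrArg (fun L : ℝ × (ℝ × ℝ) →L[ℝ] ℝ => L (r, x)) h2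
  have h4 : r = mfderiv (𝓡 3) 𝓘(ℝ, ℝ) ψ (F p)
    (mfderiv 𝓘(ℝ, ℝ × (ℝ × ℝ)) (𝓡 3) F p (r, x)) := h3
  rw [hx] at h4
  obtain rfl : r = 1 := h4.trans h1
  exact ⟨x, hx.symm⟩

/-- `n` has label component 1 and the other two vectors are tangent to the torus, so the determinant
loses all dependence on the tangential part of `n`. -/
theorem IsTransverseField.volume_apply (hF : IsTorusFoliation J F ψ) (hJ : IsOpen J)
    (hn : IsTransverseField J F ψ n) (hBF : IsTangentToTori J F B) {p : ℝ × (ℝ × ℝ)}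
    (hp : p.1 ∈ J) (y : ℝ × ℝ) :
    Ω (F p) ![n (F p), mfderiv 𝓘(ℝ, ℝ × (ℝ × ℝ)) (𝓡 3) F p ((0 : ℝ), y), B (F p)]
        = torusDensity F Ω p * ((torusField F B p).2 * y.1 - (torusField F B p).1 * y.2) ∧
      Ω (F p) ![n (F p), B (F p), mfderiv 𝓘(ℝ, ℝ × (ℝ × ℝ)) (𝓡 3) F p ((0 : ℝ), y)]
        = -(torusDensity F Ω p * ((torusField F B p).2 * y.1 - (torusField F B p).1 * y.2)) := by
  obtain ⟨x, hx⟩ := hn.exists_eq_mfderiv hF hJ hp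
  have hv := hBF.torusField_spec hp
  set v := torusField F B p
  constructor
  · have h1 : pullForm F Ω p ![((1 : ℝ), x), ((0 : ℝ), y), ((0 : ℝ), v)]
        = Ω (F p) ![n (F p), mfderiv 𝓘(ℝ, ℝ × (ℝ × ℝ)) (𝓡 3) F p ((0 : ℝ), y), B (F p)] := by
      rw [pullForm_apply, hx, hv]
      refine congrArg (Ω (F p)) (funext fun k => ?_)
      fin_cases k <;> rfl
    rw [← h1, alternating_apply_three, torusDensity]
    ring
  · have h1 : pullForm F Ω p ![((1 : ℝ), x), ((0 : ℝ), v), ((0 : ℝ), y)]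
        = Ω (F p) ![n (F p), B (F p), mfderiv 𝓘(ℝ, ℝ × (ℝ × ℝ)) (𝓡 3) F p ((0 : ℝ), y)] := by
      rw [pullForm_apply, hx, hv]
      refine congrArg (Ω (F p)) (funext fun k => ?_)
      fin_cases k <;> rfl
    rw [← h1, alternating_apply_three, torusDensity]
    ring

theorem IsTransverseClosedCurve.exists_eq_add_int {S : Set M} {γ : ℝ → M}
    (hγ : IsTransverseClosedCurve B S γ) {u u' : ℝ} (h : γ u' = γ u) : ∃ k : ℤ, u' = u + k := by
  have hfr : ∀ x, γ (Int.fract x) = γ x := fun x => by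
    have := hγ.periodic.sub_zsmul_eq (x := x) ⌊x⌋
    simpa using this
  have h1 := hγ.simple ⟨Int.fract_nonneg u', Int.fract_lt_one u'⟩
    ⟨Int.fract_nonneg u, Int.fract_lt_one u⟩ (by rw [hfr, hfr, h])
  refine ⟨⌊u'⌋ - ⌊u⌋, ?_⟩
  rw [Int.fract, Int.fract] at h1
  push_cast
  linarith

section Orbits

variable {s : ℝ} {f : ℝ × ℝ → ℝ} {H : ℝ × ℝ → ℝ} {φ : ℝ → ℝ × ℝ → ℝ × ℝ} {g : ℝ → ℝ × ℝ}
  {w : ℝ → ℝ} {m₀ e : ℤ × ℤ} {γ : ℝ → M}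

theorem IsTorusFoliation.mem_range_iff (hF : IsTorusFoliation J F ψ) (hs : s ∈ J)
    (hFg : ∀ u, F (s, g u) = γ u) (x : ℝ × ℝ) :
    F (s, x) ∈ range γ ↔ ∃ u m, x = g u + latticeVec m := by
  refine exists_congr fun u => ?_
  rw [← hFg, hF.apply_eq_iff hs]

theorem IsTorusFoliation.return_iff (hF : IsTorusFoliation J F ψ) (hs : s ∈ J)
    (hFg : ∀ u, F (s, g u) = γ u)
    (h : IsTransverseLift f (fun θ => torusField F B (s, θ)) H φ g w m₀)
    (hspan : ∀ m : ℤ × ℤ, ∃ i j : ℤ, m = i • m₀ + j • e) (u t : ℝ) :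
    F (s, φ t (g u)) ∈ range γ ↔ ∃ j : ℤ, t = translateTime H φ g (j • e) (H (g u)) := by
  rw [hF.mem_range_iff hs hFg, ← h.exists_translate_iff hspan, h.crossing_level]

theorem IsTorusFoliation.isMIntegralCurve_flow (hF : IsTorusFoliation J F ψ) (hJ : IsOpen J)
    (hBF : IsTangentToTori J F B) (hs : s ∈ J)
    (hφ : IsFlow (fun θ => torusField F B (s, θ)) φ) (x : ℝ × ℝ) :
    IsMIntegralCurve (I := 𝓡 3) (fun t => F (s, φ t x)) B :=
  isMIntegralCurve_comp hF hJ hBF hs fun t => hφ.deriv t x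

/-- The area is the integral of the return time over the level, so the quotient is its mean: the
limit of orbit averages under an irrational rotation, and in every case the average with weight `w =
dH` along the curve. -/
theorem isMeanReturnTime (hF : IsTorusFoliation J F ψ) (hJ : IsOpen J)
    (hBF : IsTangentToTori J F B) (hs : s ∈ J) (hFg : ∀ u, F (s, g u) = γ u)
    (h : IsTransverseLift f (fun θ => torusField F B (s, θ)) H φ g w m₀)
    (hw : ∀ u, |interiorProduct B (interiorProduct n Ω) (γ u) ![velocity γ u]| = w u) :
    IsMeanReturnTime Ω B n F s γ
      ((∫ x in Ico (0 : ℝ) 1 ×ˢ Ico (0 : ℝ) 1, |f x|) / holonomy H m₀) := by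
  obtain ⟨e, hspan, he⟩ := h.exists_complement
  have hret := hF.return_iff hs hFg h hspan
  have hmono := h.strictMono_translateTime he
  have hzero : ∀ u, F (s, φ 0 (g u)) = γ u := fun u => by rw [h.flow.zero, hFg]
  rw [← h.integral_translateTime hspan he]
  refine ⟨?_, fun _ => ?_⟩
  · rintro ⟨ι, hι, hwind⟩ u
    have hirr := h.irrational_of_tendsto he hι fun x => hwind (fun t => φ t x)
      (h.flow.continuous_time x) (hF.isMIntegralCurve_flow hJ hBF hs h.flow x)
    refine ⟨_, hF.isMIntegralCurve_flow hJ hBF hs h.flow (g u), hzero u,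
      fun k => translateTime H φ g ((k : ℤ) • e) (H (g u)), ?_, ?_, ?_,
      h.tendsto_translateTime_div hirr _⟩
    · simpa using h.translateTime_zero (H (g u))
    · exact fun i j hij => hmono (H (g u)) (by exact_mod_cast hij)
    · ext r
      rw [mem_ofPred_eq, hret]
      constructor
      · rintro ⟨k, rfl⟩
        refine ⟨?_, k, rfl⟩
        have := (hmono (H (g u))).monotone (Int.natCast_nonneg k)
        simpa [h.translateTime_zero] using this
      · rintro ⟨hr, j, rfl⟩
        have h0 : (0 : ℤ) ≤ j := by
          by_contra hj
          have := hmono (H (g u)) (not_le.1 hj)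
          simp only [zero_smul, h.translateTime_zero] at this
          exact absurd hr (not_le.2 this)
        exact ⟨j.toNat, by simp only [Int.toNat_of_nonneg h0]⟩
  · have hTc : Continuous fun u => translateTime H φ g e (H (g u)) :=
      (h.continuous_translateTime e).comp h.continuous_level
    simp only [IsAreaMeanReturnTime, hw]
    refine ⟨fun u => translateTime H φ g e (H (g u)), fun u => ?_,
      h.rate_continuous.intervalIntegrable _ _,
      (hTc.mul h.rate_continuous).intervalIntegrable _ _, ?_, ?_⟩
    · refine ⟨_, hF.isMIntegralCurve_flow hJ hBF hs h.flow (g u), hzero u, he _,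
        (hret u _).2 ⟨1, by rw [one_smul]⟩, fun t ht htr => ?_⟩
      obtain ⟨j, rfl⟩ := (hret u t).1 htr
      have h0 : 0 < j := (hmono (H (g u))).lt_iff_lt.1 (by
        simpa [h.translateTime_zero] using ht.1)
      -- Meetings with the curve correspond monotonically to integers, and none lies strictly
      -- between 0 and 1.
      have h1 : j < 1 := (hmono (H (g u))).lt_iff_lt.1 (by simpa using ht.2)
      omega
    · rw [h.integral_rate]
      exact h.holonomy_pos
    · rw [h.integral_rate, h.integral_translateTime_mul_rate]

/-- The orientation hypothesis says precisely that `H` increases along the lift, and the induced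
density `|i_B 𝒜|` is the rate of that increase. -/
theorem isTransverseLift (hF : IsTorusFoliation J F ψ) (hJ : IsOpen J)
    (hBF : IsTangentToTori J F B) (hn : IsTransverseField J F ψ n) (hs : s ∈ J)
    (hγ : IsTransverseClosedCurve B (torus F s) γ)
    (hγo : ∀ u, 0 < Ω (γ u) ![n (γ u), velocity γ u, B (γ u)])
    (hH : IsStreamFunction (fun θ => torusDensity F Ω (s, θ)) (fun θ => torusField F B (s, θ)) H)
    (hφ : IsFlow (fun θ => torusField F B (s, θ)) φ) (hFg : ∀ u, F (s, g u) = γ u)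
    (hg : ContDiff ℝ 1 g) (hadd : ∀ u, g (u + 1) = g u + latticeVec m₀) :
    IsTransverseLift (fun θ => torusDensity F Ω (s, θ)) (fun θ => torusField F B (s, θ)) H φ g
        (fun u => torusDensity F Ω (s, g u) * ((torusField F B (s, g u)).2 * (deriv g u).1
          - (torusField F B (s, g u)).1 * (deriv g u).2)) m₀ ∧
      ∀ u, |interiorProduct B (interiorProduct n Ω) (γ u) ![velocity γ u]|
        = torusDensity F Ω (s, g u) * ((torusField F B (s, g u)).2 * (deriv g u).1
          - (torusField F B (s, g u)).1 * (deriv g u).2) := by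
  have hgd : ∀ u, HasDerivAt g (deriv g u) u := fun u =>
    ((hg.differentiable (by simp)) u).hasDerivAt
  have hg' : Continuous (deriv g) := hg.continuous_deriv (by simp)
  have hvel := fun u => hF.velocity_eq hJ hs hFg (hgd u)
  have hfr := fun u => hn.volume_apply (Ω := Ω) hF hJ hBF (p := (s, g u)) hs (deriv g u)
  obtain rfl : (fun u => F (s, g u)) = γ := funext hFg
  have hpos : ∀ u, 0 < torusDensity F Ω (s, g u) * ((torusField F B (s, g u)).2 * (deriv g u).1
      - (torusField F B (s, g u)).1 * (deriv g u).2) := by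
    intro u
    have := hγo u
    rw [hvel u] at this
    rwa [← (hfr u).1]
  refine ⟨⟨hH, hφ, hg.continuous, hadd, fun u u' m h => ?_, fun u => hH.hasDerivAt_comp (hgd u),
    hpos, ?_⟩, fun u => ?_⟩
  · exact hγ.exists_eq_add_int ((hF.apply_eq_iff hs).2 ⟨m, h⟩).symm
  · have h1 := hH.contDiff_density.continuous.comp hg.continuous
    have h2 := hH.contDiff_field.continuous.comp hg.continuous
    exact h1.mul ((h2.snd.mul hg'.fst).sub (h2.fst.mul hg'.snd))
  · have e : interiorProduct B (interiorProduct n Ω) (F (s, g u))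
        ![velocity (fun u => F (s, g u)) u]
        = Ω (F (s, g u)) ![n (F (s, g u)), B (F (s, g u)), velocity (fun u => F (s, g u)) u] := rfl
    rw [e, hvel u, (hfr u).2, abs_neg, abs_of_pos (hpos u)]

/-- Replaces the curve by the straight loop in its class. The result depends smoothly enough on the
label, although the curves vary only continuously. -/
theorem lineIntegral_eq (hF : IsTorusFoliation J F ψ) (hJ : IsOpen J) (hs : s ∈ J)
    (hT : IsTorusField J (torusDensity F Ω) (torusField F B) (torusPotential F α))
    (hFg : ∀ u, F (s, g u) = γ u) (hg : ContDiff ℝ 1 g)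
    (hadd : ∀ u, g (u + 1) = g u + latticeVec m₀) :
    lineIntegral α γ = ∫ t in (0 : ℝ)..1, (torusPotential F α 1 (s, t • latticeVec m₀) * m₀.1
      + torusPotential F α 2 (s, t • latticeVec m₀) * m₀.2) := by
  have hgd : ∀ u, HasDerivAt g (deriv g u) u := fun u =>
    ((hg.differentiable (by simp)) u).hasDerivAt
  have hg' : Continuous (deriv g) := hg.continuous_deriv (by simp)
  have hvel := fun u => hF.velocity_eq hJ hs hFg (hgd u)
  rw [← hT.integral_potential_eq hs hgd hg' (by simpa using hadd 0)]
  refine intervalIntegral.integral_congr fun u _ => ?_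
  obtain rfl : (fun u => F (s, g u)) = γ := funext hFg
  have h1 : ((0 : ℝ), deriv g u) = (deriv g u).1 • paramVec 1 + (deriv g u).2 • paramVec 2 := by
    simp [paramVec]
  have h2 : α (F (s, g u)) ![velocity (fun u => F (s, g u)) u]
      = pullForm F α (s, g u) ![((0 : ℝ), deriv g u)] := by
    rw [hvel u, pullForm_apply]
    refine congrArg (α (F (s, g u))) (funext fun k => ?_)
    fin_cases k
    rfl
  have h3 : ∀ x, pullForm F α (s, g u) ![x]
      = ((pullForm F α (s, g u)).toContinuousMultilinearMap.toContinuousLinearMap 0 0) x := by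
    intro x
    refine congrArg (pullForm F α (s, g u)) (funext fun k => ?_)
    fin_cases k
    simp
  refine h2.trans ?_
  rw [h1, h3, map_add, map_smul, map_smul, ← h3, ← h3]
  simp [torusPotential, mul_comm]

end Orbits

end MeanReturnTime

/-! ### The derivative of the volume as mean return time times the derivative of the flux -/

theorem theorem4 {M : Type*} [TopologicalSpace M] [T2Space M] [ChartedSpace R3 M]
    [IsManifold (𝓡 3) ∞ M] [MeasurableSpace M] [BorelSpace M]
    (Ω : ∀ x : M, (TangentSpace (𝓡 3) x) [⋀^Fin 3]→L[ℝ] ℝ) (hΩ : IsVolumeForm Ω)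
    (B : ∀ x : M, TangentSpace (𝓡 3) x)
    (α : ∀ x : M, (TangentSpace (𝓡 3) x) [⋀^Fin 1]→L[ℝ] ℝ) (hB : IsMagneticField Ω B α)
    (J : Set ℝ) (hJ : IsOpen J) (hJ' : J.OrdConnected)
    (F : ℝ × (ℝ × ℝ) → M) (ψ : M → ℝ) (hF : IsTorusFoliation J F ψ)
    (hBF : IsTangentToTori J F B)
    (hB0 : ∀ s ∈ J, ∀ x ∈ torus F s, B x ≠ 0)
    (n : ∀ x : M, TangentSpace (𝓡 3) x) (hn : IsTransverseField J F ψ n)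
    (γ : ℝ → ℝ → M)
    (hγ : ∀ s ∈ J, IsTransverseClosedCurve B (torus F s) (γ s))
    (hγc : ContinuousOn (fun p : ℝ × ℝ => γ p.1 p.2) (J ×ˢ univ))
    (hγo : ∀ s ∈ J, ∀ u, 0 < Ω (γ s u) ![n (γ s u), velocity (γ s) u, B (γ s u)])
    (V : ℝ → ℝ) (hV : IsEnclosedVolume Ω J F V) :
    ∃ Tbar : ℝ → ℝ, ∀ s ∈ J,
      IsMeanReturnTime Ω B n F s (γ s) (Tbar s) ∧
      DifferentiableAt ℝ (fun r => lineIntegral α (γ r)) s ∧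
      HasDerivAt V (Tbar s * deriv (fun r => lineIntegral α (γ r)) s) s := by
  have hT := isTorusField hΩ hB hJ hF hBF hB0
  rcases J.eq_empty_or_nonempty with rfl | hne
  · exact ⟨0, fun s hs => hs.elim⟩
  obtain ⟨g, hgc, hFg⟩ := hF.exists_continuous_lift hJ hJ' hne (fun s hs => (hγ s hs).mem) hγc
  obtain ⟨m₀, hadd⟩ := hF.exists_lift_add_one hJ' (fun s hs => (hγ s hs).periodic) hgc hFg
  have hg : ∀ s ∈ J, ContDiff ℝ 1 (g s) := fun s hs =>
    hF.contDiff_lift hJ hs (hγ s hs).contMDiff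
      (hgc.comp_continuous (f := fun u : ℝ => (s, u)) (by fun_prop) fun u => ⟨hs, trivial⟩)
      (hFg s hs)
  -- The quotient `V' / Φ'`; its denominator is the positive holonomy of the class `m₀`.
  refine ⟨fun s => (∫ θ in Ico (0 : ℝ) 1 ×ˢ Ico (0 : ℝ) 1, |torusDensity F Ω (s, θ)|)
    / deriv (fun r => lineIntegral α (γ r)) s, fun s hs => ?_⟩
  obtain ⟨H, hH⟩ := hT.exists_isStreamFunction hs
  obtain ⟨φ, hφ⟩ := exists_isFlow_of_lattice_periodic hH.contDiff_field hH.field_periodic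
  obtain ⟨hlift, hrate⟩ := isTransverseLift hF hJ hBF hn hs (hγ s hs) (hγo s hs) hH hφ (hFg s hs)
    (hg s hs) (hadd s hs)
  have hΦ : HasDerivAt (fun r => lineIntegral α (γ r)) (holonomy H m₀) s := by
    refine (hT.hasDerivAt_period hs hH m₀).congr_of_eventuallyEq ?_
    filter_upwards [hJ.mem_nhds hs] with r hr
      using lineIntegral_eq hF hJ hr hT (hFg r hr) (hg r hr) (hadd r hr)
  have hV' := hF.hasDerivAt_enclosedVolume hJ hJ' hΩ hV hs
  refine ⟨?_, hΦ.differentiableAt, ?_⟩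
  · simp only [hΦ.deriv]
    exact isMeanReturnTime hF hJ hBF hs (hFg s hs) hlift hrate
  · simp only [hΦ.deriv]
    rwa [div_mul_cancel₀ _ hlift.holonomy_pos.ne']
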